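/- **Setting.** Every tuple has a type, its relation name; each relation has infinitely many tuples; a database $\mathbf D$ assigns to each relation $R$ a finite set of tuples of type $R$. An operation on $x$ is a read $\mathtt R[x]$, a write $\mathtt W[x]$ or an atomic update $\mathtt U[x]$, with finite attribute sets $\mathrm{ReadSet}$, $\mathrm{WriteSet}$ ($\mathrm{WriteSet}=\emptyset$ for $\mathtt R$, $\mathrm{ReadSet}=\emptyset$ for $\mathtt W$). $\mathtt R,\mathtt U$ are read operations and $\mathtt W,\mathtt U$ are write operations. A transaction is a finite sequence of operations on tuples followed by a commit; a template is a finite sequence of operations on typed variables. An operation $b$ is ww-, wr-, rw-conflicting with $a$ if they are on the same tuple, belong to different transactions, and $\mathrm{WriteSet}(b)\cap\mathrm{WriteSet}(a)$, $\mathrm{WriteSet}(b)\cap\mathrm{ReadSet}(a)$, $\mathrm{ReadSet}(b)\cap\mathrm{WriteSet}(a)$, respectively, is non-empty. A schedule $s$ over a finite set $\mathcal T$ of transactions (with distinct ids) consists of a total order $<_s$ of all operations and commits that extends the order of each transaction, a total order $\ll_s$ of the write operations on each tuple, and a map $v_s$ from read operations $a$ to either the initial version $op_0$ or a write operation $v_s(a)\neq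 a$ on the same tuple with $v_s(a)<_s a$; $op_0$ comes first in both orders. An operation $a$ depends on $b$ if $b$ is ww-conflicting with $a$ and $b\ll_s a$, or $b$ is wr-conflicting with $a$ and $b=v_s(a)$ or $b\ll_s v_s(a)$, or $b$ is rw-conflicting with $a$ and $v_s(b)\ll_s a$ (an rw-antidependency from $b$ to $a$). The schedule $s$ is conflict-serializable if it has the same dependencies as some schedule over $\mathcal T$ without interleaving of transactions, in which $\ll$ agrees with $<$ and each read operation reads the last version written before it. Let $\mathrm{first}(T)$ be the first operation of $T$ and $C_T$ its commit. $T,T'$ are concurrent if $\mathrm{first}(T)<_sC_{T'}$ and $\mathrm{first}(T')<_sC_T$. $T$ is allowed under RC if (i) for each write operation $a\in T$ and each write operation $b$ on the same tuple in another transaction $T'$: $a\ll_s b$ iff $C_T<_sC_{T'}$; (ii) for each read operation $a\in T$ and $e=a$: $v_s(a)$ is $op_0$ or its transaction commits before $e$, and no write operation $w$ on the tuple of $a$, in a transaction committing before $e$, has $v_s(a)\ll_s w$; (iii) there are no ww-conflicting $b\in T'\neq T$ and $a\in T$ with $b<_sa<_sC_{T'}$. $T$ is allowed under SI if (i) holds,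 (ii) holds with $e=\mathrm{first}(T)$, and there are no ww-conflicting $b\in T'\ne T$ and $a\in T$ with $b<_sa$ and $\mathrm{first}(T)<_sC_{T'}$. A dangerous structure $T_1\to T_2\to T_3$ ($T_1=T_3$ is possible) consists of rw-antidependencies from $T_1$ to $T_2$ and from $T_2$ to $T_3$, with $T_1,T_2$ concurrent, $T_2,T_3$ concurrent, $C_{T_3}\le_sC_{T_1}$, $C_{T_3}<_sC_{T_2}$ and, if $T_1$ has no write operation, $C_{T_3}<_s\mathrm{first}(T_1)$. For $\mathcal A:\mathcal T\to\{\mathrm{RC},\mathrm{SI},\mathrm{SSI}\}$, $s$ is allowed under $\mathcal A$ if each $T$ with $\mathcal A(T)=\mathrm{RC}$ is allowed under RC, all others are allowed under SI, and there is no dangerous structure of transactions mapped to SSI. A finite set $\mathcal P$ of templates is robust against $\mathcal A^{\mathcal P}:\mathcal P\to\{\mathrm{RC},\mathrm{SI},\mathrm{SSI}\}$ if for every database $\mathbf D$, every finite set $\mathcal T$ of transactions and every $\mathcal A$ such that each $T\in\mathcal T$ arises from some $\tau\in\mathcal P$ with $\mathcal A(T)=\mathcal A^{\mathcal P}(\tau)$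 by a type-respecting replacement of its variables by tuples of $\mathbf D$, every schedule over $\mathcal T$ allowed under $\mathcal A$ is conflict-serializable. **Algorithm.** Operations of templates are potentially (ww-, wr-, rw-) conflicting if their variables have the same type and the corresponding attribute sets meet; $\mathrm{var}(o)$ is the variable of $o$. Loop over all $\tau_1\in\mathcal P$, $o_1,p_1\in\tau_1$, and $h\in H$, where $H=\{1\}$ if $\mathrm{var}(o_1)=\mathrm{var}(p_1)$ and $H=\{1,2\}$ otherwise. Build the graph with the nodes $(\tau,o,c,k)$, $\tau\in\mathcal P$, $o\in\tau$, $c\in\{O,P,N\}$, $k\in\{\mathrm{in},\mathrm{out}\}$, such that: if $c=O$, or $h=1$ and $c=P$, no operation of $\tau_1$ over $\mathrm{var}(o_1)$ is potentially conflicting with an operation of $\tau$ over $\mathrm{var}(o)$; if $c=P$, or $h=1$ and $c=O$, the same with $\mathrm{var}(p_1)$. There is an edge from $(\tau,o,c,\mathrm{out})$ to $(\tau',o',c,\mathrm{in})$ if $o,o'$ are potentially conflicting, and from $(\tau,o,c,\mathrm{in})$ to $(\tau,o',c',\mathrm{out})$ if $\mathrm{var}(o)\ne\mathrm{var}(o')$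 and $(c,c')\in\{(O,P),(O,N),(N,N),(N,P)\}$, or $\mathrm{var}(o)=\mathrm{var}(o')$ and either $c=c'$ or $h=1$, $c=O$, $c'=P$. Compute its transitive closure $TC$. Loop over all $\tau_2,\tau_n\in\mathcal P$, $o_2,p_2\in\tau_2$, $o_n,p_n\in\tau_n$ with $o_1,p_2$ and $o_n,p_1$ potentially conflicting; $c_2\in\{O\}$ if $\mathrm{var}(o_2)=\mathrm{var}(p_2)$, else $c_2\in\{N,P\}$; $c_n\in\{P\}$ if $\mathrm{var}(o_n)=\mathrm{var}(p_n)$, else $c_n\in\{N,O\}$. Return False if Reachable and ValidSchedule both hold for some choice; otherwise return True at the end. *Reachable:* let $S$ be the condition $h=1$, $c_2=O$, $c_n=P$. It holds if (a) $(\tau_2,o_2,p_2)=(\tau_n,o_n,p_n)$ and ($c_2=P$, $c_n=O$, or $S$); or (b) $o_2,p_n$ are potentially conflicting and ($c_2=c_n$ or $S$); or (c) $TC$ has an edge from $(\tau,o,c_2,\mathrm{in})$ to $(\tau',o',c_n,\mathrm{out})$ with $o,o_2$ and $o',p_n$ potentially conflicting. *ValidSchedule:* $\mathrm{var}(o_1)$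 has label $O$, $\mathrm{var}(p_1)$ has label $P$; in $\tau_2$, $\mathrm{var}(p_2)$ has label $O$ and $\mathrm{var}(o_2)$ has label $c_2$; in $\tau_n$, $\mathrm{var}(o_n)$ has label $P$ and $\mathrm{var}(p_n)$ has label $c_n$. A variable of $\tau_1$ and one of $\tau_2$ (or $\tau_n$) are connected if they share the label $O$ or $P$, or if $h=1$ and both have a label in $\{O,P\}$. It holds if: no operation of $\tau_1$ up to and including $o_1$ is potentially ww-conflicting with an operation of $\tau_2$ or $\tau_n$ over a connected variable; if $\mathcal A^{\mathcal P}(\tau_1)\neq\mathrm{RC}$, neither is any later operation of $\tau_1$; $o_1$ is potentially rw-conflicting with $p_2$; $o_n$ is potentially rw-conflicting with $p_1$, or $\mathcal A^{\mathcal P}(\tau_1)=\mathrm{RC}$ and $o_1$ is strictly before $p_1$ in $\tau_1$; $\tau_1,\tau_2,\tau_n$ are not all mapped to SSI; if $\tau_1,\tau_2$ are mapped to SSI, no operation of $\tau_1$ is potentially wr-conflicting with one of $\tau_2$ over a connected variable; if $\tau_1,\tau_n$ are mapped to SSI, no operation of $\tau_1$ is potentially rw-conflicting with one of $\tau_n$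 over a connected variable. **Theorem.** For every finite set $\mathcal P$ of templates and every template allocation $\mathcal A^{\mathcal P}:\mathcal P\to\{\mathrm{RC},\mathrm{SI},\mathrm{SSI}\}$, this algorithm returns True if and only if $\mathcal P$ is robust against $\mathcal A^{\mathcal P}$. Moreover there is a polynomial $p$ such that for all $\mathcal P$ and $\mathcal A^{\mathcal P}$ the algorithm takes at most $p(\|\mathcal P\|)$ steps, where $\|\mathcal P\|$ is the length of a binary description of $\mathcal P$, every iteration of a loop and every list cell built costs a step, and comparing two names costs one plus the sum of their bit lengths. -/

import Mathlib

namespace TemplateRobustness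

/-! ### Operations, transactions and templates

Relation names, attribute names and variable names are natural numbers. A finite set of attributes
is given by a list. -/

/-- A read `R[x]`, a write `W[x]` or an atomic update `U[x]` on a location `x` (a tuple or a
variable), with the set `rs` of attributes that are read and the set `ws` of attributes that are
written. -/
inductive Op (α : Type) where
  | read (x : α) (rs : List ℕ)
  | write (x : α) (ws : List ℕ)
  | update (x : α) (rs ws : List ℕ)

namespace Op

variable {α β : Type}

def loc : Op α → α
  | read x _ => x
  | write x _ => x
  | update x _ _ => x

def readSet : Op α → List ℕ
  | read _ rs => rs
  | write _ _ => []
  | update _ rs _ => rs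

def writeSet : Op α → List ℕ
  | read _ _ => []
  | write _ ws => ws
  | update _ _ ws => ws

/-- `R`- and `U`-operations are read operations. -/
def IsRead : Op α → Prop
  | read _ _ => True
  | write _ _ => False
  | update _ _ _ => True

/-- `W`- and `U`-operations are write operations. -/
def IsWrite : Op α → Prop
  | read _ _ => False
  | write _ _ => True
  | update _ _ _ => True

def map (f : α → β) : Op α → Op β
  | read x rs => read (f x) rs
  | write x ws => write (f x) ws
  | update x rs ws => update (f x) rs ws

/-- The three ways in which the attribute sets of two operations can meet. -/
def WW (b a : Op α) : Prop := ∃ x ∈ b.writeSet, x ∈ a.writeSet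
def WR (b a : Op α) : Prop := ∃ x ∈ b.writeSet, x ∈ a.readSet
def RW (b a : Op α) : Prop := ∃ x ∈ b.readSet, x ∈ a.writeSet

end Op

/-- Tuples; every relation name `rel` has infinitely many of them. -/
structure Tuple where
  rel : ℕ
  id : ℕ

/-- Typed variables: `rel` is the relation name that is the type of the variable. -/
structure Var where
  rel : ℕ
  name : ℕ

/-- The read and write operations of a transaction in their order; the commit that concludes the
transaction is implicit. -/
abbrev Transaction := List (Op Tuple)

abbrev Template := List (Op Var)

/-! ### Schedules

A finite set of transactions is a family `T : Fin m → Transaction`, the index being the id. -/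

section Schedules

variable {m : ℕ}

/-- An operation occurrence `⟨i, k⟩`: the `k`-th operation of transaction `i`. -/
abbrev OpRef (T : Fin m → Transaction) := Σ i : Fin m, Fin (T i).length

def OpRef.get {T : Fin m → Transaction} (r : OpRef T) : Op Tuple := (T r.1).get r.2

def OpRef.tuple {T : Fin m → Transaction} (r : OpRef T) : Tuple := (OpRef.get r).loc

def OpRef.WritesOn {T : Fin m → Transaction} (r : OpRef T) (t : Tuple) : Prop :=
  (OpRef.get r).IsWrite ∧ OpRef.tuple r = t

inductive Event (T : Fin m → Transaction) where
  | op (r : OpRef T)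
  | commit (i : Fin m)

/-- The transaction to which an event belongs. -/
def Event.txn {T : Fin m → Transaction} : Event T → Fin m
  | .op r => r.1
  | .commit i => i

/-- The first operation of a transaction (its commit if there is no other one). -/
def first (T : Fin m → Transaction) (i : Fin m) : Event T :=
  if h : 0 < (T i).length then .op ⟨i, ⟨0, h⟩⟩ else .commit i

/-- A multiversion schedule. The special operation `op₀`, which writes the initial versions, is
implicit: it precedes every event and every version, and as a value of the version function it is
`none`. The version order is a total order on the write operations on each tuple `t`; the version
function `ver` matters on read operations only. -/
structure Schedule (T : Fin m → Transaction) where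
  lt : Event T → Event T → Prop
  lt_order : IsStrictTotalOrder (Event T) lt
  lt_of_lt : ∀ (i : Fin m) (k l : Fin (T i).length), k < l → lt (.op ⟨i, k⟩) (.op ⟨i, l⟩)
  lt_commit : ∀ r : OpRef T, lt (.op r) (.commit r.1)
  vlt : Tuple → OpRef T → OpRef T → Prop
  vlt_order : ∀ t, IsStrictTotalOrder {r : OpRef T // OpRef.WritesOn r t} (fun a b => vlt t a b)
  ver : OpRef T → Option (OpRef T)
  ver_spec : ∀ a w, (OpRef.get a).IsRead → ver a = some w →
    OpRef.WritesOn w (OpRef.tuple a) ∧ w ≠ a ∧ lt (.op w) (.op a)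

variable {T : Fin m → Transaction}

namespace Schedule

/-- `v ≪ a` for a version `v` (possibly the initial one) and a write operation `a` on `t`. -/
def VerLt (s : Schedule T) (t : Tuple) : Option (OpRef T) → OpRef T → Prop
  | none, _ => True
  | some w, a => s.vlt t w a

/-- Operations on the same tuple from different transactions. -/
def Meet (b a : OpRef T) : Prop := b.1 ≠ a.1 ∧ OpRef.tuple b = OpRef.tuple a

def Conflicting (b a : OpRef T) : Prop :=
  Meet b a ∧ ((OpRef.get b).WW (OpRef.get a) ∨ (OpRef.get b).WR (OpRef.get a) ∨
    (OpRef.get b).RW (OpRef.get a))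

def WWDep (s : Schedule T) (b a : OpRef T) : Prop :=
  Meet b a ∧ (OpRef.get b).WW (OpRef.get a) ∧ s.vlt (OpRef.tuple a) b a

def WRDep (s : Schedule T) (b a : OpRef T) : Prop :=
  Meet b a ∧ (OpRef.get b).WR (OpRef.get a) ∧
    ∃ w, s.ver a = some w ∧ (b = w ∨ s.vlt (OpRef.tuple a) b w)

def RWDep (s : Schedule T) (b a : OpRef T) : Prop :=
  Meet b a ∧ (OpRef.get b).RW (OpRef.get a) ∧ s.VerLt (OpRef.tuple a) (s.ver b) a

/-- `b →ₛ a`: the operation `a` depends on `b`. -/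
def Dep (s : Schedule T) (b a : OpRef T) : Prop := s.WWDep b a ∨ s.WRDep b a ∨ s.RWDep b a

def ConflictEquivalent (s s' : Schedule T) : Prop :=
  ∀ b a : OpRef T, Conflicting b a → (s.Dep b a ↔ s'.Dep b a)

/-- The version order is compatible with the order of the schedule, and every read operation reads
the last written version. -/
def SingleVersion (s : Schedule T) : Prop :=
  (∀ t a b, OpRef.WritesOn a t → OpRef.WritesOn b t → (s.vlt t a b ↔ s.lt (.op a) (.op b))) ∧
  ∀ a, (OpRef.get a).IsRead → ¬ ∃ c, OpRef.WritesOn c (OpRef.tuple a) ∧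
    (∀ w, s.ver a = some w → s.lt (.op w) (.op c)) ∧ s.lt (.op c) (.op a)

/-- Transactions are not interleaved. -/
def Serial (s : Schedule T) : Prop :=
  ∀ a b c : Event T, s.lt a b → s.lt b c → a.txn = c.txn → b.txn = a.txn

def ConflictSerializable (s : Schedule T) : Prop :=
  ∃ s' : Schedule T, s'.SingleVersion ∧ s'.Serial ∧ s.ConflictEquivalent s'

/-! ### Isolation levels -/

def Concurrent (s : Schedule T) (i j : Fin m) : Prop :=
  s.lt (first T i) (.commit j) ∧ s.lt (first T j) (.commit i)

def RespectsCommitOrder (s : Schedule T) (a : OpRef T) : Prop :=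
  ∀ b : OpRef T, b.1 ≠ a.1 → OpRef.WritesOn b (OpRef.tuple a) →
    (s.vlt (OpRef.tuple a) a b ↔ s.lt (.commit a.1) (.commit b.1))

/-- The read operation `a` is read-last-committed relative to the event `e`. -/
def ReadLastCommitted (s : Schedule T) (a : OpRef T) (e : Event T) : Prop :=
  (∀ w, s.ver a = some w → s.lt (.commit w.1) e) ∧
  ¬ ∃ w, OpRef.WritesOn w (OpRef.tuple a) ∧ s.lt (.commit w.1) e ∧
    s.VerLt (OpRef.tuple a) (s.ver a) w

/-- Transaction `j` overwrites attributes written earlier by a concurrent transaction. -/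
def ConcurrentWrite (s : Schedule T) (j : Fin m) : Prop :=
  ∃ b a : OpRef T, a.1 = j ∧ Meet b a ∧ (OpRef.get b).WW (OpRef.get a) ∧
    s.lt (.op b) (.op a) ∧ s.lt (first T j) (.commit b.1)

/-- Transaction `j` overwrites attributes written earlier by a transaction that has not yet
committed. -/
def DirtyWrite (s : Schedule T) (j : Fin m) : Prop :=
  ∃ b a : OpRef T, a.1 = j ∧ Meet b a ∧ (OpRef.get b).WW (OpRef.get a) ∧
    s.lt (.op b) (.op a) ∧ s.lt (.op a) (.commit b.1)

def AllowedRC (s : Schedule T) (i : Fin m) : Prop :=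
  (∀ a : OpRef T, a.1 = i → (OpRef.get a).IsWrite → s.RespectsCommitOrder a) ∧
  (∀ a : OpRef T, a.1 = i → (OpRef.get a).IsRead → s.ReadLastCommitted a (.op a)) ∧
  ¬ s.DirtyWrite i

def AllowedSI (s : Schedule T) (i : Fin m) : Prop :=
  (∀ a : OpRef T, a.1 = i → (OpRef.get a).IsWrite → s.RespectsCommitOrder a) ∧
  (∀ a : OpRef T, a.1 = i → (OpRef.get a).IsRead → s.ReadLastCommitted a (first T i)) ∧
  ¬ s.ConcurrentWrite i

/-- A dangerous structure `i → j → k`; `i` and `k` may be equal. -/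
def Dangerous (s : Schedule T) (i j k : Fin m) : Prop :=
  (∃ b a : OpRef T, b.1 = i ∧ a.1 = j ∧ s.RWDep b a) ∧
  (∃ b a : OpRef T, b.1 = j ∧ a.1 = k ∧ s.RWDep b a) ∧
  s.Concurrent i j ∧ s.Concurrent j k ∧
  (k = i ∨ s.lt (.commit k) (.commit i)) ∧ s.lt (.commit k) (.commit j) ∧
  ((∀ o ∈ T i, ¬ o.IsWrite) → s.lt (.commit k) (first T i))

end Schedule

inductive Level where
  | RC | SI | SSI
  deriving DecidableEq

def Schedule.Allowed (s : Schedule T) (A : Fin m → Level) : Prop :=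
  (∀ i, A i = .RC → s.AllowedRC i) ∧
  (∀ i, A i = .SI ∨ A i = .SSI → s.AllowedSI i) ∧
  ∀ i j k, A i = .SSI → A j = .SSI → A k = .SSI → ¬ s.Dangerous i j k

/-- A set of transactions is robust against an allocation. -/
def TransactionRobust (T : Fin m → Transaction) (A : Fin m → Level) : Prop :=
  ∀ s : Schedule T, s.Allowed A → s.ConflictSerializable

end Schedules

/-! ### Template robustness -/

/-- `D R` is the finite set of the ids of the tuples of relation `R`. -/
abbrev Database := ℕ → Finset ℕ

/-- The transaction `t` is `μ(τ)` for a type-respecting variable assignment `μ` that maps the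
variables of `τ` to tuples of `D`. -/
def InstantiatedFrom (D : Database) (τ : Template) (t : Transaction) : Prop :=
  ∃ μ : Var → Tuple, (∀ X, (μ X).rel = X.rel) ∧
    (∀ o ∈ τ, (μ o.loc).id ∈ D o.loc.rel) ∧ t = τ.map (Op.map μ)

def RobustOver (P : Set Template) (A : Template → Level) (D : Database) : Prop :=
  ∀ (m : ℕ) (T : Fin m → Transaction) (B : Fin m → Level),
    (∀ i, ∃ τ ∈ P, InstantiatedFrom D τ (T i) ∧ B i = A τ) → TransactionRobust T B

/-- The set `P` of templates is robust against the template allocation `A` (of which only the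
values on `P` matter). -/
def Robust (P : Set Template) (A : Template → Level) : Prop :=
  ∀ D : Database, RobustOver P A D

/-! ### Computations with a step count

`Timed α` is a result together with the number of elementary steps taken. A step is charged for
every element visited in a loop over a list and for every list cell copied or built by a loop;
comparing two natural numbers (names or positions) costs one plus the sum of their bit lengths.
Outside these, the programs below only use projections, case distinctions on constructors and
Boolean connectives, a bounded number of them between two charged steps. -/

structure Timed (α : Type) where
  val : α
  steps : ℕ

namespace Timed

variable {α β : Type}

instance : Monad Timed where
  pure a := ⟨a, 0⟩
  bind x f := ⟨(f x.val).val, x.steps + (f x.val).steps⟩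

def tick (n : ℕ) : Timed Unit := ⟨(), n⟩

/-- `for a in l do if f a then return true`, and `false` at the end. -/
def any : List α → (α → Timed Bool) → Timed Bool
  | [], _ => do tick 1; pure false
  | a :: l, f => do
    tick 1
    if ← f a then pure true else any l f

/-- Concatenates the lists `f a` for `a` in `l`. -/
def collect : List α → (α → Timed (List β)) → Timed (List β)
  | [], _ => do tick 1; pure []
  | a :: l, f => do
    tick 1
    let x ← f a
    let r ← collect l f
    tick x.length
    pure (x ++ r)

def keep (l : List α) (f : α → Timed Bool) : Timed (List α) :=
  collect l fun a => do
    if ← f a then pure [a] else pure []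

/-- Conjunction and disjunction; the second argument is run only if it is needed. -/
def and (x y : Timed Bool) : Timed Bool := do
  tick 1
  if ← x then y else pure false

def or (x y : Timed Bool) : Timed Bool := do
  tick 1
  if ← x then pure true else y

def not (x : Timed Bool) : Timed Bool := do
  tick 1
  let b ← x
  pure (!b)

def eqNat (a b : ℕ) : Timed Bool := do
  tick (1 + a.size + b.size)
  pure (decide (a = b))

def ltNat (a b : ℕ) : Timed Bool := do
  tick (1 + a.size + b.size)
  pure (decide (a < b))

end Timed

/-! ### The algorithm -/

namespace Algo

open Timed

/-- An operation occurrence in the input: the operation `op` at position `pos` of the template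
number `tid`. -/
structure Occ where
  tid : ℕ
  pos : ℕ
  op : Op Var

/-- A template of the input, with its number, its isolation level and its operations. -/
structure InTemplate where
  tid : ℕ
  level : Level
  occs : List Occ

def numberOps (tid : ℕ) : ℕ → Template → Timed (List Occ)
  | _, [] => do tick 1; pure []
  | pos, o :: l => do
    tick (1 + tid.size + pos.size)
    let r ← numberOps tid (pos + 1) l
    pure (⟨tid, pos, o⟩ :: r)

def numberTemplates : ℕ → List (Template × Level) → Timed (List InTemplate)
  | _, [] => do tick 1; pure []
  | tid, x :: l => do
    tick (1 + tid.size)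
    let occs ← numberOps tid 0 x.1
    let r ← numberTemplates (tid + 1) l
    pure (⟨tid, x.2, occs⟩ :: r)

def eqVar (X Y : Var) : Timed Bool := and (eqNat X.rel Y.rel) (eqNat X.name Y.name)

def sameVar (o p : Occ) : Timed Bool := eqVar o.op.loc p.op.loc

def sameOcc (o p : Occ) : Timed Bool := and (eqNat o.tid p.tid) (eqNat o.pos p.pos)

def meets (l l' : List ℕ) : Timed Bool := any l fun a => any l' fun b => eqNat a b

def sameType (o p : Occ) : Timed Bool := eqNat o.op.loc.rel p.op.loc.rel

/-- `o` is potentially ww-, wr-, rw-conflicting with `p`. -/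
def potWW (o p : Occ) : Timed Bool := and (sameType o p) (meets o.op.writeSet p.op.writeSet)
def potWR (o p : Occ) : Timed Bool := and (sameType o p) (meets o.op.writeSet p.op.readSet)
def potRW (o p : Occ) : Timed Bool := and (sameType o p) (meets o.op.readSet p.op.writeSet)

def pot (o p : Occ) : Timed Bool := or (potWW o p) (or (potWR o p) (potRW o p))

/-- Connected to `o₁`, connected to `p₁`, connected to neither. -/
inductive Label where
  | O | P | N
  deriving DecidableEq

inductive Dir where
  | inc | out
  deriving DecidableEq

/-- A node `(τ, o, c, k)`; the template `τ` is determined by the occurrence `o`. -/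
structure Node where
  occ : Occ
  label : Label
  dir : Dir

/-- Some operation of `τ₁` over the same variable as `o₁` is potentially conflicting with an
operation of `τ` over the same variable as `o`. -/
def blocked (τ₁ : InTemplate) (o₁ : Occ) (τ : InTemplate) (o : Occ) : Timed Bool :=
  any τ₁.occs fun o₁' => and (sameVar o₁' o₁) <|
    any τ.occs fun o' => and (sameVar o' o) (pot o₁' o')

/-- The nodes of the pt-conflict-graph. The value `h = true` stands for `h = 1` (`o₁` and `p₁` are
taken to be connected, so that the labels `O` and `P` both mean connected to both of them) and
`h = false` for `h = 2`. -/
def nodes (o₁ p₁ : Occ) (τ₁ : InTemplate) (h : Bool) (P : List InTemplate) :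
    Timed (List Node) :=
  collect P fun τ => collect τ.occs fun o => collect [Label.O, Label.P, Label.N] fun c => do
    let excluded ← or
      (and (pure (decide (c = .O) || (h && decide (c = .P)))) (blocked τ₁ o₁ τ o))
      (and (pure (decide (c = .P) || (h && decide (c = .O)))) (blocked τ₁ p₁ τ o))
    if excluded then pure [] else pure [⟨o, c, .inc⟩, ⟨o, c, .out⟩]

/-- The label pairs that are possible between two different variables of a template. -/
def breakPair : Label → Label → Bool
  | .O, .P => true
  | .O, .N => true
  | .N, .N => true
  | .N, .P => true
  | _, _ => false

/-- The edges of the pt-conflict-graph. -/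
def isEdge (h : Bool) (x y : Node) : Timed Bool :=
  match x.dir, y.dir with
  | .out, .inc => and (pure (decide (x.label = y.label))) (pot x.occ y.occ)
  | .inc, .out => and (eqNat x.occ.tid y.occ.tid) <| do
      if ← sameVar x.occ y.occ then
        pure (decide (x.label = y.label) ||
          (decide (x.label = .O) && decide (y.label = .P) && h))
      else pure (breakPair x.label y.label)
  | _, _ => do tick 1; pure false

def sameNode (x y : Node) : Timed Bool :=
  and (sameOcc x.occ y.occ) (pure (decide (x.label = y.label) && decide (x.dir = y.dir)))

def edges (h : Bool) (V : List Node) : Timed (List (Node × Node)) :=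
  collect V fun x => collect V fun y => do
    if ← isEdge h x y then pure [(x, y)] else pure []

def isListed (E : List (Node × Node)) (x y : Node) : Timed Bool :=
  any E fun e => and (sameNode e.1 x) (sameNode e.2 y)

/-- One round: adds the pairs that are joined by a listed pair followed by an edge of `E`. -/
def extend (V : List Node) (E F : List (Node × Node)) : Timed (List (Node × Node)) :=
  collect V fun x => collect V fun y => do
    if ← or (isListed F x y) (any V fun z => and (isListed F x z) (isListed E z y))
      then pure [(x, y)] else pure []

/-- One round for every element of the first list. -/
def rounds (V : List Node) (E : List (Node × Node)) :
    List Node → List (Node × Node) → Timed (List (Node × Node))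
  | [], F => do tick 1; pure F
  | _ :: l, F => do
    tick 1
    let F' ← extend V E F
    rounds V E l F'

/-- The transitive closure of the graph with nodes `V` and edges `E`. -/
def transClosure (V : List Node) (E : List (Node × Node)) : Timed (List (Node × Node)) :=
  rounds V E V E

def reachable (o₂ p₂ : Occ) (c₂ : Label) (oₙ pₙ : Occ) (cₙ : Label) (h : Bool)
    (TC : List (Node × Node)) : Timed Bool :=
  -- a cycle of two templates
  or (and (and (sameOcc o₂ oₙ) (sameOcc p₂ pₙ))
      (pure ((decide (c₂ = .P) && decide (cₙ = .O)) ||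
        (h && decide (c₂ = .O) && decide (cₙ = .P))))) <|
  -- a cycle of three templates
  or (and (pot o₂ pₙ)
      (pure (decide (c₂ = cₙ) || (h && decide (c₂ = .O) && decide (cₙ = .P))))) <|
  -- a longer cycle
  any TC fun e =>
    and (pure (decide (e.1.dir = .inc) && decide (e.2.dir = .out) &&
      decide (e.1.label = c₂) && decide (e.2.label = cₙ)))
    (and (pot e.1.occ o₂) (pot e.2.occ pₙ))

/-- A variable `X` of `τ₁` is connected to a variable `Y` of a template in which `q` is connected
to `o₁` or `p₁` as the label `d` says, and `q'` as the label `d'` says, while no other variable is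
connected to these. -/
def connected (o₁ p₁ : Occ) (h : Bool) (q : Occ) (d : Label) (q' : Occ) (d' : Label)
    (X Y : Var) : Timed Bool := do
  let xO ← eqVar X o₁.op.loc
  let xP ← eqVar X p₁.op.loc
  let y ← eqVar Y q.op.loc
  let y' ← eqVar Y q'.op.loc
  let yO := (y && decide (d = .O)) || (y' && decide (d' = .O))
  let yP := (y && decide (d = .P)) || (y' && decide (d' = .P))
  pure ((xO && yO) || (xP && yP) || (h && (xO || xP) && (yO || yP)))

/-- Some operations of `l` and `l'` over connected variables satisfy `test`. -/
def clash (test : Occ → Occ → Timed Bool) (conn : Var → Var → Timed Bool)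
    (l l' : List Occ) : Timed Bool :=
  any l fun o => any l' fun p => and (test o p) (conn o.op.loc p.op.loc)

def validSchedule (τ₁ : InTemplate) (o₁ p₁ : Occ) (τ₂ : InTemplate) (o₂ p₂ : Occ) (c₂ : Label)
    (τₙ : InTemplate) (oₙ pₙ : Occ) (cₙ : Label) (h : Bool) : Timed Bool := do
  let conn₂ := connected o₁ p₁ h p₂ .O o₂ c₂
  let connₙ := connected o₁ p₁ h oₙ .P pₙ cₙ
  let pre ← keep τ₁.occs fun o => not (ltNat o₁.pos o.pos)
  let post ← keep τ₁.occs fun o => ltNat o₁.pos o.pos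
  if ← or (clash potWW conn₂ pre τ₂.occs) (clash potWW connₙ pre τₙ.occs) then
    pure false
  else if ← and (pure (decide (τ₁.level ≠ .RC)))
      (or (clash potWW conn₂ post τ₂.occs) (clash potWW connₙ post τₙ.occs)) then
    pure false
  else if ← not (potRW o₁ p₂) then
    pure false
  else if ← and (not (potRW oₙ p₁))
      (or (pure (decide (τ₁.level ≠ .RC))) (not (ltNat o₁.pos p₁.pos))) then
    pure false
  else if decide (τ₁.level = .SSI) && decide (τ₂.level = .SSI) && decide (τₙ.level = .SSI) then
    pure false
  else if ← and (pure (decide (τ₁.level = .SSI) && decide (τ₂.level = .SSI)))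
      (clash potWR conn₂ τ₁.occs τ₂.occs) then
    pure false
  else if ← and (pure (decide (τ₁.level = .SSI) && decide (τₙ.level = .SSI)))
      (clash potRW connₙ τ₁.occs τₙ.occs) then
    pure false
  else
    pure true

/-- The body of the innermost loops: the choices made so far lead to a counterexample. -/
def witness (τ₁ : InTemplate) (o₁ p₁ : Occ) (h : Bool) (TC : List (Node × Node))
    (τ₂ : InTemplate) (o₂ p₂ : Occ) (τₙ : InTemplate) (oₙ pₙ : Occ) : Timed Bool := do
  if ← or (not (pot o₁ p₂)) (not (pot oₙ p₁)) then
    pure false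
  else
    let same₂ ← sameVar o₂ p₂
    let sameₙ ← sameVar oₙ pₙ
    let C₂ := if same₂ then [Label.O] else [Label.N, Label.P]
    let Cₙ := if sameₙ then [Label.P] else [Label.N, Label.O]
    any C₂ fun c₂ => any Cₙ fun cₙ =>
      and (reachable o₂ p₂ c₂ oₙ pₙ cₙ h TC)
        (validSchedule τ₁ o₁ p₁ τ₂ o₂ p₂ c₂ τₙ oₙ pₙ cₙ h)

/-- The decision algorithm; the input is a list of templates with their isolation levels. -/
def decideRobust (input : List (Template × Level)) : Timed Bool := do
  let P ← numberTemplates 0 input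
  let found ←
    any P fun τ₁ => any τ₁.occs fun o₁ => any τ₁.occs fun p₁ => do
      let same ← sameVar o₁ p₁
      any (if same then [true] else [true, false]) fun h => do
        let V ← nodes o₁ p₁ τ₁ h P
        let E ← edges h V
        let TC ← transClosure V E
        any P fun τ₂ => any τ₂.occs fun o₂ => any τ₂.occs fun p₂ =>
          any P fun τₙ => any τₙ.occs fun oₙ => any τₙ.occs fun pₙ =>
            witness τ₁ o₁ p₁ h TC τ₂ o₂ p₂ τₙ oₙ pₙ
  pure (!found)

end Algo

/-! ### The size of a set of templates: the length of a description in bits, up to a constant -/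

def attrsSize (l : List ℕ) : ℕ := (l.map fun a => 1 + a.size).sum

def opSize (o : Op Var) : ℕ :=
  1 + o.loc.rel.size + o.loc.name.size + attrsSize o.readSet + attrsSize o.writeSet

def templateSize (τ : Template) : ℕ := 1 + (τ.map opSize).sum

def templatesSize (P : List Template) : ℕ := (P.map templateSize).sum

end TemplateRobustness

namespace TemplateRobustness

open Schedule

/-! ### Conflicts -/

namespace Op

variable {α : Type} {o p : Op α}

/-! Robustness fails exactly when some instances of the templates form a split cycle (`SplitCycle`):
consecutive transactions `c 0, …, c (n - 1)` conflict, only `c 1` and `c (n - 1)` may conflict with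
`c 0`, and the levels permit the schedule that runs `c 0` up to the operation opening the cycle,
then `c 1, …, c (n - 1)` serially, then the rest of `c 0`.

Conflict serializability amounts to acyclicity of the dependencies between transactions
(`conflictSerializable_of_acyclic`, `ConflictSerializable.not_transGen`). In an allowed schedule,
ww- and wr-dependencies force a commit before a snapshot; only antidependencies can go against the
commit order. Take a shortest dependency cycle and rotate it so that `c 1` commits first. Then `c 0
→ c 1` is an antidependency, its snapshot precedes all commits of the cycle, and minimality removes
the chords at `c 0`; this yields a split cycle (`nonempty_splitCycle`). Conversely, the split
schedule of such a cycle is allowed (`splitSchedule_allowed`) and has all links of the cycle as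
dependencies (`not_transactionRobust_of_split`).

A cycle may be long, but its middle matters only through the links between neighbours and the
absence of conflicts with `c 0`. For the latter it is enough to know of each link whether its tuple
is that of `o₁`, that of `p₁`, or neither. The middle therefore becomes a path in a finite graph
with labels `O`, `P`, `N`. A path found by the algorithm can be instantiated with four tuples per
relation (`Counterexample.not_robust`). In the other direction (`nonempty_counterexample`) a link is
labelled `O` or `P` only where equal variables force this; all else is `N`, which loses nothing
because `O` and `P` only add restrictions.

The step bound holds because the loops are nested to a fixed depth, their lengths are polynomial in
the input, and the closure never lists more pairs than the square of the number of nodes. -/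

theorem isWrite_of_mem {x : ℕ} (h : x ∈ o.writeSet) : o.IsWrite := by
  cases o <;> simp_all [writeSet, IsWrite]

theorem isRead_of_mem {x : ℕ} (h : x ∈ o.readSet) : o.IsRead := by
  cases o <;> simp_all [readSet, IsRead]

theorem WW.symm (h : o.WW p) : p.WW o := let ⟨x, h, h'⟩ := h; ⟨x, h', h⟩
theorem WR.symm (h : o.WR p) : p.RW o := let ⟨x, h, h'⟩ := h; ⟨x, h', h⟩
theorem RW.symm (h : o.RW p) : p.WR o := let ⟨x, h, h'⟩ := h; ⟨x, h', h⟩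
theorem WW.left (h : o.WW p) : o.IsWrite := let ⟨_, h, _⟩ := h; isWrite_of_mem h
theorem WW.right (h : o.WW p) : p.IsWrite := h.symm.left
theorem WR.left (h : o.WR p) : o.IsWrite := let ⟨_, h, _⟩ := h; isWrite_of_mem h
theorem WR.right (h : o.WR p) : p.IsRead := let ⟨_, _, h⟩ := h; isRead_of_mem h
theorem RW.left (h : o.RW p) : o.IsRead := h.symm.right
theorem RW.right (h : o.RW p) : p.IsWrite := h.symm.left

/-- The attribute sets of two operations meet in one of the three ways. -/
def Clash (o p : Op α) : Prop := o.WW p ∨ o.WR p ∨ o.RW p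

theorem Clash.symm (h : o.Clash p) : p.Clash o := by
  rcases h with h | h | h
  · exact .inl h.symm
  · exact .inr (.inr h.symm)
  · exact .inr (.inl h.symm)

end Op

variable {m : ℕ} {T : Fin m → Transaction}

namespace Schedule

theorem Meet.symm {b a : OpRef T} (h : Meet b a) : Meet a b := ⟨h.1.symm, h.2.symm⟩

variable (s : Schedule T)

theorem lt_trans {x y z : Event T} (h : s.lt x y) (h' : s.lt y z) : s.lt x z :=
  s.lt_order.trans _ _ _ h h'

theorem lt_irrefl (x : Event T) : ¬ s.lt x x := s.lt_order.irrefl x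

theorem lt_asymm {x y : Event T} (h : s.lt x y) : ¬ s.lt y x :=
  fun h' => s.lt_irrefl _ (s.lt_trans h h')

theorem lt_total {x y : Event T} (h : x ≠ y) : s.lt x y ∨ s.lt y x := by
  by_contra hc
  rw [not_or] at hc
  exact h (s.lt_order.trichotomous x y hc.1 hc.2)

theorem lt_of_not_lt_of_lt {x y z : Event T} (h : ¬ s.lt y x) (h' : s.lt y z) : s.lt x z := by
  by_cases hxy : x = y
  · exact hxy ▸ h'
  · exact s.lt_trans ((s.lt_total hxy).resolve_right h) h'

theorem lt_of_lt_of_not_lt {x y z : Event T} (h : s.lt x y) (h' : ¬ s.lt z y) : s.lt x z := by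
  by_cases hyz : y = z
  · exact hyz ▸ h
  · exact s.lt_trans h ((s.lt_total hyz).resolve_right h')

theorem vlt_total {t : Tuple} {a b : OpRef T} (ha : OpRef.WritesOn a t) (hb : OpRef.WritesOn b t)
    (h : a ≠ b) : s.vlt t a b ∨ s.vlt t b a := by
  by_contra hc
  rw [not_or] at hc
  exact h (congrArg Subtype.val
    ((s.vlt_order t).trichotomous ⟨a, ha⟩ ⟨b, hb⟩ hc.1 hc.2))

/-- A write and a read on the same tuple are related by one of the two dependencies. -/
theorem wrDep_or_rwDep {b a : OpRef T} (hm : Meet b a) (h : (OpRef.get b).WR (OpRef.get a)) :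
    s.WRDep b a ∨ s.RWDep a b := by
  rcases hv : s.ver a with _ | w
  · exact .inr ⟨hm.symm, h.symm, by simp [hv, VerLt]⟩
  · have hw := (s.ver_spec a w h.right hv).1
    by_cases hbw : b = w
    · exact .inl ⟨hm, h, w, hv, .inl hbw⟩
    · rcases s.vlt_total ⟨h.left, hm.2⟩ hw hbw with hl | hl
      · exact .inl ⟨hm, h, w, hv, .inr hl⟩
      · exact .inr ⟨hm.symm, h.symm, by simpa [hv, VerLt, hm.2] using hl⟩

theorem wwDep_or_wwDep {b a : OpRef T} (hm : Meet b a) (h : (OpRef.get b).WW (OpRef.get a)) :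
    s.WWDep b a ∨ s.WWDep a b := by
  have hne : b ≠ a := fun e => hm.1 (congrArg _ e)
  rcases s.vlt_total (t := OpRef.tuple a) ⟨h.left, hm.2⟩ ⟨h.right, rfl⟩ hne with hl | hl
  · exact .inl ⟨hm, h, hl⟩
  · exact .inr ⟨hm.symm, h.symm, hm.2 ▸ hl⟩

/-- Versions of a tuple are totally ordered, and a read either sees a given write (or a later
version) or misses it, so every conflict is oriented somehow. Dependencies are later proved by
excluding the reverse one. -/
theorem dep_or_dep {b a : OpRef T} (h : Conflicting b a) : s.Dep b a ∨ s.Dep a b := by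
  obtain ⟨hm, h | h | h⟩ := h
  · exact (s.wwDep_or_wwDep hm h).imp .inl .inl
  · exact (s.wrDep_or_rwDep hm h).imp (.inr ∘ .inl) (.inr ∘ .inr)
  · exact (s.wrDep_or_rwDep hm.symm h.symm).symm.imp (.inr ∘ .inr) (.inr ∘ .inl)

theorem Dep.meet {s : Schedule T} {b a : OpRef T} (h : s.Dep b a) : Meet b a := by
  rcases h with h | h | h <;> exact h.1

theorem Dep.conflicting {s : Schedule T} {b a : OpRef T} (h : s.Dep b a) : Conflicting b a := by
  rcases h with h | h | h
  · exact ⟨h.1, .inl h.2.1⟩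
  · exact ⟨h.1, .inr (.inl h.2.1)⟩
  · exact ⟨h.1, .inr (.inr h.2.1)⟩

/-! ### Serial single-version schedules -/

/-- Version order is time here and a read sees the latest write, so even an antidependency points
forward: a write before the read would be newer than the version read. -/
theorem SingleVersion.lt_of_dep {s : Schedule T} (hs : s.SingleVersion) {b a : OpRef T}
    (h : s.Dep b a) : s.lt (.op b) (.op a) := by
  rcases h with ⟨hm, hc, h⟩ | ⟨hm, hc, w, hw, h⟩ | ⟨hm, hc, h⟩
  · exact (hs.1 _ _ _ ⟨hc.left, hm.2⟩ ⟨hc.right, rfl⟩).1 h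
  · have hw' := s.ver_spec a w hc.right hw
    rcases h with rfl | h
    · exact hw'.2.2
    · exact s.lt_trans ((hs.1 _ _ _ ⟨hc.left, hm.2⟩ hw'.1).1 h) hw'.2.2
  · by_contra hn
    have hab : s.lt (.op a) (.op b) := by
      refine (s.lt_total fun e => hm.1 ?_).resolve_left hn
      injection e with e
      exact congrArg _ e
    refine hs.2 b hc.left ⟨a, ⟨hc.right, hm.2.symm⟩, fun w hw => ?_, hab⟩
    have hw' := s.ver_spec b w hc.left hw
    rw [hw] at h
    exact (hs.1 _ _ _ (hm.2 ▸ hw'.1) ⟨hc.right, rfl⟩).1 h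

/-- Otherwise `a` would fall between `b` and the commit of the transaction of `b`. -/
theorem Serial.commit_lt {s : Schedule T} (hs : s.Serial) {b a : OpRef T} (hne : b.1 ≠ a.1)
    (h : s.lt (.op b) (.op a)) : s.lt (.commit b.1) (.commit a.1) := by
  by_contra hn
  have hab : s.lt (.commit a.1) (.commit b.1) :=
    (s.lt_total fun e => hne (by injection e)).resolve_left hn
  have := hs (.op b) (.op a) (.commit b.1) h (s.lt_trans (s.lt_commit a) hab) rfl
  exact hne this.symm

/-- Transaction `j` depends on transaction `i`. -/
def TxnDep (i j : Fin m) : Prop := ∃ b a : OpRef T, b.1 = i ∧ a.1 = j ∧ s.Dep b a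

theorem TxnDep.ne {s : Schedule T} {i j : Fin m} (h : s.TxnDep i j) : i ≠ j := by
  obtain ⟨b, a, rfl, rfl, h⟩ := h
  exact h.meet.1

/-- The dependencies of a conflict-serializable schedule are acyclic. -/
theorem ConflictSerializable.not_transGen {s : Schedule T} (hs : s.ConflictSerializable)
    (i : Fin m) : ¬ Relation.TransGen s.TxnDep i i := by
  obtain ⟨s', h1, h2, h3⟩ := hs
  have key : ∀ i j, Relation.TransGen s.TxnDep i j → s'.lt (.commit i) (.commit j) := by
    intro i j h
    have step : ∀ i j, s.TxnDep i j → s'.lt (.commit i) (.commit j) := by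
      rintro _ _ ⟨b, a, rfl, rfl, h⟩
      exact h2.commit_lt h.meet.1 (h1.lt_of_dep ((h3 b a h.conflicting).1 h))
    induction h with
    | single h => exact step _ _ h
    | tail _ h ih => exact s'.lt_trans ih (step _ _ h)
  exact fun h => s'.lt_irrefl _ (key i i h)

/-! ### Schedules given by keys -/

/-- The position of a version: versions are ordered by commit and then by position. -/
def verKey (key : Event T → ℕ ×ₗ ℕ) (a : OpRef T) : (ℕ ×ₗ ℕ) ×ₗ ℕ :=
  toLex (key (.commit a.1), (a.2 : ℕ))

theorem verKey_injective {key : Event T → ℕ ×ₗ ℕ} (hk : Function.Injective key) :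
    Function.Injective (verKey key) := by
  rintro ⟨i, k⟩ ⟨j, l⟩ h
  have h' : (key (.commit i), (k : ℕ)) = (key (.commit j), (l : ℕ)) := toLex.injective h
  rw [Prod.mk.injEq] at h'
  have := hk h'.1
  injection this with this
  subst this
  congr
  exact Fin.ext h'.2

/-- Positions only break ties inside a transaction, so across transactions the version order is the
commit order, as RC and SI both demand. -/
theorem verKey_lt_iff {key : Event T → ℕ ×ₗ ℕ} (hk : Function.Injective key) {a b : OpRef T}
    (h : a.1 ≠ b.1) : verKey key a < verKey key b ↔ key (.commit a.1) < key (.commit b.1) := by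
  rw [verKey, verKey, Prod.Lex.toLex_lt_toLex]
  refine ⟨fun h' => h'.resolve_right fun h' => h ?_, .inl⟩
  have := hk h'.1
  injection this

open Classical in
/-- The schedule that orders the events by `key`, the versions by `verKey`, and lets a read
operation `a` read the last one of the versions `w` with `cand a w`. -/
noncomputable def ofKey (key : Event T → ℕ ×ₗ ℕ) (hk : Function.Injective key)
    (hop : ∀ (i : Fin m) (k l : Fin (T i).length), k < l →
      key (.op ⟨i, k⟩) < key (.op ⟨i, l⟩))
    (hcommit : ∀ r : OpRef T, key (.op r) < key (.commit r.1))
    (cand : OpRef T → OpRef T → Prop)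
    (hcand : ∀ a w, cand a w → OpRef.WritesOn w (OpRef.tuple a) ∧ key (.op w) < key (.op a)) :
    Schedule T where
  lt x y := key x < key y
  lt_order := hk.isStrictTotalOrder_onFun (r := (· < ·))
  lt_of_lt := hop
  lt_commit := hcommit
  vlt _ a b := verKey key a < verKey key b
  vlt_order _ := Function.Injective.isStrictTotalOrder_onFun (r := (· < ·))
    (f := fun a : {r : OpRef T // OpRef.WritesOn r _} => verKey key a.1) ((verKey_injective hk).comp Subtype.val_injective)
  ver a := if h : ∃ w, cand a w ∧ ∀ w', cand a w' → verKey key w' ≤ verKey key w then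
    some h.choose else none
  ver_spec a w _ h := by
    split_ifs at h with hw
    have h := Option.some.inj h
    have := hcand a w (h ▸ hw.choose_spec.1)
    refine ⟨this.1, ?_, this.2⟩
    rintro rfl
    exact absurd this.2 (_root_.lt_irrefl _)

section ofKey

variable {key : Event T → ℕ ×ₗ ℕ} {hk : Function.Injective key}
  {hop : ∀ (i : Fin m) (k l : Fin (T i).length), k < l → key (.op ⟨i, k⟩) < key (.op ⟨i, l⟩)}
  {hcommit : ∀ r : OpRef T, key (.op r) < key (.commit r.1)}
  {cand : OpRef T → OpRef T → Prop}
  {hcand : ∀ a w, cand a w → OpRef.WritesOn w (OpRef.tuple a) ∧ key (.op w) < key (.op a)}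

theorem ofKey_ver_some {a w : OpRef T}
    (h : (ofKey key hk hop hcommit cand hcand).ver a = some w) : cand a w := by
  simp only [ofKey] at h
  split_ifs at h with hw
  exact Option.some.inj h ▸ hw.choose_spec.1

theorem ofKey_exists_ver {a w : OpRef T} (h : cand a w) :
    ∃ v, (ofKey key hk hop hcommit cand hcand).ver a = some v ∧
      verKey key w ≤ verKey key v := by
  classical
  have hex : ∃ w, cand a w ∧ ∀ w', cand a w' → verKey key w' ≤ verKey key w := by
    obtain ⟨v, hv, hmax⟩ := Finset.exists_max_image (Finset.univ.filter (cand a)) (verKey key)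
      ⟨w, by simpa using h⟩
    exact ⟨v, by simpa using hv, fun w' hw' => hmax w' (by simpa using hw')⟩
  exact ⟨hex.choose, by simp only [ofKey]; exact dif_pos hex, hex.choose_spec.2 w h⟩

/-- No candidate is newer than the version that is read. -/
theorem ofKey_not_verLt {a w : OpRef T} (h : cand a w) (t : Tuple) :
    ¬ (ofKey key hk hop hcommit cand hcand).VerLt t
      ((ofKey key hk hop hcommit cand hcand).ver a) w := by
  obtain ⟨v, hv, hle⟩ := ofKey_exists_ver (hk := hk) (hop := hop) (hcommit := hcommit)
    (hcand := hcand) h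
  rw [hv]
  exact not_lt.2 hle

end ofKey

/-! ### Acyclic dependencies -/

open Classical in
/-- The number of transactions on which `i` depends directly or indirectly. -/
noncomputable def depRank (i : Fin m) : ℕ :=
  (Finset.univ.filter fun j => Relation.TransGen s.TxnDep j i).card

/-- All predecessors of `i` are predecessors of `j`, and `i` itself is one of `j` but, by
acyclicity, not of `i`. -/
theorem depRank_lt (hs : ∀ i, ¬ Relation.TransGen s.TxnDep i i) {i j : Fin m}
    (h : s.TxnDep i j) : s.depRank i < s.depRank j := by
  classical
  refine Finset.card_lt_card (Finset.ssubset_iff_of_subset ?_ |>.2 ⟨i, ?_, ?_⟩)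
  · intro k hk
    simp only [Finset.mem_filter, Finset.mem_univ, true_and] at hk ⊢
    exact hk.tail h
  · simpa using Relation.TransGen.single h
  · simpa using hs i

/-- The key of an event in the serial schedule in which transaction `i` is run at time `f i`. -/
def serialKey (T : Fin m → Transaction) (f : Fin m → ℕ) : Event T → ℕ ×ₗ ℕ
  | .op r => toLex (f r.1, (r.2 : ℕ))
  | .commit i => toLex (f i, (T i).length)

theorem serialKey_injective {f : Fin m → ℕ} (hf : Function.Injective f) :
    Function.Injective (serialKey T f) := by
  rintro (⟨i, k⟩ | i) (⟨j, l⟩ | j) h <;>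
    · have h := toLex.injective h
      rw [Prod.mk.injEq] at h
      obtain rfl := hf h.1
      have h2 := h.2
      first
        | rfl
        | (obtain rfl : k = l := Fin.ext h2; rfl)
        | exact absurd h2 (Nat.ne_of_lt k.2)
        | exact absurd h2.symm (Nat.ne_of_lt l.2)

/-- Run the transactions serially along a linear extension of the dependencies. Both schedules
orient every conflict and all their dependencies increase `f`, so the orientations agree. -/
theorem conflictSerializable_of_acyclic (hs : ∀ i, ¬ Relation.TransGen s.TxnDep i i) :
    s.ConflictSerializable := by
  -- Scaling the rank by `m` and adding the index breaks ties: `f` is injective and still increases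
  -- along dependencies.
  let f : Fin m → ℕ := fun i => s.depRank i * m + i
  have hf : Function.Injective f := by
    intro i j h
    have h1 : (s.depRank i * m + (i : ℕ)) % m = (s.depRank j * m + (j : ℕ)) % m :=
      congrArg (· % m) h
    rw [Nat.mul_add_mod_self_right, Nat.mul_add_mod_self_right, Nat.mod_eq_of_lt i.2,
      Nat.mod_eq_of_lt j.2] at h1
    exact Fin.ext h1
  have hfdep : ∀ i j, s.TxnDep i j → f i < f j := by
    intro i j h
    have h1 := s.depRank_lt hs h
    calc f i < (s.depRank i + 1) * m := by have := i.2; simp only [f]; nlinarith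
      _ ≤ s.depRank j * m := Nat.mul_le_mul_right _ h1
      _ ≤ f j := Nat.le_add_right _ _
  have hk := serialKey_injective (T := T) hf
  let s' : Schedule T := ofKey (serialKey T f) hk
    (fun i k l h => Prod.Lex.toLex_lt_toLex.2 (.inr ⟨rfl, h⟩))
    (fun r => Prod.Lex.toLex_lt_toLex.2 (.inr ⟨rfl, r.2.2⟩))
    (fun a w => OpRef.WritesOn w (OpRef.tuple a) ∧
      serialKey T f (.op w) < serialKey T f (.op a)) (fun _ _ h => h)
  -- An operation and its commit have the same first component, so ordering versions by commit and
  -- position is ordering the writes by time.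
  have hvlt : ∀ a b : OpRef T, verKey (serialKey T f) a < verKey (serialKey T f) b ↔
        serialKey T f (.op a) < serialKey T f (.op b) := by
      intro a b
      simp only [verKey, serialKey, Prod.Lex.toLex_lt_toLex]
      constructor
      · rintro (h | ⟨h, h'⟩)
        · rcases h with h | ⟨h, h'⟩
          · exact .inl h
          · have := hf h
            rw [this] at h'
            exact absurd h' (_root_.lt_irrefl _)
        · exact .inr ⟨congrArg Prod.fst (toLex.injective h), h'⟩
      · rintro (h | ⟨h, h'⟩)
        · exact .inl (.inl h)
        · have := hf h
          exact .inr ⟨by rw [this], h'⟩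
  have hsv : s'.SingleVersion := by
    refine ⟨fun t a b _ _ => hvlt a b, ?_⟩
    · rintro a _ ⟨c, hc, hw, hca⟩
      obtain ⟨v, hv, hle⟩ := ofKey_exists_ver (hk := hk)
        (hop := fun i k l h => Prod.Lex.toLex_lt_toLex.2 (.inr ⟨rfl, h⟩))
        (hcommit := fun r => Prod.Lex.toLex_lt_toLex.2 (.inr ⟨rfl, r.2.2⟩))
        (cand := fun a w => OpRef.WritesOn w (OpRef.tuple a) ∧
          serialKey T f (.op w) < serialKey T f (.op a)) (hcand := fun _ _ h => h)
        (a := a) (w := c) ⟨hc, hca⟩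
      exact absurd ((hvlt v c).2 (hw v hv)) (not_lt.2 hle)
  have hser : s'.Serial := by
    intro a b c hab hbc hac
    have hfst : ∀ e : Event T, (ofLex (serialKey T f e)).1 = f e.txn := by rintro (_ | _) <;> rfl
    have mono : ∀ x y : Event T, s'.lt x y → f x.txn ≤ f y.txn := by
      intro x y h
      rw [← hfst, ← hfst]
      rcases Prod.Lex.lt_iff.1 h with h | h
      · exact h.le
      · exact h.1.le
    refine hf (le_antisymm ?_ (mono _ _ hab))
    rw [hac]
    exact mono _ _ hbc
  refine ⟨s', hsv, hser, fun b a hc => ?_⟩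
  have h1 : ∀ {b a : OpRef T}, s.Dep b a → f b.1 < f a.1 :=
    fun h => hfdep _ _ ⟨_, _, rfl, rfl, h⟩
  have h2 : ∀ {b a : OpRef T}, s'.Dep b a → f b.1 < f a.1 := by
    intro b a h
    rcases Prod.Lex.lt_iff.1 (hser.commit_lt h.meet.1 (hsv.lt_of_dep h)) with h' | h'
    · exact h'
    · exact absurd (hf h'.1) h.meet.1
  constructor
  · intro h
    exact (s'.dep_or_dep hc).resolve_right fun h' => absurd (h1 h) (h2 h').asymm
  · intro h
    exact (s.dep_or_dep hc).resolve_right fun h' => absurd (h2 h) (h1 h').asymm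

end Schedule

/-! ### Walks and cycles -/

section Walks

variable {α : Type*} {R : α → α → Prop}

theorem transGen_iff_exists_walk {x y : α} : Relation.TransGen R x y ↔
    ∃ n, 0 < n ∧ ∃ c : ℕ → α, c 0 = x ∧ c n = y ∧ ∀ i < n, R (c i) (c (i + 1)) := by
  constructor
  · intro h
    induction h with
    | @single z h =>
      refine ⟨1, one_pos, fun i => if i = 0 then x else z, rfl, rfl, fun i hi => ?_⟩
      obtain rfl : i = 0 := by omega
      simpa using h
    | @tail y z _ h ih =>
      obtain ⟨n, hn, c, h0, h1, hc⟩ := ih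
      refine ⟨n + 1, by omega, fun i => if i ≤ n then c i else z, by simpa using h0, by simp,
        fun i hi => ?_⟩
      by_cases hin : i = n
      · subst hin
        simpa [h1] using h
      · have := hc i (by omega)
        simpa [show i ≤ n by omega, show i + 1 ≤ n by omega] using this
  · rintro ⟨n, hn, c, rfl, rfl, hc⟩
    induction n with
    | zero => omega
    | succ k ih =>
      by_cases hk : k = 0
      · subst hk
        exact .single (hc 0 one_pos)
      · exact (ih (by omega) fun i hi => hc i (by omega)).tail (hc k (by omega))

/-- `c` runs periodically through a cycle of length `n`. -/
def IsCycle (R : α → α → Prop) (n : ℕ) (c : ℕ → α) : Prop :=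
  (∀ i, c (i + n) = c i) ∧ ∀ i, R (c i) (c (i + 1))

theorem isCycle_of_walk {c : ℕ → α} {k : ℕ} (hc : ∀ i < k, R (c i) (c (i + 1)))
    (h : R (c k) (c 0)) : IsCycle R (k + 1) fun i => c (i % (k + 1)) := by
  refine ⟨fun i => by simp, fun i => ?_⟩
  have hlt : i % (k + 1) < k + 1 := Nat.mod_lt i (Nat.succ_pos k)
  dsimp only
  by_cases hi : i % (k + 1) = k
  · rw [hi, Nat.add_mod, hi]
    by_cases hk : k = 0
    · subst hk; simpa using h
    · rw [Nat.mod_eq_of_lt (show 1 < k + 1 by omega), Nat.mod_self]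
      exact h
  · have : (i + 1) % (k + 1) = i % (k + 1) + 1 := by
      rw [Nat.add_mod]
      by_cases hk : k = 0
      · subst hk; omega
      · rw [Nat.mod_eq_of_lt (show 1 < k + 1 by omega)]
        exact Nat.mod_eq_of_lt (by omega)
    rw [this]
    exact hc _ (by omega)

theorem exists_isCycle {x : α} (h : Relation.TransGen R x x) :
    ∃ n, 0 < n ∧ ∃ c, IsCycle R n c := by
  obtain ⟨n, hn, c, h0, h1, hc⟩ := transGen_iff_exists_walk.1 h
  obtain ⟨k, rfl⟩ : ∃ k, n = k + 1 := ⟨n - 1, by omega⟩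
  refine ⟨k + 1, hn, _, isCycle_of_walk (fun i hi => hc i (by omega)) ?_⟩
  have := hc k (by omega)
  rwa [h1, ← h0] at this

theorem IsCycle.shift {n : ℕ} {c : ℕ → α} (h : IsCycle R n c) (r : ℕ) :
    IsCycle R n fun i => c (i + r) :=
  ⟨fun i => by dsimp only; rw [show i + n + r = i + r + n by omega]; exact h.1 _,
    fun i => by dsimp only; rw [show i + 1 + r = i + r + 1 by omega]; exact h.2 _⟩

/-- A chord closes a cycle with a part of a walk. -/
theorem exists_isCycle_of_chord {c : ℕ → α} (hc : ∀ i, R (c i) (c (i + 1))) {i j : ℕ}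
    (hij : i ≤ j) (h : R (c j) (c i)) : ∃ c', IsCycle R (j - i + 1) c' :=
  ⟨_, isCycle_of_walk (c := fun k => c (k + i)) (k := j - i)
    (fun k _ => by rw [show k + 1 + i = k + i + 1 by omega]; exact hc _)
    (by rw [show j - i + i = j by omega, Nat.zero_add]; exact h)⟩

end Walks

/-! ### Dependencies and commits in allowed schedules -/

namespace Schedule

variable {m : ℕ} {T : Fin m → Transaction}

theorem first_eq (a : OpRef T) :
    first T a.1 = .op ⟨a.1, ⟨0, Nat.zero_lt_of_lt a.2.2⟩⟩ := by
  simp [first, Nat.zero_lt_of_lt a.2.2]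

/-- The event at which the snapshot that `a` reads is taken. -/
def start (A : Fin m → Level) (a : OpRef T) : Event T :=
  if A a.1 = .RC then .op a else first T a.1

theorem start_of_ne {A : Fin m → Level} {a : OpRef T} (h : A a.1 ≠ .RC) :
    start A a = first T a.1 := if_neg h

theorem start_of_eq {A : Fin m → Level} {a : OpRef T} (h : A a.1 = .RC) :
    start A a = .op a := if_pos h

variable (s : Schedule T)

theorem not_lt_of_le {i : Fin m} {k l : Fin (T i).length} (h : k ≤ l) :
    ¬ s.lt (.op ⟨i, l⟩) (.op ⟨i, k⟩) := by
  rcases h.lt_or_eq with h | rfl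
  · exact s.lt_asymm (s.lt_of_lt _ _ _ h)
  · exact s.lt_irrefl _

theorem not_op_lt_first (a : OpRef T) : ¬ s.lt (.op a) (first T a.1) := by
  rw [first_eq]
  exact s.not_lt_of_le (Nat.zero_le _)

theorem not_op_lt_start (A : Fin m → Level) (a : OpRef T) : ¬ s.lt (.op a) (start A a) := by
  unfold start
  split_ifs
  · exact s.lt_irrefl _
  · exact s.not_op_lt_first a

theorem not_start_lt_first (A : Fin m → Level) (a : OpRef T) :
    ¬ s.lt (start A a) (first T a.1) := by
  unfold start
  split_ifs
  · exact s.not_op_lt_first a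
  · exact s.lt_irrefl _

theorem start_ne_commit (A : Fin m → Level) (a : OpRef T) (i : Fin m) :
    start A a ≠ .commit i := by
  unfold start
  rw [first_eq]
  split_ifs <;> simp

theorem start_lt_commit (A : Fin m → Level) (a : OpRef T) :
    s.lt (start A a) (.commit a.1) :=
  s.lt_of_not_lt_of_lt (s.not_op_lt_start A a) (s.lt_commit a)

variable {s} {A : Fin m → Level}

theorem Allowed.si (hA : s.Allowed A) {i : Fin m} (h : A i ≠ .RC) : s.AllowedSI i :=
  hA.2.1 i (by revert h; cases A i <;> simp)

theorem Allowed.respectsCommitOrder (hA : s.Allowed A) {a : OpRef T}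
    (ha : (OpRef.get a).IsWrite) : s.RespectsCommitOrder a := by
  by_cases h : A a.1 = .RC
  · exact (hA.1 _ h).1 a rfl ha
  · exact (hA.si h).1 a rfl ha

theorem Allowed.readLastCommitted (hA : s.Allowed A) {a : OpRef T}
    (ha : (OpRef.get a).IsRead) : s.ReadLastCommitted a (start A a) := by
  unfold start
  split_ifs with h
  · exact (hA.1 _ h).2.1 a rfl ha
  · exact (hA.si h).2.1 a rfl ha

/-- The commit order of versions makes `b` commit first. If that commit came after the snapshot of
`a`, either order of the two writes would be a forbidden overwrite: by `a` if `b` was written first,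
by `b` otherwise. -/
theorem Allowed.commit_lt_of_ww (hA : s.Allowed A) {b a : OpRef T} (h : s.WWDep b a) :
    s.lt (.commit b.1) (start A a) := by
  obtain ⟨hm, hc, h⟩ := h
  have hba : s.lt (.commit b.1) (.commit a.1) := by
    have := hA.respectsCommitOrder hc.left a hm.1.symm ⟨hc.right, hm.2.symm⟩
    rw [hm.2] at this
    exact this.1 h
  by_contra hn
  have hn : s.lt (start A a) (.commit b.1) :=
    (s.lt_total (start_ne_commit A a _)).resolve_right hn
  have hne : Event.op b ≠ Event.op a := fun e => hm.1 (by injection e with e; rw [e])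
  rcases s.lt_total hne with hlt | hlt
  · by_cases hl : A a.1 = .RC
    · rw [start_of_eq hl] at hn
      exact (hA.1 _ hl).2.2 ⟨b, a, rfl, hm, hc, hlt, hn⟩
    · rw [start_of_ne hl] at hn
      exact (hA.si hl).2.2 ⟨b, a, rfl, hm, hc, hlt, hn⟩
  · have hb : s.lt (.op b) (.commit a.1) := s.lt_trans (s.lt_commit b) hba
    by_cases hl : A b.1 = .RC
    · exact (hA.1 _ hl).2.2 ⟨a, b, rfl, hm.symm, hc.symm, hlt, hb⟩
    · exact (hA.si hl).2.2 ⟨a, b, rfl, hm.symm, hc.symm, hlt,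
        s.lt_of_not_lt_of_lt (s.not_op_lt_first b) hb⟩

/-- The version read is committed before the snapshot, and an older version from another transaction
was committed earlier still. -/
theorem Allowed.commit_lt_of_wr (hA : s.Allowed A) {b a : OpRef T} (h : s.WRDep b a) :
    s.lt (.commit b.1) (start A a) := by
  obtain ⟨hm, hc, w, hw, h⟩ := h
  have hw' := (hA.readLastCommitted hc.right).1 w hw
  rcases h with rfl | h
  · exact hw'
  · by_cases hbw : b.1 = w.1
    · rwa [hbw]
    · have hr := hA.respectsCommitOrder hc.left w (Ne.symm hbw)
        (by rw [hm.2]; exact (s.ver_spec a w hc.right hw).1)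
      rw [hm.2] at hr
      exact s.lt_trans (hr.1 h) hw'

/-- Had `a` been committed before the snapshot of `b`, it would be a committed version newer than
the one read. -/
theorem Allowed.start_lt_of_rw (hA : s.Allowed A) {b a : OpRef T} (h : s.RWDep b a) :
    s.lt (start A b) (.commit a.1) := by
  obtain ⟨hm, hc, h⟩ := h
  refine (s.lt_total (start_ne_commit A b _)).resolve_right fun hlt => ?_
  refine (hA.readLastCommitted hc.left).2 ⟨a, ⟨hc.right, hm.2.symm⟩, hlt, ?_⟩
  rwa [hm.2]

/-- Only an antidependency can lead to a transaction that commits earlier; this dichotomy drives the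
analysis of cycles. -/
theorem Allowed.rw_or_commit_lt (hA : s.Allowed A) {b a : OpRef T} (h : s.Dep b a) :
    s.RWDep b a ∨ s.lt (.commit b.1) (start A a) := by
  rcases h with h | h | h
  · exact .inr (hA.commit_lt_of_ww h)
  · exact .inr (hA.commit_lt_of_wr h)
  · exact .inl h

/-- Hence no transaction depends on one that starts after its own commit. -/
theorem Allowed.first_lt_of_dep (hA : s.Allowed A) {b a : OpRef T} (h : s.Dep b a) :
    s.lt (first T b.1) (.commit a.1) := by
  rcases hA.rw_or_commit_lt h with h | h
  · exact s.lt_of_not_lt_of_lt (s.not_start_lt_first A b) (hA.start_lt_of_rw h)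
  · exact s.lt_of_not_lt_of_lt (s.not_op_lt_first b)
      (s.lt_trans (s.lt_commit b) (s.lt_trans h (s.start_lt_commit A a)))

end Schedule

/-! ### From a non-serializable schedule to a split cycle -/

variable {m : ℕ}

/-- A cycle of conflicts through the transactions `c 0, …, c (n - 1)`, where `out i` in `c i`
conflicts with `inn i` in `c (i + 1)`, for which splitting `c 0` after `out 0` gives an allowed
schedule. -/
structure SplitCycle (T : Fin m → Transaction) (A : Fin m → Level) where
  n : ℕ
  two_le : 2 ≤ n
  c : ℕ → Fin m
  c_n : c n = c 0
  out : ℕ → OpRef T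
  inn : ℕ → OpRef T
  out_txn : ∀ i, (out i).1 = c i
  inn_txn : ∀ i, (inn i).1 = c (i + 1)
  conflicting : ∀ i, Conflicting (out i) (inn i)
  ne_zero : ∀ k, 2 ≤ k → k + 1 < n → c 0 ≠ c k
  rw_zero : (OpRef.get (out 0)).RW (OpRef.get (inn 0))
  rw_last : (OpRef.get (out (n - 1))).RW (OpRef.get (inn (n - 1))) ∨
    A (c 0) = .RC ∧ ((out 0).2 : ℕ) < (inn (n - 1)).2
  not_conflicting : ∀ k, 2 ≤ k → k + 1 < n → ∀ x y : OpRef T, x.1 = c 0 → y.1 = c k →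
    ¬ Conflicting x y
  not_ww : ∀ k, k = 1 ∨ k = n - 1 → ∀ x y : OpRef T, x.1 = c 0 → y.1 = c k → Meet x y →
    (OpRef.get x).WW (OpRef.get y) → A (c 0) = .RC ∧ ((out 0).2 : ℕ) < x.2
  not_ssi : ¬ (A (c 0) = .SSI ∧ A (c 1) = .SSI ∧ A (c (n - 1)) = .SSI)
  not_wr : A (c 0) = .SSI → A (c 1) = .SSI → ∀ x y : OpRef T, x.1 = c 0 → y.1 = c 1 →
    Meet x y → ¬ (OpRef.get x).WR (OpRef.get y)
  not_rw : A (c 0) = .SSI → A (c (n - 1)) = .SSI → ∀ x y : OpRef T, x.1 = c 0 →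
    y.1 = c (n - 1) → Meet x y → ¬ (OpRef.get x).RW (OpRef.get y)

/-- In a shortest dependency cycle a chord at `c 0` would close a shorter cycle, and a rotation puts
the earliest commit at index `1`. -/
theorem exists_chordless_cycle {T : Fin m → Transaction} {s : Schedule T}
    (hs : ¬ s.ConflictSerializable) :
    ∃ (n : ℕ) (c : ℕ → Fin m), 2 ≤ n ∧ IsCycle s.TxnDep n c ∧
      (∀ i, ¬ s.lt (.commit (c i)) (.commit (c 1))) ∧
      (∀ k, 2 ≤ k → k < n → ¬ s.TxnDep (c 0) (c k)) ∧
      ∀ k, k + 1 < n → ¬ s.TxnDep (c k) (c 0) := by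
  classical
  obtain ⟨x, hx⟩ : ∃ x, Relation.TransGen s.TxnDep x x := by
    by_contra h
    rw [not_exists] at h
    exact hs (s.conflictSerializable_of_acyclic h)
  have hex := exists_isCycle hx
  obtain ⟨hpos, c, hc⟩ := Nat.find_spec hex
  set n := Nat.find hex with hn
  have hmin : ∀ k, 0 < k → (∃ c', IsCycle s.TxnDep k c') → n ≤ k := fun k hk h =>
    Nat.find_min' hex ⟨hk, h⟩
  have hwf : WellFounded fun i j : Fin m => s.lt (.commit i) (.commit j) := by
    have : IsTrans (Fin m) fun i j => s.lt (.commit i) (.commit j) :=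
      ⟨fun _ _ _ => s.lt_trans⟩
    have : Std.Irrefl fun i j : Fin m => s.lt (.commit i) (.commit j) :=
      ⟨fun _ => s.lt_irrefl _⟩
    exact Finite.wellFounded_of_trans_of_irrefl _
  obtain ⟨_, ⟨r, rfl⟩, hr⟩ := hwf.has_min (Set.range c) ⟨_, 0, rfl⟩
  -- The shift is `r - 1` modulo `n`, written so that the subtraction does not truncate; index `1`
  -- becomes `c r`.
  have hc' := hc.shift (r + n - 1)
  set d : ℕ → Fin m := fun i => c (i + (r + n - 1)) with hd
  refine ⟨n, d, ?_, hc', fun i => ?_, fun k h2 hkn hdep => ?_, fun k hkn hdep => ?_⟩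
  · by_contra hlt
    have h1 : n = 1 := by omega
    have h := hc.2 0
    have h' := hc.1 0
    rw [h1] at h'
    rw [h'] at h
    exact h.ne rfl
  · have : d 1 = c r := by
      simp only [hd]
      rw [show 1 + (r + n - 1) = r + n by omega]
      exact hc.1 r
    rw [this]
    exact hr _ ⟨_, rfl⟩
  -- The chord leaves `d n = d 0` and enters `d k`, so it closes a cycle of length `n - k + 1 < n`.
  · rw [← Nat.zero_add n] at hkn
    have h0 : d n = d 0 := by simpa using hc'.1 0
    rw [← h0] at hdep
    have := hmin _ (Nat.succ_pos _) (exists_isCycle_of_chord hc'.2 (i := k) (j := n) (by omega) hdep)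
    omega
  · have := hmin _ (Nat.succ_pos _) (exists_isCycle_of_chord hc'.2 (Nat.zero_le k) hdep)
    omega

/-- An allowed schedule that is not conflict-serializable contains a split cycle. -/
theorem nonempty_splitCycle {T : Fin m → Transaction} {A : Fin m → Level} {s : Schedule T}
    (hA : s.Allowed A) (hs : ¬ s.ConflictSerializable) : Nonempty (SplitCycle T A) := by
  obtain ⟨n, c, hn, ⟨hper, hc⟩, hmin, hout, hin⟩ := exists_chordless_cycle hs
  choose b a hb ha hdep using hc
  have hcn : c n = c 0 := by simpa using hper 0
  have hn1 : n - 1 + 1 = n := by omega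
  have h01 : s.lt (.commit (c 1)) (.commit (c 0)) := by
    refine (s.lt_total fun e => (hdep 0).meet.1 ?_).resolve_right (hmin 0)
    rw [hb, ha]
    injection e with e
    exact e.symm
  -- the first dependency
  have hrw0 : s.RWDep (b 0) (a 0) := by
    refine (hA.rw_or_commit_lt (hdep 0)).resolve_right fun h => ?_
    have := s.lt_trans h (s.start_lt_commit A (a 0))
    rw [hb, ha] at this
    exact hmin 0 this
  -- The snapshot of `b 0` precedes the commit of `c 1`, the first one in the cycle, and so every
  -- commit of the cycle.
  have hstart : ∀ k, s.lt (start A (b 0)) (.commit (c k)) := fun k => by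
    have := hA.start_lt_of_rw hrw0
    rw [ha] at this
    exact s.lt_of_lt_of_not_lt this (hmin k)
  have hfirst : ∀ k, s.lt (first T (c 0)) (.commit (c k)) := fun k => by
    have := s.not_start_lt_first A (b 0)
    rw [hb] at this
    exact s.lt_of_not_lt_of_lt this (hstart k)
  -- a transaction of the cycle that commits before the snapshot of an operation of `c 0`
  have hafter : ∀ k (x : OpRef T), x.1 = c 0 → s.lt (.commit (c k)) (start A x) →
      A (c 0) = .RC ∧ ((b 0).2 : ℕ) < x.2 := by
    intro k x hx hlt
    -- Under RC the snapshot is the operation itself, which puts `x` after `b 0`; otherwise it is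
    -- the start of `c 0`, which precedes every commit of the cycle.
    by_cases hl : A (c 0) = .RC
    · refine ⟨hl, ?_⟩
      have h1 := s.lt_trans (hstart k) hlt
      rw [start_of_eq (by rw [hb, hl]), start_of_eq (by rw [hx, hl])] at h1
      by_contra hle
      have hbx : (b 0).1 = x.1 := by rw [hb, hx]
      revert h1 hle hbx
      generalize b 0 = y
      obtain ⟨i, k⟩ := x
      obtain ⟨j, l⟩ := y
      rintro h1 hle rfl
      exact s.not_lt_of_le (Fin.le_def.2 (not_lt.1 hle)) h1
    · rw [start_of_ne (by rwa [hx]), hx] at hlt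
      exact absurd hlt (s.lt_asymm (hfirst k))
  have hto : ∀ k, 1 ≤ k → k < n → s.TxnDep (c 0) (c k) → k = 1 := fun k h1 h2 h => by
    by_contra hk
    exact hout k (by omega) h2 h
  have hfrom : ∀ k, k < n → s.TxnDep (c k) (c 0) → k = n - 1 := fun k h2 h => by
    by_contra hk
    exact hin k (by omega) h
  have hlast : c (n - 1 + 1) = c 0 := by rw [hn1, hcn]
  -- With all three under SSI, `c (n - 1) → c 0 → c 1` would be a dangerous structure, as `c 1`
  -- commits first.
  have hssi : ¬ (A (c 0) = .SSI ∧ A (c 1) = .SSI ∧ A (c (n - 1)) = .SSI) := by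
    rintro ⟨h0, h1, h2⟩
    have hrwn : s.RWDep (b (n - 1)) (a (n - 1)) := by
      refine (hA.rw_or_commit_lt (hdep (n - 1))).resolve_right fun h => ?_
      rw [hb] at h
      have := (hafter (n - 1) _ (by rw [ha, hlast]) h).1
      rw [h0] at this
      cases this
    refine hA.2.2 (c (n - 1)) (c 0) (c 1) h2 h0 h1
      ⟨⟨_, _, hb _, by rw [ha, hlast], hrwn⟩, ⟨_, _, hb 0, ha 0, hrw0⟩, ⟨?_, hfirst _⟩,
        ⟨hfirst _, ?_⟩, ?_, h01, fun hro => ?_⟩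
    · have := hA.first_lt_of_dep (hdep (n - 1))
      rwa [hb, ha, hlast] at this
    · have := s.lt_of_not_lt_of_lt (s.not_op_lt_first (a 0)) (s.lt_commit (a 0))
      rw [ha] at this
      exact s.lt_trans this h01
    · by_cases he : c 1 = c (n - 1)
      · exact .inl he
      · exact .inr ((s.lt_total fun e => he (by injection e)).resolve_right (hmin _))
    -- The extra condition for a read-only `c (n - 1)`: it can be entered only by a wr-dependency,
    -- whose source commits before it starts, and `c 1` commits no later than that source. For `n =
    -- 2` the antidependency enters a write of `c (n - 1)`, so it is not read-only.
    · have hnw : ∀ x : OpRef T, x.1 = c (n - 1) → ¬ (OpRef.get x).IsWrite := by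
        intro x hx
        apply hro
        rw [← hx]
        exact List.get_mem _ _
      by_cases h2n : n = 2
      · subst h2n
        exact absurd hrw0.2.1.right (hnw _ (ha 0))
      · have hd := hdep (n - 2)
        have han : (a (n - 2)).1 = c (n - 1) := by
          rw [ha, show n - 2 + 1 = n - 1 by omega]
        have hlt : s.lt (.commit (c (n - 2))) (first T (c (n - 1))) := by
          rcases hd with hd | hd | hd
          · exact absurd hd.2.1.right (hnw _ han)
          · have := hA.commit_lt_of_wr hd
            rw [start_of_ne (by rw [han, h2]; simp), han, hb] at this
            exact this
          · exact absurd hd.2.1.right (hnw _ han)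
        exact s.lt_of_not_lt_of_lt (hmin _) hlt
  refine ⟨{ n := n, two_le := hn, c := c, c_n := hcn, out := b, inn := a, out_txn := hb
            inn_txn := ha, conflicting := fun i => (hdep i).conflicting
            rw_zero := hrw0.2.1, not_ssi := hssi, ne_zero := ?_, rw_last := ?_, not_conflicting := ?_, not_ww := ?_
            not_wr := ?_, not_rw := ?_ }⟩
  -- If `c k` were `c 0`, the edge from `c (k - 1)` would be a chord into `c 0`.
  · intro k h2 hk he
    refine hin (k - 1) (by omega) ⟨b (k - 1), a (k - 1), hb _, ?_, hdep _⟩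
    rw [ha, show k - 1 + 1 = k by omega, he]
  · rcases hA.rw_or_commit_lt (hdep (n - 1)) with h | h
    · exact .inl h.2.1
    · rw [hb] at h
      exact .inr (hafter (n - 1) _ (by rw [ha, hlast]) h)
  · intro k h2 hk x y hx hy h
    rcases s.dep_or_dep h with h | h
    · have := hto k (by omega) (by omega) ⟨x, y, hx, hy, h⟩
      omega
    · have := hfrom k (by omega) ⟨y, x, hy, hx, h⟩
      omega
  · intro k hk x y hx hy hm hww
    -- The direction `c 0 → c k` would need `k = 1` and an earlier commit of `c 0`. So `y` comes
    -- first and is committed before the snapshot of `x`.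
    rcases s.wwDep_or_wwDep hm hww with h | h
    · have h1 := hto k (by omega) (by omega) ⟨x, y, hx, hy, .inl h⟩
      have := s.lt_trans (hA.commit_lt_of_ww h) (s.start_lt_commit A y)
      rw [hx, hy, h1] at this
      exact absurd this (hmin 0)
    · have := hA.commit_lt_of_ww h
      rw [hy] at this
      exact hafter k x hx this
  -- A wr-dependency would make `c 0` commit before `c 1`. The opposite antidependency is a chord
  -- unless `n = 2`, and then all three transactions are under SSI.
  · intro h0 h1 x y hx hy hm hwr
    rcases s.wrDep_or_rwDep hm hwr with h | h
    · have := s.lt_trans (hA.commit_lt_of_wr h) (s.start_lt_commit A y)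
      rw [hx, hy] at this
      exact hmin 0 this
    · have := hfrom 1 (by omega) ⟨y, x, hy, hx, .inr (.inr h)⟩
      exact hssi ⟨h0, h1, this ▸ h1⟩
  -- A wr-dependency from `c (n - 1)` would need a commit before the start of `c 0`; an
  -- antidependency from `c 0` again forces `n = 2`.
  · intro h0 h1 x y hx hy hm hrw
    rcases s.wrDep_or_rwDep hm.symm hrw.symm with h | h
    · have := hA.commit_lt_of_wr h
      rw [hy] at this
      have := (hafter _ _ hx this).1
      rw [h0] at this
      cases this
    · have := hto (n - 1) (by omega) (by omega) ⟨x, y, hx, hy, .inr (.inr h)⟩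
      exact hssi ⟨h0, this ▸ h1, h1⟩

/-! ### Split schedules -/

section Split

variable {n : ℕ}

/-- The time at which a transaction commits in a split schedule. -/
def splitCommit (i : Fin (n + 2)) : ℕ := if i = 0 then n + 2 else i

variable {T : Fin (n + 2) → Transaction}

/-- The key of an event in the schedule that interrupts transaction `0` after its operation at
position `q` and runs all other transactions in the gap. -/
def splitKey (T : Fin (n + 2) → Transaction) (q : ℕ) : Event T → ℕ ×ₗ ℕ
  | .op r => toLex (if r.1 = 0 ∧ (r.2 : ℕ) ≤ q then 0 else splitCommit r.1, (r.2 : ℕ))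
  | .commit i => toLex (splitCommit i, (T i).length)

theorem splitCommit_pos (i : Fin (n + 2)) : 0 < splitCommit i := by
  unfold splitCommit
  split_ifs with h
  · omega
  · exact Nat.pos_of_ne_zero fun h' => h (Fin.ext h')

theorem splitCommit_injective : Function.Injective (splitCommit (n := n)) := by
  intro i j h
  unfold splitCommit at h
  have := i.2
  have := j.2
  split_ifs at h with h1 h2 h2
  · rw [h1, h2]
  · omega
  · omega
  · exact Fin.ext h

theorem splitKey_injective (q : ℕ) : Function.Injective (splitKey T q) := by
  rintro (⟨i, k⟩ | i) (⟨j, l⟩ | j) h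
  all_goals
    have h := toLex.injective h
    rw [Prod.mk.injEq] at h
    obtain ⟨h1, h2⟩ := h
  · have hij : i = j := by
      dsimp only at h1
      split_ifs at h1 with ha hb hb
      · rw [ha.1, hb.1]
      · exact absurd h1 (splitCommit_pos j).ne
      · exact absurd h1 (splitCommit_pos i).ne'
      · exact splitCommit_injective h1
    subst hij
    obtain rfl : k = l := Fin.ext h2
    rfl
  · have hij : i = j := by
      dsimp only at h1
      split_ifs at h1 with ha
      · exact absurd h1 (splitCommit_pos j).ne
      · exact splitCommit_injective h1
    subst hij
    exact absurd h2 (Nat.ne_of_lt k.2)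
  · have hij : i = j := by
      dsimp only at h1
      split_ifs at h1 with ha
      · exact absurd h1 (splitCommit_pos i).ne'
      · exact splitCommit_injective h1
    subst hij
    exact absurd h2.symm (Nat.ne_of_lt l.2)
  · rw [splitCommit_injective h1]

theorem splitKey_op_lt (q : ℕ) (i : Fin (n + 2)) (k l : Fin (T i).length) (h : k < l) :
    splitKey T q (.op ⟨i, k⟩) < splitKey T q (.op ⟨i, l⟩) := by
  have h' : (k : ℕ) < l := h
  refine Prod.Lex.toLex_lt_toLex.2 ?_
  dsimp only
  split_ifs with h1 h2 h2
  · exact .inr ⟨rfl, h⟩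
  · exact .inl (splitCommit_pos i)
  · exact absurd ⟨h2.1, by omega⟩ h1
  · exact .inr ⟨rfl, h⟩

theorem splitKey_op_lt_commit (q : ℕ) (r : OpRef T) :
    splitKey T q (.op r) < splitKey T q (.commit r.1) := by
  refine Prod.Lex.toLex_lt_toLex.2 ?_
  dsimp only
  split_ifs with h1
  · exact .inl (splitCommit_pos _)
  · exact .inr ⟨rfl, r.2.2⟩

theorem splitKey_start_le (q : ℕ) (A : Fin (n + 2) → Level) (a : OpRef T) :
    splitKey T q (start A a) ≤ splitKey T q (.op a) := by
  unfold start
  split_ifs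
  · exact le_rfl
  · rw [first_eq]
    obtain ⟨i, k⟩ := a
    rcases Nat.eq_zero_or_pos (k : ℕ) with hk | hk
    · exact le_of_eq (congrArg _ (congrArg _ (by congr 1; exact Fin.ext hk.symm)))
    · exact (splitKey_op_lt q i _ _ (Fin.lt_def.2 hk)).le

/-- The split schedule for the operation at position `q` of transaction `0`. -/
noncomputable def splitSchedule (T : Fin (n + 2) → Transaction) (A : Fin (n + 2) → Level)
    (q : ℕ) : Schedule T :=
  ofKey (splitKey T q) (splitKey_injective q) (splitKey_op_lt q) (splitKey_op_lt_commit q)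
    (fun a w => OpRef.WritesOn w (OpRef.tuple a) ∧
      splitKey T q (.commit w.1) < splitKey T q (start A a))
    (fun a w h => ⟨h.1, (splitKey_op_lt_commit q w).trans
      (h.2.trans_le (splitKey_start_le q A a))⟩)

variable {A : Fin (n + 2) → Level} {q : ℕ}

theorem splitSchedule_respectsCommitOrder (a : OpRef T) :
    (splitSchedule T A q).RespectsCommitOrder a :=
  fun _ hb _ => verKey_lt_iff (splitKey_injective q) hb.symm

/-- The candidates in `splitSchedule` are exactly the writes committed before the snapshot, and the
newest of them is read. -/
theorem splitSchedule_readLastCommitted (a : OpRef T) :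
    (splitSchedule T A q).ReadLastCommitted a (start A a) := by
  refine ⟨fun w hw => (ofKey_ver_some hw).2, ?_⟩
  rintro ⟨w, hw, hlt, hv⟩
  exact ofKey_not_verLt ⟨hw, hlt⟩ _ hv

/-- The time of an event. -/
def splitTime (T : Fin (n + 2) → Transaction) (q : ℕ) (e : Event T) : ℕ :=
  (ofLex (splitKey T q e)).1

/-- The part of transaction `0` up to the split has time `0`, its rest and its commit `n + 2`, and
every other transaction its own index. Impossible orders of events are refuted by comparing these
times. -/
theorem splitTime_le_of_lt {x y : Event T} (h : (splitSchedule T A q).lt x y) :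
    splitTime T q x ≤ splitTime T q y := by
  rcases Prod.Lex.lt_iff.1 (show splitKey T q x < splitKey T q y from h) with h | h
  · exact h.le
  · exact h.1.le

theorem splitTime_of_ne {e : Event T} (h : e.txn ≠ 0) : splitTime T q e = e.txn := by
  rcases e with r | i
  · have h : r.1 ≠ 0 := h
    simp [splitTime, splitKey, h, splitCommit, Event.txn]
  · have h : i ≠ 0 := h
    simp [splitTime, splitKey, h, splitCommit, Event.txn]

theorem splitTime_commit_zero : splitTime T q (.commit 0) = n + 2 := by
  simp [splitTime, splitKey, splitCommit]

theorem splitTime_op_zero {a : OpRef T} (h : a.1 = 0) :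
    splitTime T q (.op a) = if (a.2 : ℕ) ≤ q then 0 else n + 2 := by
  simp [splitTime, splitKey, splitCommit, h]

theorem splitTime_op_of_ne {a : OpRef T} (h : a.1 ≠ 0) : splitTime T q (.op a) = a.1 :=
  splitTime_of_ne (e := .op a) h

theorem splitTime_commit_of_ne {i : Fin (n + 2)} (h : i ≠ 0) :
    splitTime T q (.commit i) = i :=
  splitTime_of_ne (e := .commit i) h

theorem first_txn (i : Fin (n + 2)) : (first T i).txn = i := by
  unfold first
  split_ifs <;> rfl

theorem splitTime_first_of_ne {i : Fin (n + 2)} (h : i ≠ 0) :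
    splitTime T q (first T i) = i := by
  rw [splitTime_of_ne (by rwa [first_txn]), first_txn]

theorem splitSchedule_not_concurrent {i j : Fin (n + 2)} (hi : i ≠ 0) (hj : j ≠ 0)
    (hij : i ≠ j) : ¬ (splitSchedule T A q).Concurrent i j := by
  rintro ⟨h1, h2⟩
  have h1 := splitTime_le_of_lt h1
  have h2 := splitTime_le_of_lt h2
  rw [splitTime_first_of_ne ‹_›, splitTime_commit_of_ne ‹_›] at h1 h2
  exact hij (Fin.ext (le_antisymm h1 h2))

/-- Taking `e` to be `a` or the start of its transaction covers both kinds of forbidden overwrite.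
Apart from transaction `0` the schedule is serial, and the ww-conflicts of transaction `0` involve
only its part after the split, which runs last. -/
theorem splitSchedule_no_overwrite
    (hww : ∀ x y : OpRef T, x.1 = 0 → y.1 ≠ 0 → Meet x y → (OpRef.get x).WW (OpRef.get y) →
      A 0 = .RC ∧ q < x.2) {b a : OpRef T} (hm : Meet b a)
    (hc : (OpRef.get b).WW (OpRef.get a)) (hlt : (splitSchedule T A q).lt (.op b) (.op a))
    (e : Event T) (he : e.txn = a.1) (hRC : A 0 = .RC → e = .op a) :
    ¬ (splitSchedule T A q).lt e (.commit b.1) := by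
  intro h
  have h1 := splitTime_le_of_lt hlt
  have h2 := splitTime_le_of_lt h
  by_cases ha : a.1 = 0
  · have hb : b.1 ≠ 0 := fun hb => hm.1 (hb.trans ha.symm)
    have hw := hww a b ha hb hm.symm hc.symm
    rw [hRC hw.1, splitTime_op_zero ha, if_neg (by omega), splitTime_commit_of_ne hb] at h2
    have := b.1.2
    omega
  · rw [splitTime_op_of_ne ha] at h1
    rw [splitTime_of_ne (by rwa [he]), he] at h2
    by_cases hb : b.1 = 0
    · have hw := hww b a hb ha hm hc
      rw [splitTime_op_zero hb, if_neg (by omega)] at h1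
      have := a.1.2
      omega
    · rw [splitTime_op_of_ne hb] at h1
      rw [splitTime_commit_of_ne hb] at h2
      exact hm.1 (Fin.ext (le_antisymm h1 h2))

/-- A dangerous structure must have transaction `0` in the middle, and its ends can then only be
transaction `1` and the last one; the three hypotheses on SSI exclude every combination. -/
theorem splitSchedule_allowed
    (hmid : ∀ x y : OpRef T, x.1 = 0 → y.1 ≠ 0 → y.1 ≠ 1 → y.1 ≠ Fin.last (n + 1) →
      ¬ Conflicting x y)
    (hww : ∀ x y : OpRef T, x.1 = 0 → y.1 ≠ 0 → Meet x y → (OpRef.get x).WW (OpRef.get y) →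
      A 0 = .RC ∧ q < x.2)
    (hssi : ¬ (A 0 = .SSI ∧ A 1 = .SSI ∧ A (Fin.last (n + 1)) = .SSI))
    (hwr : A 0 = .SSI → A 1 = .SSI → ∀ x y : OpRef T, x.1 = 0 → y.1 = 1 → Meet x y →
      ¬ (OpRef.get x).WR (OpRef.get y))
    (hrw : A 0 = .SSI → A (Fin.last (n + 1)) = .SSI → ∀ x y : OpRef T, x.1 = 0 →
      y.1 = Fin.last (n + 1) → Meet x y → ¬ (OpRef.get x).RW (OpRef.get y)) :
    (splitSchedule T A q).Allowed A := by
  refine ⟨fun i hi => ⟨fun a _ _ => splitSchedule_respectsCommitOrder a, ?_, ?_⟩,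
    fun i hi => ⟨fun a _ _ => splitSchedule_respectsCommitOrder a, ?_, ?_⟩, ?_⟩
  · rintro a rfl -
    have := splitSchedule_readLastCommitted (A := A) (q := q) a
    rwa [start_of_eq hi] at this
  · rintro ⟨b, a, rfl, hm, hc, h1, h2⟩
    exact splitSchedule_no_overwrite hww hm hc h1 _ rfl (fun _ => rfl) h2
  · rintro a rfl -
    have := splitSchedule_readLastCommitted (A := A) (q := q) a
    rwa [start_of_ne (by rcases hi with hi | hi <;> simp [hi])] at this
  · rintro ⟨b, a, rfl, hm, hc, h1, h2⟩
    by_cases ha : a.1 = 0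
    · have hb : b.1 ≠ 0 := fun hb => hm.1 (hb.trans ha.symm)
      have := (hww a b ha hb hm.symm hc.symm).1
      rw [ha, this] at hi
      simp at hi
    -- `splitSchedule_no_overwrite` now requires `e = .op a`; the order it asks for holds because
    -- each case for `b` is contradictory.
    · by_cases hA : A 0 = .RC
      · refine splitSchedule_no_overwrite hww hm hc h1 (.op a) rfl (fun _ => rfl) ?_
        by_cases hb : b.1 = 0
        · have hw := hww b a hb ha hm hc
          have h1 := splitTime_le_of_lt h1
          rw [splitTime_op_zero hb, if_neg (by omega), splitTime_op_of_ne ha] at h1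
          have := a.1.2
          omega
        · have h1 := splitTime_le_of_lt h1
          have h2 := splitTime_le_of_lt h2
          rw [splitTime_op_of_ne ‹_›, splitTime_op_of_ne ‹_›] at h1
          rw [splitTime_first_of_ne ‹_›, splitTime_commit_of_ne ‹_›] at h2
          exact absurd (Fin.ext (le_antisymm h1 h2)) hm.1
      · exact splitSchedule_no_overwrite hww hm hc h1 _ (first_txn _) (fun h => absurd h hA) h2
  · rintro i j k hi hj hk ⟨⟨x, y, rfl, rfl, hxy⟩, ⟨y', z, hy', rfl, hyz⟩, hcij, hcjk, -, hkj, -⟩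
    have hxy' := hxy.1
    have hyz' := hyz.1
    by_cases h0 : y.1 = 0
    · have hx0 : x.1 ≠ 0 := fun h => hxy'.1 (h.trans h0.symm)
      have hz0 : z.1 ≠ 0 := fun h => hyz'.1 ((hy'.trans h0).trans h.symm)
      have hx : x.1 = 1 ∨ x.1 = Fin.last (n + 1) := by
        by_contra h
        rw [not_or] at h
        exact hmid y x h0 hx0 h.1 h.2 ⟨hxy'.symm, .inr (.inl hxy.2.1.symm)⟩
      have hz : z.1 = 1 ∨ z.1 = Fin.last (n + 1) := by
        by_contra h
        rw [not_or] at h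
        exact hmid y' z (hy'.trans h0) hz0 h.1 h.2 ⟨hyz', .inr (.inr hyz.2.1)⟩
      rw [h0] at hj
      rcases hz with hz | hz
      · rw [hz] at hk
        rcases hx with hx | hx
        · exact hwr hj hk y x h0 hx hxy'.symm hxy.2.1.symm
        · exact hssi ⟨hj, hk, hx ▸ hi⟩
      · rw [hz] at hk
        exact hrw hj hk y' z (hy'.trans h0) hz hyz' hyz.2.1
    -- Two transactions other than `0` are never concurrent, so the structure would end in
    -- transaction `0`, which commits last.
    · have hz0 : z.1 = 0 := by
        by_contra h
        exact splitSchedule_not_concurrent h0 h (fun e => hyz'.1 (hy'.trans e)) hcjk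
      have := splitTime_le_of_lt hkj
      rw [hz0, splitTime_commit_zero, splitTime_commit_of_ne h0] at this
      have := y.1.2
      omega

/-- A cycle of conflicts that can be split is a counterexample to robustness. -/
theorem not_transactionRobust_of_split (o : OpRef T) (ho : o.1 = 0)
    (hfirst : ∃ a : OpRef T, a.1 = 1 ∧ Meet o a ∧ (OpRef.get o).RW (OpRef.get a))
    (hlink : ∀ i j : Fin (n + 2), i ≠ 0 → (j : ℕ) = i + 1 →
      ∃ b a : OpRef T, b.1 = i ∧ a.1 = j ∧ Conflicting b a)
    (hlast : ∃ b a : OpRef T, b.1 = Fin.last (n + 1) ∧ a.1 = 0 ∧ Conflicting b a ∧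
      ((OpRef.get b).RW (OpRef.get a) ∨ A 0 = .RC ∧ (o.2 : ℕ) < a.2))
    (hmid : ∀ x y : OpRef T, x.1 = 0 → y.1 ≠ 0 → y.1 ≠ 1 → y.1 ≠ Fin.last (n + 1) →
      ¬ Conflicting x y)
    (hww : ∀ x y : OpRef T, x.1 = 0 → y.1 ≠ 0 → Meet x y → (OpRef.get x).WW (OpRef.get y) →
      A 0 = .RC ∧ (o.2 : ℕ) < x.2)
    (hssi : ¬ (A 0 = .SSI ∧ A 1 = .SSI ∧ A (Fin.last (n + 1)) = .SSI))
    (hwr : A 0 = .SSI → A 1 = .SSI → ∀ x y : OpRef T, x.1 = 0 → y.1 = 1 → Meet x y →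
      ¬ (OpRef.get x).WR (OpRef.get y))
    (hrw : A 0 = .SSI → A (Fin.last (n + 1)) = .SSI → ∀ x y : OpRef T, x.1 = 0 →
      y.1 = Fin.last (n + 1) → Meet x y → ¬ (OpRef.get x).RW (OpRef.get y)) :
    ¬ TransactionRobust T A := by
  intro hrob
  have hA := splitSchedule_allowed hmid hww hssi hwr hrw
  have hCS := hrob _ hA
  set s := splitSchedule T A o.2 with hs
  -- Transaction `0` commits last, so no ww- or wr-dependency leaves it.
  have hstart : ∀ b : OpRef T, b.1 ≠ 0 → ¬ s.lt (.commit 0) (start A b) := by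
    intro b hb h
    have h := splitTime_le_of_lt (s.lt_trans h (s.start_lt_commit A b))
    rw [splitTime_commit_zero, splitTime_commit_of_ne hb] at h
    have := b.1.2
    omega
  have hlast0 : Fin.last (n + 1) ≠ 0 := Fin.last_pos.ne'
  have d0 : s.TxnDep 0 1 := by
    obtain ⟨a, ha, hm, hc⟩ := hfirst
    refine ⟨o, a, ho, ha, ?_⟩
    -- The read `o` happens at time `0`, before transaction `1` commits, so it cannot have seen the
    -- write `a`.
    rcases s.wrDep_or_rwDep hm.symm hc.symm with h | h
    · have h := splitTime_le_of_lt (s.lt_of_lt_of_not_lt (hA.commit_lt_of_wr h)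
        (s.not_op_lt_start A o))
      rw [ha, splitTime_commit_of_ne (by simp), splitTime_op_zero ho, if_pos le_rfl] at h
      simp at h
    · exact .inr (.inr h)
  have dlink : ∀ i j : Fin (n + 2), i ≠ 0 → (j : ℕ) = i + 1 → s.TxnDep i j := by
    intro i j hi hj
    obtain ⟨b, a, hb, ha, hc⟩ := hlink i j hi hj
    refine ⟨b, a, hb, ha, (s.dep_or_dep hc).resolve_right fun h => ?_⟩
    have hj0 : j ≠ 0 := fun h => by simp [h] at hj
    have h := splitTime_le_of_lt (hA.first_lt_of_dep h)
    rw [ha, hb, splitTime_first_of_ne hj0, splitTime_commit_of_ne hi] at h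
    omega
  have dlast : s.TxnDep (Fin.last (n + 1)) 0 := by
    obtain ⟨b, a, hb, ha, ⟨hm, hc⟩, h⟩ := hlast
    have hb0 : b.1 ≠ 0 := by rwa [hb]
    refine ⟨b, a, hb, ha, ?_⟩
    have hRW : (OpRef.get b).RW (OpRef.get a) → s.Dep b a := fun h =>
      .inr (.inr ((s.wrDep_or_rwDep hm.symm h.symm).resolve_left fun h => by
        have := hA.commit_lt_of_wr h
        rw [ha] at this
        exact hstart b hb0 this))
    rcases h with h | ⟨hRC, hlt⟩
    · exact hRW h
    · rcases hc with hc | hc | hc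
      · refine .inl ((s.wwDep_or_wwDep hm hc).resolve_right fun h => ?_)
        have := hA.commit_lt_of_ww h
        rw [ha] at this
        exact hstart b hb0 this
      -- The antidependency `a → b` is impossible: `a` lies after the split, when `b` is already
      -- committed.
      · refine .inr (.inl ((s.wrDep_or_rwDep hm hc).resolve_right fun h => ?_))
        have := hA.start_lt_of_rw h
        rw [start_of_eq (by rw [ha, hRC])] at this
        have := splitTime_le_of_lt this
        rw [splitTime_op_zero ha, if_neg (by omega), splitTime_commit_of_ne hb0] at this
        have := b.1.2
        omega
      · exact hRW hc
  have hreach : ∀ k (hk : k + 1 < n + 2), Relation.TransGen s.TxnDep 0 ⟨k + 1, hk⟩ := by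
    intro k
    induction k with
    | zero => exact fun _ => .single d0
    | succ k ih =>
      exact fun hk => (ih (by omega)).tail (dlink _ _ (by simp [Fin.ext_iff]) rfl)
  exact hCS.not_transGen 0 ((hreach n (by omega)).tail dlast)

end Split

/-! ### Values of timed programs -/

namespace Timed

variable {α β : Type}

@[simp] theorem val_pure (a : α) : (pure a : Timed α).val = a := rfl
@[simp] theorem val_bind (x : Timed α) (f : α → Timed β) : (x >>= f).val = (f x.val).val := rfl
@[simp] theorem val_ite (c : Prop) [Decidable c] (x y : Timed α) :
    (if c then x else y).val = if c then x.val else y.val := apply_ite _ _ _ _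

@[simp] theorem val_and (x y : Timed Bool) : (Timed.and x y).val = (x.val && y.val) := by
  simp only [Timed.and, val_bind, val_ite, val_pure]
  cases x.val <;> simp

@[simp] theorem val_or (x y : Timed Bool) : (Timed.or x y).val = (x.val || y.val) := by
  simp only [Timed.or, val_bind, val_ite, val_pure]
  cases x.val <;> simp

@[simp] theorem val_not (x : Timed Bool) : (Timed.not x).val = !x.val := rfl
@[simp] theorem val_eqNat (a b : ℕ) : (eqNat a b).val = decide (a = b) := rfl
@[simp] theorem val_ltNat (a b : ℕ) : (ltNat a b).val = decide (a < b) := rfl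

@[simp] theorem val_any (l : List α) (f : α → Timed Bool) :
    (Timed.any l f).val = true ↔ ∃ a ∈ l, (f a).val = true := by
  induction l with
  | nil => simp [Timed.any]
  | cons a l ih =>
    simp only [Timed.any, val_bind, val_ite, val_pure, List.mem_cons, exists_eq_or_imp, ← ih]
    cases (f a).val <;> simp

theorem mem_val_collect {l : List α} {f : α → Timed (List β)} {b : β} :
    b ∈ (collect l f).val ↔ ∃ a ∈ l, b ∈ (f a).val := by
  induction l with
  | nil => simp [collect]
  | cons a l ih => simp [collect, ih]

theorem mem_val_keep {l : List α} {f : α → Timed Bool} {a : α} :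
    a ∈ (keep l f).val ↔ a ∈ l ∧ (f a).val = true := by
  simp only [keep, mem_val_collect, val_bind, val_ite, val_pure]
  constructor
  · rintro ⟨b, hb, h⟩
    split_ifs at h with hf
    · obtain rfl := List.mem_singleton.1 h
      exact ⟨hb, hf⟩
    · simp at h
  · rintro ⟨h, hf⟩
    exact ⟨a, h, by simp [hf]⟩

end Timed

/-! ### Meaning of the tests and of the graph -/

namespace Algo

open Timed

/-- Potentially conflicting occurrences. -/
def Pot (o p : Occ) : Prop := o.op.loc.rel = p.op.loc.rel ∧ o.op.Clash p.op

theorem Pot.symm {o p : Occ} (h : Pot o p) : Pot p o := ⟨h.1.symm, h.2.symm⟩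

theorem val_eqVar (X Y : Var) : (eqVar X Y).val = true ↔ X = Y := by
  cases X
  cases Y
  simp [eqVar]

theorem val_sameVar (o p : Occ) : (sameVar o p).val = true ↔ o.op.loc = p.op.loc :=
  val_eqVar _ _

theorem val_sameOcc (o p : Occ) :
    (sameOcc o p).val = true ↔ o.tid = p.tid ∧ o.pos = p.pos := by
  simp [sameOcc]

theorem val_meets (l l' : List ℕ) : (meets l l').val = true ↔ ∃ x ∈ l, x ∈ l' := by
  simp [meets]

theorem val_potWW (o p : Occ) :
    (potWW o p).val = true ↔ o.op.loc.rel = p.op.loc.rel ∧ o.op.WW p.op := by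
  simp [potWW, sameType, val_meets, Op.WW]

theorem val_potWR (o p : Occ) :
    (potWR o p).val = true ↔ o.op.loc.rel = p.op.loc.rel ∧ o.op.WR p.op := by
  simp [potWR, sameType, val_meets, Op.WR]

theorem val_potRW (o p : Occ) :
    (potRW o p).val = true ↔ o.op.loc.rel = p.op.loc.rel ∧ o.op.RW p.op := by
  simp [potRW, sameType, val_meets, Op.RW]

theorem val_pot (o p : Occ) : (pot o p).val = true ↔ Pot o p := by
  simp only [pot, val_or, Bool.or_eq_true, val_potWW, val_potWR, val_potRW, Pot, Op.Clash]
  tauto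

/-- Some operation of `τ₁` over the variable of `o₁` is potentially conflicting with an operation
of `τ` over the variable of `o`. -/
def Blocked (τ₁ : InTemplate) (o₁ : Occ) (τ : InTemplate) (o : Occ) : Prop :=
  ∃ x ∈ τ₁.occs, x.op.loc = o₁.op.loc ∧ ∃ y ∈ τ.occs, y.op.loc = o.op.loc ∧ Pot x y

theorem val_blocked (τ₁ : InTemplate) (o₁ : Occ) (τ : InTemplate) (o : Occ) :
    (blocked τ₁ o₁ τ o).val = true ↔ Blocked τ₁ o₁ τ o := by
  simp [blocked, val_sameVar, val_pot, Blocked]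

theorem mem_nodes {o₁ p₁ : Occ} {τ₁ : InTemplate} {h : Bool} {Q : List InTemplate} {x : Node} :
    x ∈ (nodes o₁ p₁ τ₁ h Q).val ↔ ∃ τ ∈ Q, x.occ ∈ τ.occs ∧
      (x.label = .O ∨ h = true ∧ x.label = .P → ¬ Blocked τ₁ o₁ τ x.occ) ∧
      (x.label = .P ∨ h = true ∧ x.label = .O → ¬ Blocked τ₁ p₁ τ x.occ) := by
  have hl : ∀ c : Label, c ∈ [Label.O, Label.P, Label.N] := by rintro (_ | _ | _) <;> simp
  have hex : ∀ τ o (c : Label), (Timed.or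
      (Timed.and (pure (decide (c = .O) || (h && decide (c = .P)))) (blocked τ₁ o₁ τ o))
      (Timed.and (pure (decide (c = .P) || (h && decide (c = .O))))
        (blocked τ₁ p₁ τ o))).val = true ↔
      ((c = .O ∨ h = true ∧ c = .P) ∧ Blocked τ₁ o₁ τ o ∨
        (c = .P ∨ h = true ∧ c = .O) ∧ Blocked τ₁ p₁ τ o) := by
    intro τ o c
    simp only [val_or, val_and, val_pure, Bool.or_eq_true, Bool.and_eq_true, decide_eq_true_eq,
      val_blocked]
  simp only [nodes, mem_val_collect, val_bind, val_ite, val_pure]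
  constructor
  · rintro ⟨τ, hτ, o, ho, c, -, hx⟩
    split_ifs at hx with hn
    · simp at hx
    · rw [hex, not_or] at hn
      have hx : x = ⟨o, c, .inc⟩ ∨ x = ⟨o, c, .out⟩ := by simpa using hx
      refine ⟨τ, hτ, ?_⟩
      rcases hx with rfl | rfl <;>
        exact ⟨ho, fun h1 h2 => hn.1 ⟨h1, h2⟩, fun h1 h2 => hn.2 ⟨h1, h2⟩⟩
  · rintro ⟨τ, hτ, ho, h1, h2⟩
    refine ⟨τ, hτ, x.occ, ho, x.label, hl _, ?_⟩
    rw [if_neg (by rw [hex]; rintro (⟨h, h'⟩ | ⟨h, h'⟩); exacts [h1 h h', h2 h h'])]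
    obtain ⟨o, c, _ | _⟩ := x <;> simp

/-- The two kinds of edges of the pt-conflict-graph. -/
def Edge (h : Bool) (x y : Node) : Prop :=
  x.dir = .out ∧ y.dir = .inc ∧ x.label = y.label ∧ Pot x.occ y.occ ∨
  x.dir = .inc ∧ y.dir = .out ∧ x.occ.tid = y.occ.tid ∧
    (x.occ.op.loc = y.occ.op.loc ∧
        (x.label = y.label ∨ x.label = .O ∧ y.label = .P ∧ h = true) ∨
      x.occ.op.loc ≠ y.occ.op.loc ∧ breakPair x.label y.label = true)

theorem val_isEdge (h : Bool) (x y : Node) : (isEdge h x y).val = true ↔ Edge h x y := by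
  unfold isEdge Edge
  split
  next h1 h2 => simp [h1, h2, val_pot]
  next h1 h2 =>
    simp only [h1, h2, val_and, val_eqNat, val_bind, val_ite, val_pure, Bool.and_eq_true,
      decide_eq_true_eq]
    by_cases hv : x.occ.op.loc = y.occ.op.loc
    · simp [(val_sameVar _ _).2 hv, hv, and_assoc]
    · have : (sameVar x.occ y.occ).val = false := by
        rw [← Bool.not_eq_true, val_sameVar]
        exact hv
      simp [this, hv]
  next h1 h2 =>
    have : ∀ d d' : Dir, (d = .out → d' = .inc → False) → (d = .inc → d' = .out → False) →
      ¬ (d = .out ∧ d' = .inc) ∧ ¬ (d = .inc ∧ d' = .out) := by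
      intro d d'
      cases d <;> cases d' <;> simp
    have := this _ _ h1 h2
    simp only [val_bind, val_pure, Bool.false_eq_true, false_iff]
    tauto

theorem mem_edges {h : Bool} {V : List Node} {x y : Node} :
    (x, y) ∈ (edges h V).val ↔ x ∈ V ∧ y ∈ V ∧ Edge h x y := by
  simp only [edges, mem_val_collect, val_bind, val_ite, val_pure]
  constructor
  · rintro ⟨a, ha, b, hb, hx⟩
    split_ifs at hx with he
    · have hx : x = a ∧ y = b := by simpa using hx
      obtain ⟨rfl, rfl⟩ := hx
      exact ⟨ha, hb, (val_isEdge _ _ _).1 he⟩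
    · simp at hx
  · rintro ⟨hx, hy, he⟩
    exact ⟨x, hx, y, hy, by rw [if_pos ((val_isEdge _ _ _).2 he)]; simp⟩

/-! ### The numbered input -/

/-- The occurrences of `τ` are those of the template `t`. -/
def Describes (τ : InTemplate) (t : Template) : Prop :=
  ∀ o : Occ, o ∈ τ.occs ↔ o.tid = τ.tid ∧ t[o.pos]? = some o.op

theorem mem_numberOps {tid pos : ℕ} {t : Template} {o : Occ} :
    o ∈ (numberOps tid pos t).val ↔
      o.tid = tid ∧ pos ≤ o.pos ∧ t[o.pos - pos]? = some o.op := by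
  induction t generalizing pos with
  | nil => simp [numberOps]
  | cons a t ih =>
    simp only [numberOps, val_bind, val_pure, List.mem_cons, ih]
    obtain ⟨i, k, op⟩ := o
    simp only [Occ.mk.injEq]
    constructor
    · rintro (⟨rfl, rfl, rfl⟩ | ⟨rfl, h1, h2⟩)
      · simp
      · refine ⟨rfl, by omega, ?_⟩
        rwa [show k - pos = k - (pos + 1) + 1 by omega, List.getElem?_cons_succ]
    · rintro ⟨rfl, h1, h2⟩
      rcases h1.lt_or_eq with h | rfl
      · refine .inr ⟨rfl, h, ?_⟩
        rwa [show k - pos = k - (pos + 1) + 1 by omega, List.getElem?_cons_succ] at h2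
      · have : a = op := by simpa using h2
        exact .inl ⟨rfl, rfl, this.symm⟩

theorem mem_numberTemplates {tid : ℕ} {l : List (Template × Level)} {τ : InTemplate} :
    τ ∈ (numberTemplates tid l).val ↔ tid ≤ τ.tid ∧ ∃ x, l[τ.tid - tid]? = some x ∧
      τ.level = x.2 ∧ τ.occs = (numberOps τ.tid 0 x.1).val := by
  induction l generalizing tid with
  | nil => simp [numberTemplates]
  | cons a t ih =>
    simp only [numberTemplates, val_bind, val_pure, List.mem_cons, ih]
    obtain ⟨k, lev, occs⟩ := τ
    simp only [InTemplate.mk.injEq]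
    constructor
    · rintro (⟨rfl, rfl, rfl⟩ | ⟨h1, h2⟩)
      · simp
      · refine ⟨by omega, ?_⟩
        rwa [show k - tid = k - (tid + 1) + 1 by omega, List.getElem?_cons_succ]
    · rintro ⟨h1, h2⟩
      rcases h1.lt_or_eq with h | rfl
      · refine .inr ⟨h, ?_⟩
        rwa [show k - tid = k - (tid + 1) + 1 by omega, List.getElem?_cons_succ] at h2
      · obtain ⟨x, hx, h⟩ := h2
        have : a = x := by simpa using hx
        exact .inl ⟨rfl, this ▸ h⟩

/-- `Q` is a numbered version of the templates `P` with the levels `A`. -/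
structure IsInput (Q : List InTemplate) (P : List Template) (A : Template → Level) : Prop where
  exists_template : ∀ τ ∈ Q, ∃ t ∈ P, τ.level = A t ∧ Describes τ t
  exists_inTemplate : ∀ t ∈ P, ∃ τ ∈ Q, τ.level = A t ∧ Describes τ t
  eq_of_tid : ∀ τ ∈ Q, ∀ τ' ∈ Q, τ.tid = τ'.tid → τ = τ'

theorem isInput_numberTemplates (P : List Template) (A : Template → Level) :
    IsInput (numberTemplates 0 (P.map fun τ => (τ, A τ))).val P A := by
  have hmem : ∀ τ, τ ∈ (numberTemplates 0 (P.map fun τ => (τ, A τ))).val ↔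
      ∃ t, P[τ.tid]? = some t ∧ τ.level = A t ∧ τ.occs = (numberOps τ.tid 0 t).val := by
    intro τ
    simp [mem_numberTemplates]
  have hdesc : ∀ (τ : InTemplate) t, τ.occs = (numberOps τ.tid 0 t).val → Describes τ t := by
    intro τ t h o
    simp [h, mem_numberOps]
  constructor
  · intro τ hτ
    obtain ⟨t, h1, h2, h3⟩ := (hmem τ).1 hτ
    exact ⟨t, List.mem_of_getElem? h1, h2, hdesc _ _ h3⟩
  · intro t ht
    obtain ⟨k, hk⟩ := List.mem_iff_getElem?.1 ht
    exact ⟨⟨k, A t, (numberOps k 0 t).val⟩, (hmem _).2 ⟨t, hk, rfl, rfl⟩, rfl, hdesc _ _ rfl⟩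
  · intro τ hτ τ' hτ' h
    obtain ⟨t, h1, h2, h3⟩ := (hmem τ).1 hτ
    obtain ⟨t', h1', h2', h3'⟩ := (hmem τ').1 hτ'
    rw [← h, h1] at h1'
    obtain rfl := Option.some.inj h1'
    obtain ⟨a, b, c⟩ := τ
    obtain ⟨a', b', c'⟩ := τ'
    simp_all

namespace IsInput

variable {Q : List InTemplate} {P : List Template} {A : Template → Level}

theorem tid_eq (hQ : IsInput Q P A) {τ : InTemplate} (hτ : τ ∈ Q) {o : Occ}
    (ho : o ∈ τ.occs) : o.tid = τ.tid := by
  obtain ⟨t, -, -, h⟩ := hQ.exists_template τ hτ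
  exact ((h o).1 ho).1

theorem eq_of_mem (hQ : IsInput Q P A) {τ τ' : InTemplate} (hτ : τ ∈ Q) (hτ' : τ' ∈ Q)
    {o o' : Occ} (ho : o ∈ τ.occs) (ho' : o' ∈ τ'.occs) (h : o.tid = o'.tid) : τ = τ' :=
  hQ.eq_of_tid τ hτ τ' hτ' (by rw [← hQ.tid_eq hτ ho, h, hQ.tid_eq hτ' ho'])

theorem occ_eq (hQ : IsInput Q P A) {τ τ' : InTemplate} (hτ : τ ∈ Q) (hτ' : τ' ∈ Q)
    {o o' : Occ} (ho : o ∈ τ.occs) (ho' : o' ∈ τ'.occs) (h : o.tid = o'.tid)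
    (h' : o.pos = o'.pos) : o = o' := by
  obtain rfl := hQ.eq_of_mem hτ hτ' ho ho' h
  obtain ⟨t, -, -, hd⟩ := hQ.exists_template τ hτ
  have h1 := ((hd o).1 ho).2
  have h2 := ((hd o').1 ho').2
  rw [← h', h1] at h2
  obtain ⟨a, b, c⟩ := o
  obtain ⟨a', b', c'⟩ := o'
  simp_all

/-! ### The computed transitive closure -/

/-- A list of nodes over the occurrences of `Q`. -/
def NodesOver (Q : List InTemplate) (V : List Node) : Prop :=
  ∀ x ∈ V, ∃ τ ∈ Q, x.occ ∈ τ.occs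

theorem val_sameNode (hQ : IsInput Q P A) {V : List Node} (hV : NodesOver Q V) {x y : Node}
    (hx : x ∈ V) (hy : y ∈ V) : (sameNode x y).val = true ↔ x = y := by
  simp only [sameNode, val_and, val_pure, Bool.and_eq_true, decide_eq_true_eq, val_sameOcc]
  constructor
  · rintro ⟨⟨h1, h2⟩, h3, h4⟩
    obtain ⟨τ, hτ, ho⟩ := hV x hx
    obtain ⟨τ', hτ', ho'⟩ := hV y hy
    have := hQ.occ_eq hτ hτ' ho ho' h1 h2
    cases x
    cases y
    simp_all
  · rintro rfl
    simp

theorem val_isListed (hQ : IsInput Q P A) {V : List Node} (hV : NodesOver Q V)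
    {F : List (Node × Node)} (hF : ∀ e ∈ F, e.1 ∈ V ∧ e.2 ∈ V) {x y : Node} (hx : x ∈ V)
    (hy : y ∈ V) : (isListed F x y).val = true ↔ (x, y) ∈ F := by
  simp only [isListed, val_any, val_and, Bool.and_eq_true]
  constructor
  · rintro ⟨e, he, h1, h2⟩
    rw [hQ.val_sameNode hV (hF e he).1 hx] at h1
    rw [hQ.val_sameNode hV (hF e he).2 hy] at h2
    rwa [← h1, ← h2]
  · exact fun h => ⟨_, h, (hQ.val_sameNode hV hx hx).2 rfl, (hQ.val_sameNode hV hy hy).2 rfl⟩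

theorem mem_extend (hQ : IsInput Q P A) {V : List Node} (hV : NodesOver Q V)
    {E F : List (Node × Node)} (hE : ∀ e ∈ E, e.1 ∈ V ∧ e.2 ∈ V)
    (hF : ∀ e ∈ F, e.1 ∈ V ∧ e.2 ∈ V) {x y : Node} :
    (x, y) ∈ (extend V E F).val ↔ (x ∈ V ∧ y ∈ V) ∧
      ((x, y) ∈ F ∨ ∃ z ∈ V, (x, z) ∈ F ∧ (z, y) ∈ E) := by
  have key : ∀ a ∈ V, ∀ b ∈ V, ((Timed.or (isListed F a b)
      (Timed.any V fun z => Timed.and (isListed F a z) (isListed E z b))).val = true ↔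
      ((a, b) ∈ F ∨ ∃ z ∈ V, (a, z) ∈ F ∧ (z, b) ∈ E)) := by
    intro a ha b hb
    simp only [val_or, Bool.or_eq_true, val_any, val_and, Bool.and_eq_true,
      hQ.val_isListed hV hF ha hb]
    refine or_congr_right (exists_congr fun z => and_congr_right fun hz => ?_)
    rw [hQ.val_isListed hV hF ha hz, hQ.val_isListed hV hE hz hb]
  simp only [extend, mem_val_collect, val_bind, val_ite, val_pure]
  constructor
  · rintro ⟨a, ha, b, hb, hx⟩
    split_ifs at hx with he
    · have hx : x = a ∧ y = b := by simpa using hx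
      obtain ⟨rfl, rfl⟩ := hx
      exact ⟨⟨ha, hb⟩, (key _ ha _ hb).1 he⟩
    · simp at hx
  · rintro ⟨⟨hx, hy⟩, he⟩
    exact ⟨x, hx, y, hy, by rw [if_pos ((key _ hx _ hy).2 he)]; simp⟩

/-- After `k` rounds the list contains the pairs that are joined by a walk of length between `1`
and `k + 1`. -/
theorem mem_rounds (hQ : IsInput Q P A) {V : List Node} (hV : NodesOver Q V)
    {E : List (Node × Node)} (hE : ∀ e ∈ E, e.1 ∈ V ∧ e.2 ∈ V) (l : List Node) :
    ∀ (F : List (Node × Node)), (∀ e ∈ F, e.1 ∈ V ∧ e.2 ∈ V) → ∀ k : ℕ,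
      (∀ x y, (x, y) ∈ F ↔ ∃ n, 0 < n ∧ n ≤ k + 1 ∧ ∃ c : ℕ → Node, c 0 = x ∧ c n = y ∧
        ∀ i < n, (c i, c (i + 1)) ∈ E) →
      ∀ x y, (x, y) ∈ (rounds V E l F).val ↔ ∃ n, 0 < n ∧ n ≤ k + l.length + 1 ∧
        ∃ c : ℕ → Node, c 0 = x ∧ c n = y ∧ ∀ i < n, (c i, c (i + 1)) ∈ E := by
  induction l with
  | nil => exact fun F _ k h => h
  | cons a l ih =>
    intro F hF k h x y
    simp only [rounds, val_bind]
    rw [ih _ (fun e he => ((hQ.mem_extend hV hE hF).1 (show (e.1, e.2) ∈ _ from he)).1) (k + 1)]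
    · simp only [List.length_cons, show k + 1 + l.length + 1 = k + (l.length + 1) + 1 by omega]
    · intro x y
      rw [hQ.mem_extend hV hE hF]
      constructor
      · rintro ⟨-, hxy | ⟨z, hz, h1, h2⟩⟩
        · obtain ⟨n, h1, h2, h3⟩ := (h x y).1 hxy
          exact ⟨n, h1, by omega, h3⟩
        · obtain ⟨n, hn, hnk, c, h0, hc, hw⟩ := (h x z).1 h1
          refine ⟨n + 1, by omega, by omega, fun i => if i ≤ n then c i else y, by simpa using h0,
            by simp, fun i hi => ?_⟩
          by_cases hin : i = n
          · subst hin
            simpa [hc] using h2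
          · simpa [show i ≤ n by omega, show i + 1 ≤ n by omega] using hw i (by omega)
      · rintro ⟨n, hn, hnk, c, rfl, rfl, hw⟩
        have h0 := (hE _ (hw 0 hn)).1
        have h1 := hE _ (hw (n - 1) (by omega))
        have hn1 : n - 1 + 1 = n := by omega
        rw [hn1] at h1
        refine ⟨⟨h0, h1.2⟩, ?_⟩
        -- A walk not yet listed has length exactly `k + 2`; its last edge is split off.
        by_cases hle : n ≤ k + 1
        · exact .inl ((h _ _).2 ⟨n, hn, hle, c, rfl, rfl, hw⟩)
        · have h2 := hw (n - 1) (by omega)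
          rw [hn1] at h2
          exact .inr ⟨c (n - 1), h1.1,
            (h _ _).2 ⟨n - 1, by omega, by omega, c, rfl, rfl, fun i hi => hw i (by omega)⟩, h2⟩

end IsInput

/-- A walk inside a finite set can be shortened to the size of the set. -/
theorem exists_short_walk {α : Type*} {R : α → α → Prop} (V : List α)
    (hV : ∀ x y, R x y → y ∈ V) {x y : α} (h : Relation.TransGen R x y) :
    ∃ n, 0 < n ∧ n ≤ V.length ∧ ∃ c : ℕ → α, c 0 = x ∧ c n = y ∧ ∀ i < n, R (c i) (c (i + 1)) := by
  classical
  have hex := transGen_iff_exists_walk.1 h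
  obtain ⟨hn, c, h0, h1, hc⟩ := Nat.find_spec hex
  set n := Nat.find hex
  refine ⟨n, hn, ?_, c, h0, h1, hc⟩
  by_contra hlt
  -- Pigeonhole on the positions `1, …, n`; the start is left out because it need not lie in `V`.
  obtain ⟨i, hi, j, hj, hij, he⟩ := Finset.exists_ne_map_eq_of_card_lt_of_maps_to
    (s := Finset.Icc 1 n) (t := V.toFinset) (f := c)
    (by
      have := V.toFinset_card_le
      rw [Nat.card_Icc]
      omega)
    (fun i hi => by
      have hi := Finset.mem_Icc.1 hi
      have := hV _ _ (hc (i - 1) (by omega))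
      rw [show i - 1 + 1 = i by omega] at this
      simpa using this)
  wlog hlt' : i < j generalizing i j
  · exact this j hj i hi hij.symm he.symm (by omega)
  have hi := Finset.mem_Icc.1 hi
  have hj := Finset.mem_Icc.1 hj
  -- Cutting out the part between the two visits gives a shorter walk, still nonempty since `i ≥ 1`.
  have := Nat.find_min' hex (m := n - (j - i)) ⟨by omega,
    fun k => if k ≤ i then c k else c (k + (j - i)), by simpa using h0, ?_, fun k hk => ?_⟩
  · omega
  · dsimp only
    split_ifs with hle
    · have : n - (j - i) = i := by omega
      rw [this, he, ← h1]
      congr 1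
      omega
    · rw [show n - (j - i) + (j - i) = n by omega, h1]
  · rcases lt_trichotomy k i with hki | rfl | hki
    · dsimp only
      rw [if_pos (by omega), if_pos (by omega)]
      exact hc k (by omega)
    · dsimp only
      rw [if_pos le_rfl, if_neg (by omega), he, show k + 1 + (j - k) = j + 1 by omega]
      exact hc j (by omega)
    · dsimp only
      rw [if_neg (by omega), if_neg (by omega), show k + 1 + (j - i) = k + (j - i) + 1 by omega]
      exact hc _ (by omega)

/-- Starting from the edges, `V.length` rounds capture all walks of length up to `V.length + 1`; by
`exists_short_walk` length `V.length` already suffices. -/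
theorem IsInput.mem_transClosure {Q : List InTemplate} {P : List Template}
    {A : Template → Level} (hQ : IsInput Q P A) {V : List Node} (hV : NodesOver Q V)
    {E : List (Node × Node)} (hE : ∀ e ∈ E, e.1 ∈ V ∧ e.2 ∈ V) {x y : Node} :
    (x, y) ∈ (transClosure V E).val ↔ Relation.TransGen (fun x y => (x, y) ∈ E) x y := by
  rw [transClosure, hQ.mem_rounds hV hE V E hE 0]
  · constructor
    · rintro ⟨n, hn, -, h⟩
      exact transGen_iff_exists_walk.2 ⟨n, hn, h⟩
    · intro h
      obtain ⟨n, hn, hle, h⟩ := exists_short_walk V (fun x y h => (hE _ h).2) h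
      exact ⟨n, hn, by omega, h⟩
  · intro x y
    constructor
    · intro h
      refine ⟨1, one_pos, le_rfl, fun i => if i = 0 then x else y, rfl, rfl, fun i hi => ?_⟩
      obtain rfl : i = 0 := by omega
      simpa using h
    · rintro ⟨n, hn, hn', c, rfl, rfl, h⟩
      obtain rfl : n = 1 := by omega
      exact h 0 one_pos

/-! ### The search conditions as predicates -/

/-- The label `O` of one operation and the label `P` of the other one mean the same. -/
def Switch (h : Bool) (c₂ cₙ : Label) : Prop := h = true ∧ c₂ = .O ∧ cₙ = .P

theorem val_reachable {o₂ p₂ : Occ} {c₂ : Label} {oₙ pₙ : Occ} {cₙ : Label} {h : Bool}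
    {TC : List (Node × Node)} :
    (reachable o₂ p₂ c₂ oₙ pₙ cₙ h TC).val = true ↔
      ((o₂.tid = oₙ.tid ∧ o₂.pos = oₙ.pos) ∧ p₂.tid = pₙ.tid ∧ p₂.pos = pₙ.pos) ∧
        (c₂ = .P ∧ cₙ = .O ∨ Switch h c₂ cₙ) ∨
      Pot o₂ pₙ ∧ (c₂ = cₙ ∨ Switch h c₂ cₙ) ∨
      ∃ e ∈ TC, (e.1.dir = .inc ∧ e.2.dir = .out ∧ e.1.label = c₂ ∧ e.2.label = cₙ) ∧
        Pot e.1.occ o₂ ∧ Pot e.2.occ pₙ := by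
  simp only [reachable, val_or, val_and, val_any, val_pure, Bool.or_eq_true, Bool.and_eq_true,
    decide_eq_true_eq, val_sameOcc, val_pot, Switch, and_assoc]

/-- The relation that `connected` decides. -/
def Connected (o₁ p₁ : Occ) (h : Bool) (q : Occ) (d : Label) (q' : Occ) (d' : Label)
    (X Y : Var) : Prop :=
  X = o₁.op.loc ∧ (Y = q.op.loc ∧ d = .O ∨ Y = q'.op.loc ∧ d' = .O) ∨
  X = p₁.op.loc ∧ (Y = q.op.loc ∧ d = .P ∨ Y = q'.op.loc ∧ d' = .P) ∨
  h = true ∧ (X = o₁.op.loc ∨ X = p₁.op.loc) ∧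
    ((Y = q.op.loc ∧ d = .O ∨ Y = q'.op.loc ∧ d' = .O) ∨
      (Y = q.op.loc ∧ d = .P ∨ Y = q'.op.loc ∧ d' = .P))

theorem val_connected {o₁ p₁ : Occ} {h : Bool} {q : Occ} {d : Label} {q' : Occ} {d' : Label}
    {X Y : Var} : (connected o₁ p₁ h q d q' d' X Y).val = true ↔
      Connected o₁ p₁ h q d q' d' X Y := by
  simp only [connected, val_bind, val_pure, Bool.or_eq_true, Bool.and_eq_true, decide_eq_true_eq,
    val_eqVar, Connected, and_assoc, or_assoc]

theorem val_clash {test : Occ → Occ → Timed Bool} {conn : Var → Var → Timed Bool}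
    {l l' : List Occ} : (clash test conn l l').val = true ↔
      ∃ x ∈ l, ∃ y ∈ l', (test x y).val = true ∧ (conn x.op.loc y.op.loc).val = true := by
  simp only [clash, val_any, val_and, Bool.and_eq_true]

/-- The conditions that `validSchedule` checks. -/
structure ValidSchedule (τ₁ : InTemplate) (o₁ p₁ : Occ) (τ₂ : InTemplate) (o₂ p₂ : Occ)
    (c₂ : Label) (τₙ : InTemplate) (oₙ pₙ : Occ) (cₙ : Label) (h : Bool) : Prop where
  ww₂ : ∀ x ∈ τ₁.occs, ∀ y ∈ τ₂.occs, x.op.loc.rel = y.op.loc.rel → x.op.WW y.op →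
    Connected o₁ p₁ h p₂ .O o₂ c₂ x.op.loc y.op.loc → τ₁.level = .RC ∧ o₁.pos < x.pos
  wwₙ : ∀ x ∈ τ₁.occs, ∀ y ∈ τₙ.occs, x.op.loc.rel = y.op.loc.rel → x.op.WW y.op →
    Connected o₁ p₁ h oₙ .P pₙ cₙ x.op.loc y.op.loc → τ₁.level = .RC ∧ o₁.pos < x.pos
  rw₂ : o₁.op.loc.rel = p₂.op.loc.rel ∧ o₁.op.RW p₂.op
  rwₙ : oₙ.op.loc.rel = p₁.op.loc.rel ∧ oₙ.op.RW p₁.op ∨ τ₁.level = .RC ∧ o₁.pos < p₁.pos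
  not_ssi : ¬ (τ₁.level = .SSI ∧ τ₂.level = .SSI ∧ τₙ.level = .SSI)
  wr₂ : τ₁.level = .SSI → τ₂.level = .SSI → ∀ x ∈ τ₁.occs, ∀ y ∈ τ₂.occs,
    x.op.loc.rel = y.op.loc.rel → x.op.WR y.op →
      ¬ Connected o₁ p₁ h p₂ .O o₂ c₂ x.op.loc y.op.loc
  not_rwₙ : τ₁.level = .SSI → τₙ.level = .SSI → ∀ x ∈ τ₁.occs, ∀ y ∈ τₙ.occs,
    x.op.loc.rel = y.op.loc.rel → x.op.RW y.op →
      ¬ Connected o₁ p₁ h oₙ .P pₙ cₙ x.op.loc y.op.loc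

theorem ite_false_eq_true {c : Prop} [Decidable c] {b : Bool} :
    (if c then false else b) = true ↔ ¬ c ∧ b = true := by
  split_ifs with h <;> simp [h]

/-- The ww-tests on both sides of `o₁` merge into one rule, the form used in `SplitCycle`: such a
conflict over connected variables is tolerated only under RC and after `o₁`. -/
theorem val_validSchedule {τ₁ : InTemplate} {o₁ p₁ : Occ} {τ₂ : InTemplate} {o₂ p₂ : Occ}
    {c₂ : Label} {τₙ : InTemplate} {oₙ pₙ : Occ} {cₙ : Label} {h : Bool} :
    (validSchedule τ₁ o₁ p₁ τ₂ o₂ p₂ c₂ τₙ oₙ pₙ cₙ h).val = true ↔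
      ValidSchedule τ₁ o₁ p₁ τ₂ o₂ p₂ c₂ τₙ oₙ pₙ cₙ h := by
  have hpre : ∀ x, x ∈ (keep τ₁.occs fun o => Timed.not (ltNat o₁.pos o.pos)).val ↔
      x ∈ τ₁.occs ∧ ¬ o₁.pos < x.pos := by
    intro x
    simp [mem_val_keep]
  have hpost : ∀ x, x ∈ (keep τ₁.occs fun o => ltNat o₁.pos o.pos).val ↔
      x ∈ τ₁.occs ∧ o₁.pos < x.pos := by
    intro x
    simp [mem_val_keep]
  simp only [validSchedule, val_bind, val_ite, val_pure, ite_false_eq_true]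
  simp only [val_or, val_and, val_not, val_pure, val_ltNat, val_clash, val_potWW, val_potWR,
    val_potRW, val_connected, hpre, hpost, Bool.or_eq_true, Bool.and_eq_true, decide_eq_true_eq,
    Bool.not_eq_true', ← Bool.not_eq_true, and_true, not_or, not_and, not_not]
  constructor
  · rintro ⟨h1, h2, h3, h4, h5, h6, h7⟩
    refine ⟨?_, ?_, by_contra fun hc => h3 fun a b => hc ⟨a, b⟩, ?_, ?_, ?_, ?_⟩
    · intro x hx y hy hr hw hc
      by_contra hn
      by_cases hlt : o₁.pos < x.pos
      · exact (h2 fun h => hn ⟨h, hlt⟩).1 ⟨x, ⟨hx, hlt⟩, y, hy, ⟨hr, hw⟩, hc⟩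
      · exact h1.1 ⟨x, ⟨hx, hlt⟩, y, hy, ⟨hr, hw⟩, hc⟩
    · intro x hx y hy hr hw hc
      by_contra hn
      by_cases hlt : o₁.pos < x.pos
      · exact (h2 fun h => hn ⟨h, hlt⟩).2 ⟨x, ⟨hx, hlt⟩, y, hy, ⟨hr, hw⟩, hc⟩
      · exact h1.2 ⟨x, ⟨hx, hlt⟩, y, hy, ⟨hr, hw⟩, hc⟩
    · by_cases hr : oₙ.op.loc.rel = p₁.op.loc.rel ∧ oₙ.op.RW p₁.op
      · exact .inl hr
      · exact .inr (h4 fun a b => hr ⟨a, b⟩)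
    · exact fun h => h5 ⟨h.1, h.2.1⟩ h.2.2
    · exact fun ha hb x hx y hy hr hw hc => h6 ⟨ha, hb⟩ ⟨x, hx, y, hy, ⟨hr, hw⟩, hc⟩
    · exact fun ha hb x hx y hy hr hw hc => h7 ⟨ha, hb⟩ ⟨x, hx, y, hy, ⟨hr, hw⟩, hc⟩
  · intro H
    refine ⟨⟨?_, ?_⟩, fun hl => ⟨?_, ?_⟩, fun hc => hc H.rw₂.1 H.rw₂.2, fun hn => ?_,
      fun a b => H.not_ssi ⟨a.1, a.2, b⟩, ?_, ?_⟩
    · rintro ⟨x, ⟨hx, hlt⟩, y, hy, ⟨hr, hw⟩, hc⟩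
      exact hlt (H.ww₂ x hx y hy hr hw hc).2
    · rintro ⟨x, ⟨hx, hlt⟩, y, hy, ⟨hr, hw⟩, hc⟩
      exact hlt (H.wwₙ x hx y hy hr hw hc).2
    · rintro ⟨x, ⟨hx, hlt⟩, y, hy, ⟨hr, hw⟩, hc⟩
      exact hl (H.ww₂ x hx y hy hr hw hc).1
    · rintro ⟨x, ⟨hx, hlt⟩, y, hy, ⟨hr, hw⟩, hc⟩
      exact hl (H.wwₙ x hx y hy hr hw hc).1
    · exact H.rwₙ.resolve_left fun h => hn h.1 h.2
    · rintro ⟨ha, hb⟩ ⟨x, hx, y, hy, ⟨hr, hw⟩, hc⟩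
      exact H.wr₂ ha hb x hx y hy hr hw hc
    · rintro ⟨ha, hb⟩ ⟨x, hx, y, hy, ⟨hr, hw⟩, hc⟩
      exact H.not_rwₙ ha hb x hx y hy hr hw hc

/-- The edges of the pt-conflict-graph between its nodes. -/
def GraphEdge (Q : List InTemplate) (τ₁ : InTemplate) (o₁ p₁ : Occ) (h : Bool)
    (x y : Node) : Prop :=
  x ∈ (nodes o₁ p₁ τ₁ h Q).val ∧ y ∈ (nodes o₁ p₁ τ₁ h Q).val ∧ Edge h x y

/-- The condition `Reachable`. -/
def Reachable (Q : List InTemplate) (τ₁ : InTemplate) (o₁ p₁ : Occ) (h : Bool) (o₂ p₂ : Occ)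
    (c₂ : Label) (oₙ pₙ : Occ) (cₙ : Label) : Prop :=
  (o₂ = oₙ ∧ p₂ = pₙ) ∧ (c₂ = .P ∧ cₙ = .O ∨ Switch h c₂ cₙ) ∨
  Pot o₂ pₙ ∧ (c₂ = cₙ ∨ Switch h c₂ cₙ) ∨
  ∃ x y, Relation.TransGen (GraphEdge Q τ₁ o₁ p₁ h) x y ∧ x.dir = .inc ∧ y.dir = .out ∧
    x.label = c₂ ∧ y.label = cₙ ∧ Pot x.occ o₂ ∧ Pot y.occ pₙ

/-- The choices of the algorithm that show that the templates are not robust. -/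
structure Counterexample (Q : List InTemplate) where
  τ₁ : InTemplate
  τ₁_mem : τ₁ ∈ Q
  o₁ : Occ
  o₁_mem : o₁ ∈ τ₁.occs
  p₁ : Occ
  p₁_mem : p₁ ∈ τ₁.occs
  h : Bool
  h_eq : o₁.op.loc = p₁.op.loc → h = true
  τ₂ : InTemplate
  τ₂_mem : τ₂ ∈ Q
  o₂ : Occ
  o₂_mem : o₂ ∈ τ₂.occs
  p₂ : Occ
  p₂_mem : p₂ ∈ τ₂.occs
  τₙ : InTemplate
  τₙ_mem : τₙ ∈ Q
  oₙ : Occ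
  oₙ_mem : oₙ ∈ τₙ.occs
  pₙ : Occ
  pₙ_mem : pₙ ∈ τₙ.occs
  pot₁ : Pot o₁ p₂
  potₙ : Pot oₙ p₁
  c₂ : Label
  c₂_eq : o₂.op.loc = p₂.op.loc → c₂ = .O
  c₂_ne : o₂.op.loc ≠ p₂.op.loc → c₂ ≠ .O
  cₙ : Label
  cₙ_eq : oₙ.op.loc = pₙ.op.loc → cₙ = .P
  cₙ_ne : oₙ.op.loc ≠ pₙ.op.loc → cₙ ≠ .P
  reachable : Reachable Q τ₁ o₁ p₁ h o₂ p₂ c₂ oₙ pₙ cₙ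
  valid : ValidSchedule τ₁ o₁ p₁ τ₂ o₂ p₂ c₂ τₙ oₙ pₙ cₙ h

theorem val_witness {τ₁ : InTemplate} {o₁ p₁ : Occ} {h : Bool} {TC : List (Node × Node)}
    {τ₂ : InTemplate} {o₂ p₂ : Occ} {τₙ : InTemplate} {oₙ pₙ : Occ} :
    (witness τ₁ o₁ p₁ h TC τ₂ o₂ p₂ τₙ oₙ pₙ).val = true ↔
      (Pot o₁ p₂ ∧ Pot oₙ p₁) ∧
      ∃ c₂, ((o₂.op.loc = p₂.op.loc → c₂ = .O) ∧ (o₂.op.loc ≠ p₂.op.loc → c₂ ≠ .O)) ∧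
        ∃ cₙ, ((oₙ.op.loc = pₙ.op.loc → cₙ = .P) ∧ (oₙ.op.loc ≠ pₙ.op.loc → cₙ ≠ .P)) ∧
        (Algo.reachable o₂ p₂ c₂ oₙ pₙ cₙ h TC).val = true ∧
        ValidSchedule τ₁ o₁ p₁ τ₂ o₂ p₂ c₂ τₙ oₙ pₙ cₙ h := by
  have h2 : ∀ c : Label, c ∈ (if (sameVar o₂ p₂).val = true then [Label.O] else [Label.N, Label.P]) ↔
      (o₂.op.loc = p₂.op.loc → c = .O) ∧ (o₂.op.loc ≠ p₂.op.loc → c ≠ .O) := by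
    intro c
    by_cases hv : o₂.op.loc = p₂.op.loc
    · rw [if_pos ((val_sameVar _ _).2 hv)]
      simp [hv]
    · rw [if_neg (by rwa [val_sameVar])]
      cases c <;> simp [hv]
  have hn : ∀ c : Label, c ∈ (if (sameVar oₙ pₙ).val = true then [Label.P] else [Label.N, Label.O]) ↔
      (oₙ.op.loc = pₙ.op.loc → c = .P) ∧ (oₙ.op.loc ≠ pₙ.op.loc → c ≠ .P) := by
    intro c
    by_cases hv : oₙ.op.loc = pₙ.op.loc
    · rw [if_pos ((val_sameVar _ _).2 hv)]
      simp [hv]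
    · rw [if_neg (by rwa [val_sameVar])]
      cases c <;> simp [hv]
  simp only [witness, val_bind, val_ite, val_pure, ite_false_eq_true, val_any, h2, hn]
  simp only [val_or, val_and, val_not, Bool.or_eq_true, Bool.and_eq_true, Bool.not_eq_true',
    ← Bool.not_eq_true, val_pot, val_validSchedule, not_or, not_not]

/-- The fields of `Counterexample` are the choices made by the nested loops. Only reachability needs
an argument: listed pairs are walks, and an occurrence is determined by its numbers. -/
theorem val_decideRobust (P : List Template) (A : Template → Level) :
    (decideRobust (P.map fun τ => (τ, A τ))).val = true ↔
      ¬ Nonempty (Counterexample (numberTemplates 0 (P.map fun τ => (τ, A τ))).val) := by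
  have hQ := isInput_numberTemplates P A
  set Q := (numberTemplates 0 (P.map fun τ => (τ, A τ))).val
  have hh : ∀ o₁ p₁ : Occ, ∀ h, h ∈ (if (sameVar o₁ p₁).val = true then [true] else [true, false]) ↔
      (o₁.op.loc = p₁.op.loc → h = true) := by
    intro o₁ p₁ h
    by_cases hv : o₁.op.loc = p₁.op.loc
    · rw [if_pos ((val_sameVar _ _).2 hv)]
      simp [hv]
    · rw [if_neg (by rwa [val_sameVar])]
      cases h <;> simp [hv]
  have hreach : ∀ τ₁ o₁ p₁ h o₂ p₂ c₂ oₙ pₙ cₙ, ∀ τ₂ ∈ Q, o₂ ∈ τ₂.occs → p₂ ∈ τ₂.occs →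
      ∀ τₙ ∈ Q, oₙ ∈ τₙ.occs → pₙ ∈ τₙ.occs →
      ((Algo.reachable o₂ p₂ c₂ oₙ pₙ cₙ h (transClosure (nodes o₁ p₁ τ₁ h Q).val
        (edges h (nodes o₁ p₁ τ₁ h Q).val).val).val).val = true ↔
        Reachable Q τ₁ o₁ p₁ h o₂ p₂ c₂ oₙ pₙ cₙ) := by
    intro τ₁ o₁ p₁ h o₂ p₂ c₂ oₙ pₙ cₙ τ₂ hτ₂ ho₂ hp₂ τₙ hτₙ hoₙ hpₙ
    have hV : IsInput.NodesOver Q (nodes o₁ p₁ τ₁ h Q).val := fun x hx => by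
      obtain ⟨τ, hτ, ho, -⟩ := mem_nodes.1 hx
      exact ⟨τ, hτ, ho⟩
    rw [val_reachable, Reachable]
    refine or_congr (and_congr_left fun _ => ?_) (or_congr Iff.rfl ?_)
    · constructor
      · rintro ⟨⟨h1, h2⟩, h3, h4⟩
        exact ⟨hQ.occ_eq hτ₂ hτₙ ho₂ hoₙ h1 h2, hQ.occ_eq hτ₂ hτₙ hp₂ hpₙ h3 h4⟩
      · rintro ⟨rfl, rfl⟩
        simp
    · rw [Prod.exists]
      refine exists_congr fun x => exists_congr fun y => ?_
      rw [hQ.mem_transClosure hV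
        (fun e he => ⟨(mem_edges.1 (show (e.1, e.2) ∈ _ from he)).1,
          (mem_edges.1 (show (e.1, e.2) ∈ _ from he)).2.1⟩)]
      simp only [mem_edges, and_assoc]
      rfl
  simp only [decideRobust, val_bind, val_pure, Bool.not_eq_true', ← Bool.not_eq_true]
  refine not_congr ?_
  simp only [val_any, val_bind, hh, val_witness]
  constructor
  · rintro ⟨τ₁, hτ₁, o₁, ho₁, p₁, hp₁, h, hh, τ₂, hτ₂, o₂, ho₂, p₂, hp₂, τₙ, hτₙ, oₙ, hoₙ, pₙ, hpₙ,
      ⟨hpot₁, hpotₙ⟩, c₂, ⟨hc₂, hc₂'⟩, cₙ, ⟨hcₙ, hcₙ'⟩, hr, hv⟩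
    exact ⟨⟨τ₁, hτ₁, o₁, ho₁, p₁, hp₁, h, hh, τ₂, hτ₂, o₂, ho₂, p₂, hp₂, τₙ, hτₙ, oₙ, hoₙ, pₙ, hpₙ,
      hpot₁, hpotₙ, c₂, hc₂, hc₂', cₙ, hcₙ, hcₙ',
      (hreach _ _ _ _ _ _ _ _ _ _ τ₂ hτ₂ ho₂ hp₂ τₙ hτₙ hoₙ hpₙ).1 hr, hv⟩⟩
  · rintro ⟨τ₁, hτ₁, o₁, ho₁, p₁, hp₁, h, hh, τ₂, hτ₂, o₂, ho₂, p₂, hp₂, τₙ, hτₙ, oₙ, hoₙ, pₙ, hpₙ,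
      hpot₁, hpotₙ, c₂, hc₂, hc₂', cₙ, hcₙ, hcₙ', hr, hv⟩
    exact ⟨τ₁, hτ₁, o₁, ho₁, p₁, hp₁, h, hh, τ₂, hτ₂, o₂, ho₂, p₂, hp₂, τₙ, hτₙ, oₙ, hoₙ, pₙ, hpₙ,
      ⟨hpot₁, hpotₙ⟩, c₂, ⟨hc₂, hc₂'⟩, cₙ, ⟨hcₙ, hcₙ'⟩,
      (hreach _ _ _ _ _ _ _ _ _ _ τ₂ hτ₂ ho₂ hp₂ τₙ hτₙ hoₙ hpₙ).2 hr, hv⟩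

end Algo

namespace Op

variable {α β : Type} (f : α → β) (o : Op α)

@[simp] theorem loc_map : (o.map f).loc = f o.loc := by cases o <;> rfl
@[simp] theorem readSet_map : (o.map f).readSet = o.readSet := by cases o <;> rfl
@[simp] theorem writeSet_map : (o.map f).writeSet = o.writeSet := by cases o <;> rfl

end Op

namespace Algo

/-! ### Transactions that are instances of the input templates -/

/-- Transaction `i` is the instance of `τs i` under the variable assignment `μ i`. -/
def Realizes {m : ℕ} (T : Fin m → Transaction) (τs : Fin m → InTemplate)
    (μ : Fin m → Var → Tuple) : Prop :=
  ∀ i, ∃ t, Describes (τs i) t ∧ T i = t.map (Op.map (μ i))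

section Realizes

variable {m : ℕ} {T : Fin m → Transaction} {τs : Fin m → InTemplate}
  {μ : Fin m → Var → Tuple}

/-- The operation `x` is an instance of the occurrence `o`. -/
structure InstanceOf (τs : Fin m → InTemplate) (μ : Fin m → Var → Tuple) (x : OpRef T)
    (o : Occ) : Prop where
  mem : o ∈ (τs x.1).occs
  pos : o.pos = x.2
  tuple : OpRef.tuple x = μ x.1 o.op.loc
  readSet : (OpRef.get x).readSet = o.op.readSet
  writeSet : (OpRef.get x).writeSet = o.op.writeSet

theorem instanceOf_of_get {x : OpRef T} {o : Occ} (h1 : o ∈ (τs x.1).occs) (h2 : o.pos = x.2)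
    (h3 : OpRef.get x = o.op.map (μ x.1)) : InstanceOf τs μ x o :=
  ⟨h1, h2, by simp [OpRef.tuple, h3], by simp [h3], by simp [h3]⟩

theorem Realizes.exists_occ (hT : Realizes T τs μ) (x : OpRef T) :
    ∃ o, InstanceOf τs μ x o := by
  obtain ⟨t, hd, ht⟩ := hT x.1
  have hx : (T x.1)[(x.2 : ℕ)]? = some (OpRef.get x) := List.getElem?_eq_getElem x.2.2
  have hx' := congrArg (fun l : Transaction => l[(x.2 : ℕ)]?) ht
  rw [hx, List.getElem?_map, eq_comm, Option.map_eq_some_iff] at hx'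
  obtain ⟨op, h1, h2⟩ := hx'
  exact ⟨⟨(τs x.1).tid, x.2, op⟩, instanceOf_of_get ((hd _).2 ⟨rfl, h1⟩) rfl h2.symm⟩

theorem Realizes.exists_ref (hT : Realizes T τs μ) {i : Fin m} {o : Occ}
    (ho : o ∈ (τs i).occs) : ∃ x : OpRef T, x.1 = i ∧ InstanceOf τs μ x o := by
  obtain ⟨t, hd, ht⟩ := hT i
  have h := ((hd o).1 ho).2
  have hlt : o.pos < (T i).length := by
    rw [ht, List.length_map]
    exact (List.getElem?_eq_some_iff.1 h).1
  refine ⟨⟨i, ⟨o.pos, hlt⟩⟩, rfl, instanceOf_of_get ho rfl ?_⟩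
  have hx : (T i)[o.pos]? = some ((T i)[o.pos]) := List.getElem?_eq_getElem hlt
  have hy : (T i)[o.pos]? = some (o.op.map (μ i)) := by
    rw [ht, List.getElem?_map, h]
    rfl
  exact Option.some.inj (hx.symm.trans hy)

variable {x y : OpRef T} {o p : Occ}

theorem InstanceOf.ww_iff (hx : InstanceOf τs μ x o) (hy : InstanceOf τs μ y p) :
    (OpRef.get x).WW (OpRef.get y) ↔ o.op.WW p.op := by
  simp only [Op.WW, hx.writeSet, hy.writeSet]

theorem InstanceOf.wr_iff (hx : InstanceOf τs μ x o) (hy : InstanceOf τs μ y p) :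
    (OpRef.get x).WR (OpRef.get y) ↔ o.op.WR p.op := by
  simp only [Op.WR, hx.writeSet, hy.readSet]

theorem InstanceOf.rw_iff (hx : InstanceOf τs μ x o) (hy : InstanceOf τs μ y p) :
    (OpRef.get x).RW (OpRef.get y) ↔ o.op.RW p.op := by
  simp only [Op.RW, hx.readSet, hy.writeSet]

theorem InstanceOf.conflicting_iff (hx : InstanceOf τs μ x o) (hy : InstanceOf τs μ y p) :
    Conflicting x y ↔
      x.1 ≠ y.1 ∧ μ x.1 o.op.loc = μ y.1 p.op.loc ∧ o.op.Clash p.op := by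
  rw [Conflicting, Meet, hx.ww_iff hy, hx.wr_iff hy, hx.rw_iff hy, hx.tuple, hy.tuple, and_assoc]
  rfl

end Realizes

/-! ### Counterexamples are correct -/

/-- The assignment that maps the variable `X` to the tuple with the number `f X`. -/
def assign (f : Var → ℕ) (X : Var) : Tuple := ⟨X.rel, f X⟩

theorem assign_eq_iff {f g : Var → ℕ} {X Y : Var} :
    assign f X = assign g Y ↔ X.rel = Y.rel ∧ f X = g Y := by
  simp [assign]

/-- A transaction after the first one in a cycle: a template, its operations that conflict with the
previous and with the next transaction, and the numbers of their tuples. -/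
structure Step where
  τ : InTemplate
  inn : Occ
  out : Occ
  a : ℕ
  b : ℕ

namespace Step

open Classical in
/-- The numbers of the tuples of the variables. -/
noncomputable def num (st : Step) (X : Var) : ℕ :=
  if X = st.inn.op.loc then st.a else if X = st.out.op.loc then st.b else 2

/-- The equation between `a` and `b` covers a single variable carrying both operations; the bound
`4` fixes the database in advance. -/
structure Good (Q : List InTemplate) (st : Step) : Prop where
  mem : st.τ ∈ Q
  inn_mem : st.inn ∈ st.τ.occs
  out_mem : st.out ∈ st.τ.occs
  eq : st.inn.op.loc = st.out.op.loc → st.a = st.b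
  a_lt : st.a < 4
  b_lt : st.b < 4

theorem num_inn (st : Step) : st.num st.inn.op.loc = st.a := if_pos rfl

theorem Good.num_out {Q : List InTemplate} {st : Step} (h : st.Good Q) :
    st.num st.out.op.loc = st.b := by
  unfold num
  split_ifs with h1 h2
  · exact h.eq h1.symm
  · rfl
  · exact absurd rfl h2

theorem Good.num_lt {Q : List InTemplate} {st : Step} (h : st.Good Q) (X : Var) :
    st.num X < 4 := by
  unfold num
  split_ifs
  · exact h.a_lt
  · exact h.b_lt
  · omega

/-- The outgoing operation of `st` conflicts with the incoming operation of `st'`. -/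
def Link (st st' : Step) : Prop := Pot st.out st'.inn ∧ st.b = st'.a

end Step

/-- Transaction `0` instantiates `τ₁` and the steps follow it in order, over a database with four
tuples per relation. Conflicts among the later transactions are unrestricted, since only those with
transaction `0` endanger the split schedule; hence tuple numbers may be reused freely. -/
theorem not_robust_of_steps {Q : List InTemplate} {P : List Template} {A : Template → Level}
    (hQ : IsInput Q P A) {τ₁ : InTemplate} (hτ₁ : τ₁ ∈ Q) {o₁ p₁ : Occ} (ho₁ : o₁ ∈ τ₁.occs)
    (hp₁ : p₁ ∈ τ₁.occs) {f : Var → ℕ} (hf : ∀ X, f X < 4) {L : List Step} {n : ℕ}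
    (hn : L.length = n + 1) (hgood : ∀ st ∈ L, st.Good Q) (hchain : L.IsChain Step.Link)
    {s₂ sₙ : Step} (hs₂ : L[0]? = some s₂) (hsₙ : L[n]? = some sₙ)
    (hfirst : (o₁.op.loc.rel = s₂.inn.op.loc.rel ∧ o₁.op.RW s₂.inn.op) ∧ f o₁.op.loc = s₂.a)
    (hlast : Pot sₙ.out p₁ ∧ sₙ.b = f p₁.op.loc ∧
      (sₙ.out.op.RW p₁.op ∨ τ₁.level = .RC ∧ o₁.pos < p₁.pos))
    (hmid : ∀ i st, L[i]? = some st → i ≠ 0 → i ≠ n → ∀ x ∈ τ₁.occs, ∀ y ∈ st.τ.occs,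
      Pot x y → f x.op.loc ≠ st.num y.op.loc)
    (hww : ∀ st, st = s₂ ∨ st = sₙ → ∀ x ∈ τ₁.occs, ∀ y ∈ st.τ.occs,
      x.op.loc.rel = y.op.loc.rel → x.op.WW y.op → f x.op.loc = st.num y.op.loc →
        τ₁.level = .RC ∧ o₁.pos < x.pos)
    (hssi : ¬ (τ₁.level = .SSI ∧ s₂.τ.level = .SSI ∧ sₙ.τ.level = .SSI))
    (hwr : τ₁.level = .SSI → s₂.τ.level = .SSI → ∀ x ∈ τ₁.occs, ∀ y ∈ s₂.τ.occs,
      x.op.loc.rel = y.op.loc.rel → x.op.WR y.op → f x.op.loc ≠ s₂.num y.op.loc)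
    (hrw : τ₁.level = .SSI → sₙ.τ.level = .SSI → ∀ x ∈ τ₁.occs, ∀ y ∈ sₙ.τ.occs,
      x.op.loc.rel = y.op.loc.rel → x.op.RW y.op → f x.op.loc ≠ sₙ.num y.op.loc) :
    ¬ Robust {τ | τ ∈ P} A := by
  intro hrob
  choose! g hgP hgA hgD using hQ.exists_template
  let st : Fin (n + 1) → Step := fun i => L[(i : ℕ)]
  have hst : ∀ i, st i ∈ L := fun i => List.getElem_mem _
  have hst? : ∀ i : Fin (n + 1), L[(i : ℕ)]? = some (st i) :=
    fun i => List.getElem?_eq_getElem _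
  have hst0 : st 0 = s₂ := Option.some.inj ((hst? 0).symm.trans hs₂)
  have hstn : st (Fin.last n) = sₙ := Option.some.inj ((hst? (Fin.last n)).symm.trans hsₙ)
  let τs : Fin (n + 2) → InTemplate := Fin.cons τ₁ fun i => (st i).τ
  let fs : Fin (n + 2) → Var → ℕ := Fin.cons f fun i => (st i).num
  let μ : Fin (n + 2) → Var → Tuple := fun i => assign (fs i)
  let T : Fin (n + 2) → Transaction := fun i => (g (τs i)).map (Op.map (μ i))
  have hτs : ∀ i, τs i ∈ Q := Fin.cases hτ₁ fun i => (hgood _ (hst i)).mem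
  have hfs : ∀ i X, fs i X < 4 := Fin.cases hf fun i => (hgood _ (hst i)).num_lt
  have hT : Realizes T τs μ := fun i => ⟨g (τs i), hgD _ (hτs i), rfl⟩
  have hRob : TransactionRobust T fun i => (τs i).level := by
    refine hrob (fun _ => Finset.range 4) (n + 2) T _ fun i => ⟨g (τs i), hgP _ (hτs i),
      ⟨μ i, fun _ => rfl, fun o _ => ?_, rfl⟩, hgA _ (hτs i)⟩
    exact Finset.mem_range.2 (hfs i _)
  have hlast_eq : Fin.last (n + 1) = (Fin.last n).succ := rfl
  have hone : (1 : Fin (n + 2)) = Fin.succ 0 := rfl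
  -- operations of the first and of another transaction
  have hocc : ∀ x y : OpRef T, x.1 = 0 → y.1 ≠ 0 → ∃ i : Fin (n + 1), y.1 = i.succ ∧
      ∃ o p, InstanceOf τs μ x o ∧ InstanceOf τs μ y p ∧ o ∈ τ₁.occs ∧ p ∈ (st i).τ.occs ∧
        (Meet x y → o.op.loc.rel = p.op.loc.rel ∧ f o.op.loc = (st i).num p.op.loc) := by
    intro x y hx hy
    obtain ⟨i, hi⟩ := Fin.exists_succ_eq.2 hy
    obtain ⟨o, ho⟩ := hT.exists_occ x
    obtain ⟨p, hp⟩ := hT.exists_occ y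
    refine ⟨i, hi.symm, o, p, ho, hp, ?_, ?_, fun hm => ?_⟩
    · have := ho.mem
      rwa [hx] at this
    · have := hp.mem
      rwa [← hi] at this
    · have := hm.2
      rw [ho.tuple, hp.tuple, hx, ← hi] at this
      exact assign_eq_iff.1 this
  obtain ⟨x₁, hx₁, hx₁o⟩ := hT.exists_ref (i := 0) ho₁
  refine not_transactionRobust_of_split (A := fun i => (τs i).level) x₁ hx₁ ?_ ?_ ?_ ?_ ?_ ?_ ?_ ?_
    hRob
  · have hmem : s₂.inn ∈ (τs 1).occs := by
      rw [← hst0]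
      exact (hgood _ (hst 0)).inn_mem
    obtain ⟨y, hy, hyo⟩ := hT.exists_ref hmem
    refine ⟨y, hy, ⟨by rw [hx₁, hy]; simp, ?_⟩, (hx₁o.rw_iff hyo).2 hfirst.1.2⟩
    rw [hx₁o.tuple, hyo.tuple, hx₁, hy]
    refine assign_eq_iff.2 ⟨hfirst.1.1, hfirst.2.trans ?_⟩
    change _ = (st 0).num s₂.inn.op.loc
    rw [hst0, s₂.num_inn]
  · intro i j hi hj
    obtain ⟨i, rfl⟩ := Fin.exists_succ_eq.2 hi
    obtain ⟨j, rfl⟩ := Fin.exists_succ_eq.2 (show j ≠ 0 by rintro rfl; simp at hj)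
    have hj : (j : ℕ) = i + 1 := by simpa using hj
    have hlink : Step.Link (st i) (st j) := by
      have := List.isChain_iff_getElem.1 hchain i (by have := j.2; omega)
      simpa only [st, hj] using this
    obtain ⟨x, hx, hxo⟩ := hT.exists_ref (i := i.succ) (hgood _ (hst i)).out_mem
    obtain ⟨y, hy, hyo⟩ := hT.exists_ref (i := j.succ) (hgood _ (hst j)).inn_mem
    refine ⟨x, y, hx, hy, (hxo.conflicting_iff hyo).2 ⟨?_, ?_, hlink.1.2⟩⟩
    · rw [hx, hy, Ne, Fin.succ_inj, Fin.ext_iff]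
      omega
    · rw [hx, hy]
      refine assign_eq_iff.2 ⟨hlink.1.1, ?_⟩
      change (st i).num _ = (st j).num _
      rw [(hgood _ (hst i)).num_out, (st j).num_inn, hlink.2]
  · have hg := hgood _ (hst (Fin.last n))
    obtain ⟨x, hx, hxo⟩ := hT.exists_ref (i := (Fin.last n).succ) hg.out_mem
    obtain ⟨y, hy, hyo⟩ := hT.exists_ref (i := 0) hp₁
    rw [hstn] at hg hxo
    refine ⟨x, y, hx, hy, (hxo.conflicting_iff hyo).2 ⟨?_, ?_, hlast.1.2⟩, ?_⟩
    · rw [hx, hy]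
      exact Fin.succ_ne_zero _
    · rw [hx, hy]
      refine assign_eq_iff.2 ⟨hlast.1.1, ?_⟩
      change (st (Fin.last n)).num _ = f _
      rw [hstn, hg.num_out, hlast.2.1]
    · rw [hxo.rw_iff hyo, ← hx₁o.pos, ← hyo.pos]
      exact hlast.2.2
  · intro x y hx hy hy1 hyn hc
    obtain ⟨i, hi, o, p, ho, hp, hoτ, hpτ, hm⟩ := hocc x y hx hy
    have hm := hm hc.1
    refine hmid i (st i) (hst? i) ?_ ?_ o hoτ p hpτ ⟨hm.1, ?_⟩ hm.2
    · rintro h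
      exact hy1 (by rw [hi, hone]; congr; exact Fin.ext h)
    · rintro h
      exact hyn (by rw [hi, hlast_eq]; congr; exact Fin.ext h)
    · exact ((ho.conflicting_iff hp).1 hc).2.2
  · intro x y hx hy hm hc
    obtain ⟨i, hi, o, p, ho, hp, hoτ, hpτ, hm'⟩ := hocc x y hx hy
    have hm' := hm' hm
    have hc' := (ho.ww_iff hp).1 hc
    rw [← hx₁o.pos, ← ho.pos]
    change τ₁.level = _ ∧ _
    by_cases h0 : (i : ℕ) = 0
    · exact hww (st i) (.inl ((congrArg st (Fin.ext h0)).trans hst0)) o hoτ p hpτ hm'.1 hc' hm'.2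
    · by_cases hin : (i : ℕ) = n
      · exact hww (st i) (.inr ((congrArg st (Fin.ext hin)).trans hstn)) o hoτ p hpτ hm'.1 hc'
          hm'.2
      · exact absurd hm'.2 (hmid i (st i) (hst? i) h0 hin o hoτ p hpτ ⟨hm'.1, .inl hc'⟩)
  · rw [← hst0, ← hstn] at hssi
    exact hssi
  · intro h0 h1 x y hx hy hm hc
    obtain ⟨i, hi, o, p, ho, hp, hoτ, hpτ, hm'⟩ := hocc x y hx (by rw [hy]; simp)
    have hm' := hm' hm
    obtain rfl : i = 0 := Fin.succ_injective _ (hi.symm.trans hy)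
    change (st 0).τ.level = _ at h1
    rw [hst0] at h1 hpτ hm'
    exact hwr h0 h1 o hoτ p hpτ hm'.1 ((ho.wr_iff hp).1 hc) hm'.2
  · intro h0 h1 x y hx hy hm hc
    obtain ⟨i, hi, o, p, ho, hp, hoτ, hpτ, hm'⟩ :=
      hocc x y hx (by rw [hy]; exact Fin.last_pos.ne')
    have hm' := hm' hm
    obtain rfl : i = Fin.last n := Fin.succ_injective _ (hi.symm.trans hy)
    change (st (Fin.last n)).τ.level = _ at h1
    rw [hstn] at h1 hpτ hm'
    exact hrw h0 h1 o hoτ p hpτ hm'.1 ((ho.rw_iff hp).1 hc) hm'.2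

/-! ### Tuple numbers realizing the labels -/

/-- The number of the tuple that a label stands for. -/
def labelNum (h : Bool) : Label → ℕ
  | .O => 0
  | .P => if h then 0 else 1
  | .N => 2

theorem labelNum_lt (h : Bool) (c : Label) : labelNum h c < 4 := by
  cases c <;> cases h <;> simp [labelNum]

open Classical in
/-- The numbers of the tuples of the variables of the first transaction. -/
noncomputable def firstNum (o₁ p₁ : Occ) (h : Bool) (X : Var) : ℕ :=
  if X = o₁.op.loc then 0 else if X = p₁.op.loc then labelNum h .P else 3

theorem firstNum_lt (o₁ p₁ : Occ) (h : Bool) (X : Var) : firstNum o₁ p₁ h X < 4 := by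
  unfold firstNum
  split_ifs
  · omega
  · exact labelNum_lt _ _
  · omega

/-- Other variables of `τ₁` have number `3`, which no label uses, and `N` stands for `2`, which no
variable of `τ₁` has. So a common tuple comes from the variable of `o₁` or of `p₁`. -/
theorem firstNum_eq {o₁ p₁ : Occ} {h : Bool} {X : Var} {c : Label}
    (heq : firstNum o₁ p₁ h X = labelNum h c) :
    X = o₁.op.loc ∧ (c = .O ∨ h = true ∧ c = .P) ∨ X = p₁.op.loc ∧ (c = .P ∨ h = true ∧ c = .O) := by
  revert heq
  unfold firstNum
  split_ifs with h1 h2 <;> cases c <;> cases h <;> simp [labelNum, *]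

/-- Tuples are shared with the first transaction only through connected variables, so
`ValidSchedule` controls all its conflicts with its two neighbours. -/
theorem connected_of_eq {o₁ p₁ : Occ} {h : Bool} {q : Occ} {d : Label} {q' : Occ} {d' : Label}
    {X Y : Var} {k : ℕ} (heq : firstNum o₁ p₁ h X = k)
    (hk : Y = q.op.loc ∧ k = labelNum h d ∨ Y = q'.op.loc ∧ k = labelNum h d' ∨ k = 2) :
    Connected o₁ p₁ h q d q' d' X Y := by
  subst heq
  unfold Connected
  rcases hk with ⟨hY, hk⟩ | ⟨hY, hk⟩ | hk
  · rcases firstNum_eq hk with ⟨hX, hc | ⟨hh, hc⟩⟩ | ⟨hX, hc | ⟨hh, hc⟩⟩ <;> simp [*]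
  · rcases firstNum_eq hk with ⟨hX, hc | ⟨hh, hc⟩⟩ | ⟨hX, hc | ⟨hh, hc⟩⟩ <;> simp [*]
  · have := firstNum_eq (c := .N) hk
    simp at this

/-- A shared number would be that of `o₁` or `p₁`, and then the conflict of `x` and `y` would have
excluded the node `v`. -/
theorem firstNum_ne_labelNum {Q : List InTemplate} {P : List Template} {A : Template → Level}
    (hQ : IsInput Q P A) {τ₁ : InTemplate} {o₁ p₁ : Occ} {h : Bool} {v : Node}
    (hv : v ∈ (nodes o₁ p₁ τ₁ h Q).val) {τ : InTemplate} (hτ : τ ∈ Q) (hvτ : v.occ ∈ τ.occs)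
    {x : Occ} (hx : x ∈ τ₁.occs) {y : Occ} (hy : y ∈ τ.occs) (hpot : Pot x y)
    (hyv : y.op.loc = v.occ.op.loc) : firstNum o₁ p₁ h x.op.loc ≠ labelNum h v.label := by
  intro heq
  obtain ⟨τ', hτ', hv', h1, h2⟩ := mem_nodes.1 hv
  obtain rfl := hQ.eq_of_mem hτ hτ' hvτ hv' rfl
  rcases firstNum_eq heq with ⟨hX, hc⟩ | ⟨hX, hc⟩
  · exact h1 hc ⟨x, hx, hX, y, hy, hyv, hpot⟩
  · exact h2 hc ⟨x, hx, hX, y, hy, hyv, hpot⟩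

/-- A step that does not interfere with the first transaction. -/
def IsMiddle (Q : List InTemplate) (τ₁ : InTemplate) (f : Var → ℕ) (st : Step) : Prop :=
  st.Good Q ∧ ∀ x ∈ τ₁.occs, ∀ y ∈ st.τ.occs, Pot x y → f x.op.loc ≠ st.num y.op.loc

/-- An edge inside a template is one transaction. If both operations have the same variable, the
labels agree or are `O` and `P` with `h` true, so the numbers agree. The two nodes guard these
tuples against `τ₁`, and every other variable gets the harmless number `2`. -/
theorem exists_middle {Q : List InTemplate} {P : List Template} {A : Template → Level}
    (hQ : IsInput Q P A) {τ₁ : InTemplate} {o₁ p₁ : Occ} {h : Bool} {x y : Node}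
    (he : GraphEdge Q τ₁ o₁ p₁ h x y) (hx : x.dir = .inc) :
    ∃ st, IsMiddle Q τ₁ (firstNum o₁ p₁ h) st ∧ st.inn = x.occ ∧ st.out = y.occ ∧
      st.a = labelNum h x.label ∧ st.b = labelNum h y.label := by
  obtain ⟨hxV, hyV, he⟩ := he
  obtain ⟨τ, hτ, hxτ, -⟩ := mem_nodes.1 hxV
  obtain ⟨τ', hτ', hyτ, -⟩ := mem_nodes.1 hyV
  rcases he with he | ⟨-, -, htid, he⟩
  · rw [hx] at he
    cases he.1
  obtain rfl := hQ.eq_of_mem hτ hτ' hxτ hyτ htid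
  refine ⟨⟨τ, x.occ, y.occ, labelNum h x.label, labelNum h y.label⟩,
    ⟨⟨hτ, hxτ, hyτ, ?_, labelNum_lt _ _, labelNum_lt _ _⟩, ?_⟩, rfl, rfl, rfl, rfl⟩
  · intro hv
    rcases he with ⟨-, hl | ⟨hl, hl', hh⟩⟩ | ⟨hn, -⟩
    · exact congrArg (labelNum h) hl
    · simp only [hl, hl', hh, labelNum, if_true]
    · exact absurd hv hn
  · intro z hz w hw hpot
    simp only [Step.num]
    split_ifs with h1 h2
    · exact firstNum_ne_labelNum hQ hxV hτ hxτ hz hw hpot h1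
    · exact firstNum_ne_labelNum hQ hyV hτ hyτ hz hw hpot h2
    · intro heq
      have := firstNum_eq (c := .N) heq
      simp at this

/-- Edges inside templates give steps and conflict edges give links. As the induction prepends
edges, paths starting at either kind of node occur: before an `inc` node the preceding step
conflicts with its operation, before an `out` node it already ends in it. -/
theorem exists_steps {Q : List InTemplate} {P : List Template} {A : Template → Level}
    (hQ : IsInput Q P A) {τ₁ : InTemplate} {o₁ p₁ : Occ} {h : Bool} {x y : Node}
    (hxy : Relation.TransGen (GraphEdge Q τ₁ o₁ p₁ h) x y) (hy : y.dir = .out) :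
    ∃ L : List Step, (∀ st ∈ L, IsMiddle Q τ₁ (firstNum o₁ p₁ h) st) ∧ ∀ s₂ sₙ : Step,
      (if x.dir = .inc then Pot s₂.out x.occ else s₂.out = x.occ) → s₂.b = labelNum h x.label →
      Pot y.occ sₙ.inn → labelNum h y.label = sₙ.a →
      (s₂ :: (L ++ [sₙ])).IsChain Step.Link := by
  induction hxy using Relation.TransGen.head_induction_on with
  | @single x he =>
    have hx : x.dir = .inc := by
      rcases he.2.2 with he | he
      · rw [hy] at he
        cases he.2.1
      · exact he.1
    obtain ⟨st, hst, h1, h2, h3, h4⟩ := exists_middle hQ he hx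
    refine ⟨[st], by simpa using hst, fun s₂ sₙ hs hs' ht ht' => ?_⟩
    rw [if_pos hx] at hs
    simp [Step.Link, h1, h2, h3, h4, hs, hs', ht, ht']
  | @head x z he _ ih =>
    obtain ⟨L, hL, ih⟩ := ih
    rcases hx : x.dir with _ | _
    · have hz : z.dir = .out := by
        rcases he.2.2 with he | he
        · rw [hx] at he
          cases he.1
        · exact he.2.1
      obtain ⟨st, hst, h1, h2, h3, h4⟩ := exists_middle hQ he hx
      refine ⟨st :: L, ?_, fun s₂ sₙ hs hs' ht ht' => ?_⟩
      · simpa using ⟨hst, hL⟩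
      · rw [if_pos rfl] at hs
        refine List.isChain_cons_cons.2 ⟨⟨h1 ▸ hs, h3 ▸ hs'⟩, ih st sₙ ?_ h4 ht ht'⟩
        rw [hz, if_neg (by simp)]
        exact h2
    · rcases he.2.2 with he | he
      · refine ⟨L, hL, fun s₂ sₙ hs hs' ht ht' => ih s₂ sₙ ?_ (he.2.2.1 ▸ hs') ht ht'⟩
        rw [if_neg (by simp)] at hs
        rw [if_pos he.2.1, hs]
        exact he.2.2.2
      · rw [hx] at he
        cases he.1

/-- The three ways of being reachable give cycles with one, two or more transactions besides the
first; `main` treats them uniformly as lists of steps. -/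
theorem Counterexample.not_robust {Q : List InTemplate} {P : List Template}
    {A : Template → Level} (hQ : IsInput Q P A) (C : Counterexample Q) :
    ¬ Robust {τ | τ ∈ P} A := by
  obtain ⟨τ₁, hτ₁, o₁, ho₁, p₁, hp₁, h, hh, τ₂, hτ₂, o₂, ho₂, p₂, hp₂, τₙ, hτₙ, oₙ, hoₙ, pₙ, hpₙ,
      hpot₁, hpotₙ, c₂, hc₂, hc₂', cₙ, hcₙ, hcₙ', hr, hv⟩ := C
  have hfo : firstNum o₁ p₁ h o₁.op.loc = 0 := if_pos rfl
  have hfp : firstNum o₁ p₁ h p₁.op.loc = labelNum h .P := by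
    unfold firstNum
    split_ifs with he he'
    · simp [labelNum, hh he.symm]
    · rfl
    · exact absurd rfl he'
  -- the general conclusion for a list of steps
  have main : ∀ (s₂ sₙ : Step) (L : List Step) (n : ℕ), s₂.τ = τ₂ → sₙ.τ = τₙ → s₂.inn = p₂ →
      s₂.a = 0 → sₙ.out = oₙ → sₙ.b = labelNum h .P →
      (∀ Y, Y = p₂.op.loc ∧ s₂.num Y = labelNum h .O ∨ Y = o₂.op.loc ∧ s₂.num Y = labelNum h c₂ ∨
        s₂.num Y = 2) →
      (∀ Y, Y = oₙ.op.loc ∧ sₙ.num Y = labelNum h .P ∨ Y = pₙ.op.loc ∧ sₙ.num Y = labelNum h cₙ ∨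
        sₙ.num Y = 2) → L.length = n + 1 → (∀ st ∈ L, st.Good Q) → L.IsChain Step.Link →
      L[0]? = some s₂ → L[n]? = some sₙ →
      (∀ i st, L[i]? = some st → i ≠ 0 → i ≠ n → IsMiddle Q τ₁ (firstNum o₁ p₁ h) st) →
      ¬ Robust {τ | τ ∈ P} A := by
    rintro s₂ sₙ L n rfl rfl hi ha ho hb h2 hn hlen hgood hchain hs₂ hsₙ hmid
    refine not_robust_of_steps hQ hτ₁ ho₁ hp₁ (firstNum_lt o₁ p₁ h) hlen hgood hchain hs₂ hsₙ
      ?_ ?_ (fun i st hst h0 h1 => (hmid i st hst h0 h1).2) ?_ hv.not_ssi ?_ ?_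
    · rw [hi, hfo, ha]
      exact ⟨hv.rw₂, rfl⟩
    · rw [ho, hb, hfp]
      exact ⟨hpotₙ, rfl, hv.rwₙ.imp (fun h => h.2) id⟩
    · rintro st (rfl | rfl) x hx y hy hr hw heq
      · exact hv.ww₂ x hx y hy hr hw (connected_of_eq heq (h2 _))
      · exact hv.wwₙ x hx y hy hr hw (connected_of_eq heq (hn _))
    · exact fun h1 h1' x hx y hy hr hw heq =>
        hv.wr₂ h1 h1' x hx y hy hr hw (connected_of_eq heq (h2 _))
    · exact fun h1 h1' x hx y hy hr hw heq =>
        hv.not_rwₙ h1 h1' x hx y hy hr hw (connected_of_eq heq (hn _))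
  -- the second and the last transaction of a cycle of at least three transactions
  let s₂ : Step := ⟨τ₂, p₂, o₂, 0, labelNum h c₂⟩
  let sₙ : Step := ⟨τₙ, pₙ, oₙ, labelNum h cₙ, labelNum h .P⟩
  have hs₂ : s₂.Good Q := ⟨hτ₂, hp₂, ho₂, fun e => by simp [s₂, hc₂ e.symm, labelNum],
    by simp [s₂], labelNum_lt _ _⟩
  have hsₙ : sₙ.Good Q := ⟨hτₙ, hpₙ, hoₙ, fun e => by simp [sₙ, hcₙ e.symm],
    labelNum_lt h cₙ, labelNum_lt h .P⟩
  have hnum₂ : ∀ Y, Y = p₂.op.loc ∧ s₂.num Y = labelNum h .O ∨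
      Y = o₂.op.loc ∧ s₂.num Y = labelNum h c₂ ∨ s₂.num Y = 2 := by
    intro Y
    simp only [Step.num]
    split_ifs with h1 h2
    · exact .inl ⟨h1, rfl⟩
    · exact .inr (.inl ⟨h2, rfl⟩)
    · exact .inr (.inr rfl)
  have hnumₙ : ∀ Y, Y = oₙ.op.loc ∧ sₙ.num Y = labelNum h .P ∨
      Y = pₙ.op.loc ∧ sₙ.num Y = labelNum h cₙ ∨ sₙ.num Y = 2 := by
    intro Y
    simp only [Step.num]
    split_ifs with h1 h2
    · exact .inr (.inl ⟨h1, rfl⟩)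
    · exact .inl ⟨h2, rfl⟩
    · exact .inr (.inr rfl)
  have hswitch : ∀ {c c' : Label}, c = c' ∨ Switch h c c' → labelNum h c = labelNum h c' := by
    rintro c c' (rfl | ⟨hh, rfl, rfl⟩)
    · rfl
    · simp [labelNum, hh]
  rcases hr with ⟨⟨rfl, rfl⟩, hr⟩ | ⟨hpot, hr⟩ | ⟨x, y, hxy, hx, hy, hx', hy', hpx, hpy⟩
  · obtain rfl := hQ.eq_of_mem hτ₂ hτₙ ho₂ hoₙ rfl
    -- The second and the last transaction coincide, entered at `p₂` and left at `o₂`. Each of `c₂`,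
    -- `cₙ` then repeats the label of the other end.
    let st : Step := ⟨τ₂, p₂, o₂, 0, labelNum h .P⟩
    have hP : p₂.op.loc = o₂.op.loc → labelNum h .P = 0 := by
      intro e
      rcases hr with ⟨hr, -⟩ | ⟨hr, -⟩
      · have := hc₂ e.symm
        rw [hr] at this
        cases this
      · simp [labelNum, hr]
    have hst : st.Good Q := ⟨hτ₂, hp₂, ho₂, fun e => (hP e).symm, by simp [st], labelNum_lt h .P⟩
    have hc : labelNum h c₂ = labelNum h .P ∧ labelNum h cₙ = 0 := by
      rcases hr with ⟨rfl, rfl⟩ | ⟨hr, rfl, rfl⟩ <;> simp [labelNum, *]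
    refine main st st [st] 0 rfl rfl rfl rfl rfl rfl ?_ ?_ rfl (by simpa using hst) (by simp) rfl
      rfl ?_
    · intro Y
      simp only [Step.num]
      split_ifs with h1 h2
      · exact .inl ⟨h1, rfl⟩
      · exact .inr (.inl ⟨h2, hc.1.symm⟩)
      · exact .inr (.inr rfl)
    · intro Y
      simp only [Step.num]
      split_ifs with h1 h2
      · exact .inr (.inl ⟨h1, hc.2.symm⟩)
      · exact .inl ⟨h2, rfl⟩
      · exact .inr (.inr rfl)
    · rintro (_ | i) s hs h0 -
      · exact absurd rfl h0
      · simp at hs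
  · refine main s₂ sₙ [s₂, sₙ] 1 rfl rfl rfl rfl rfl rfl hnum₂ hnumₙ rfl (by simp [hs₂, hsₙ]) ?_ rfl
      rfl ?_
    · simpa using ⟨hpot, hswitch hr⟩
    · rintro (_ | _ | i) s hs h0 h1
      · exact absurd rfl h0
      · exact absurd rfl h1
      · simp at hs
  · obtain ⟨L, hL, hchain⟩ := exists_steps hQ hxy hy
    refine main s₂ sₙ (s₂ :: (L ++ [sₙ])) (L.length + 1) rfl rfl rfl rfl rfl rfl hnum₂ hnumₙ
      (by simp) ?_ (hchain s₂ sₙ ?_ (hx' ▸ rfl) hpy (hy' ▸ rfl)) rfl (by simp) ?_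
    · intro st hst
      simp only [List.mem_cons, List.mem_append, List.not_mem_nil, or_false] at hst
      rcases hst with rfl | hst | rfl
      exacts [hs₂, (hL st hst).1, hsₙ]
    · rw [if_pos hx]
      exact hpx.symm
    · rintro (_ | i) st hst h0 h1
      · exact absurd rfl h0
      · rw [List.getElem?_cons_succ] at hst
        have hlt : i < L.length := by
          have := (List.getElem?_eq_some_iff.1 hst).1
          simp only [List.length_append, List.length_singleton] at this
          omega
        rw [List.getElem?_append_left hlt] at hst
        exact hL st (List.mem_of_getElem? hst)

end Algo

namespace Algo

/-! ### Labels of the links of a cycle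

Link `i` of a cycle of length `n` joins the transactions `i` and `i + 1`; `same i` means that the
transaction between the links `i` and `i + 1` has the same variable on both of them. -/

open Classical in
/-- The label of link `i`: `O` or `P` if its tuple is forced to be that of the first or of the last
link, and `N` otherwise. -/
noncomputable def linkLabel (n : ℕ) (same : ℕ → Prop) (i : ℕ) : Label :=
  if ∀ j < n - 1, same j then if i ≤ 1 then .O else .P
  else if ∀ j < i, same j then .O
  else if ∀ j < n - 1, i ≤ j → same j then .P
  else .N

section linkLabel

variable {n : ℕ} {same : ℕ → Prop}

theorem linkLabel_eq_O {i : ℕ} (h : linkLabel n same i = .O) (hi : i ≤ n - 1) :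
    ∀ j < i, same j := by
  unfold linkLabel at h
  split_ifs at h with h1 h2 h2
  · exact fun j hj => h1 j (by omega)
  · exact h2

theorem linkLabel_eq_P {i : ℕ} (h : linkLabel n same i = .P) :
    ∀ j < n - 1, i ≤ j → same j := by
  unfold linkLabel at h
  split_ifs at h with h1 h2 h2 h3
  · exact fun j hj _ => h1 j hj
  · exact h3

theorem linkLabel_one (h : same 0) : linkLabel n same 1 = .O := by
  unfold linkLabel
  rw [if_pos le_rfl, if_pos (show ∀ j < 1, same j from fun j hj => by
    obtain rfl : j = 0 := by omega
    exact h)]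
  simp

/-- If every variable is kept, the label turns into `P` only after link `1`, so link `n - 2` has it
only from `n = 4` on. -/
theorem linkLabel_last (hn : 4 ≤ n ∨ ¬ ∀ j < n - 1, same j) (hn' : 2 ≤ n) (h : same (n - 2)) :
    linkLabel n same (n - 2) = .P := by
  unfold linkLabel
  split_ifs with h1 h2 h2 h3
  · exact absurd (hn.resolve_right (not_not.2 h1)) (by omega)
  · rfl
  · refine absurd (fun j hj => ?_) h1
    by_cases he : j = n - 2
    · exact he ▸ h
    · exact h2 j (by omega)
  · rfl
  · refine absurd (fun j hj hj' => ?_) h3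
    obtain rfl : j = n - 2 := by omega
    exact h

/-- A kept variable passes on whether the tuple is forced from the left or from the right. The only
change is the artificial switch after link `1` when all variables are kept and all links share one
tuple. -/
theorem linkLabel_same {k : ℕ} (hk : 2 ≤ k) (h : same (k - 1)) :
    linkLabel n same (k - 1) = linkLabel n same k ∨
      linkLabel n same (k - 1) = .O ∧ linkLabel n same k = .P ∧ ∀ j < n - 1, same j := by
  unfold linkLabel
  by_cases hall : ∀ j < n - 1, same j
  · rw [if_pos hall, if_pos hall, if_neg (show ¬ k ≤ 1 by omega)]
    split_ifs
    · exact .inr ⟨rfl, rfl, hall⟩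
    · exact .inl rfl
  · rw [if_neg hall, if_neg hall]
    have h1 : (∀ j < k - 1, same j) ↔ ∀ j < k, same j := by
      refine ⟨fun H j hj => ?_, fun H j hj => H j (by omega)⟩
      by_cases he : j = k - 1
      · exact he ▸ h
      · exact H j (by omega)
    have h2 : (∀ j < n - 1, k - 1 ≤ j → same j) ↔ ∀ j < n - 1, k ≤ j → same j := by
      refine ⟨fun H j hj hkj => H j hj (by omega), fun H j hj hkj => ?_⟩
      by_cases he : j = k - 1
      · exact he ▸ h
      · exact H j hj (by omega)
    left
    by_cases hA : ∀ j < k, same j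
    · rw [if_pos (h1.2 hA), if_pos hA]
    · rw [if_neg fun H => hA (h1.1 H), if_neg hA]
      by_cases hB : ∀ j < n - 1, k ≤ j → same j
      · rw [if_pos (h2.2 hB), if_pos hB]
      · rw [if_neg fun H => hB (h2.1 H), if_neg hB]

/-- `P` on the left or `O` on the right would force the variable to be kept; the four remaining
label pairs are those of `breakPair`. -/
theorem breakPair_linkLabel {k : ℕ} (hk : 1 ≤ k) (hkn : k < n) (h : ¬ same (k - 1)) :
    breakPair (linkLabel n same (k - 1)) (linkLabel n same k) = true := by
  have h1 : linkLabel n same (k - 1) ≠ .P := fun e =>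
    h (linkLabel_eq_P e (k - 1) (by omega) le_rfl)
  have h2 : linkLabel n same k ≠ .O := fun e =>
    h (linkLabel_eq_O e (by omega) (k - 1) (by omega))
  revert h1 h2
  cases linkLabel n same (k - 1) <;> cases linkLabel n same k <;> simp [breakPair]

end linkLabel

/-! ### Counterexamples exist -/

/-- The counterpart of `connected_of_eq`: if the labels tell the truth about the tuples, connected
variables are mapped to the same tuple. -/
theorem Connected.eq {α : Type*} {o₁ p₁ : Occ} {h : Bool} {q : Occ} {d : Label} {q' : Occ}
    {d' : Label} {X Y : Var} (H : Connected o₁ p₁ h q d q' d' X Y) {g g' : Var → α}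
    (hh : h = true → g o₁.op.loc = g p₁.op.loc)
    (h1 : (d = .O → g' q.op.loc = g o₁.op.loc) ∧ (d = .P → g' q.op.loc = g p₁.op.loc))
    (h2 : (d' = .O → g' q'.op.loc = g o₁.op.loc) ∧ (d' = .P → g' q'.op.loc = g p₁.op.loc)) :
    g X = g' Y := by
  rcases H with ⟨rfl, ⟨rfl, hd⟩ | ⟨rfl, hd⟩⟩ | ⟨rfl, ⟨rfl, hd⟩ | ⟨rfl, hd⟩⟩ |
    ⟨h', rfl | rfl, (⟨rfl, hd⟩ | ⟨rfl, hd⟩) | (⟨rfl, hd⟩ | ⟨rfl, hd⟩)⟩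
  · rw [h1.1 hd]
  · rw [h2.1 hd]
  · rw [h1.2 hd]
  · rw [h2.2 hd]
  · rw [h1.1 hd]
  · rw [h2.1 hd]
  · rw [h1.2 hd, hh h']
  · rw [h2.2 hd, hh h']
  · rw [h1.1 hd, hh h']
  · rw [h2.1 hd, hh h']
  · rw [h1.2 hd]
  · rw [h2.2 hd]

/-- The cycle is read back as template occurrences and its middle as a path in the graph. Labels `O`
and `P` are used only where chains of kept variables force the tuple; accidental coincidences get
`N`. The restrictions that `O` and `P` impose hold because the tuples really are equal and a split
cycle has no forbidden conflict on them. -/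
theorem nonempty_counterexample {Q : List InTemplate} {P : List Template} {A : Template → Level}
    (hQ : IsInput Q P A) {m : ℕ} {T : Fin m → Transaction} {τs : Fin m → InTemplate}
    {μ : Fin m → Var → Tuple} (hτs : ∀ i, τs i ∈ Q) (hμ : ∀ i X, (μ i X).rel = X.rel)
    (hT : Realizes T τs μ) (S : SplitCycle T fun i => (τs i).level) :
    Nonempty (Counterexample Q) := by
  classical
  choose O hO using fun i => hT.exists_occ (S.out i)
  choose I hI using fun i => hT.exists_occ (S.inn i)
  set n := S.n with hn
  have hn2 : 2 ≤ n := S.two_le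
  let τ : ℕ → InTemplate := fun i => τs (S.c i)
  let g : ℕ → Var → Tuple := fun i => μ (S.c i)
  have hOm : ∀ i, O i ∈ (τ i).occs := fun i => by
    have := (hO i).mem
    rwa [S.out_txn] at this
  have hIm : ∀ i, I i ∈ (τ (i + 1)).occs := fun i => by
    have := (hI i).mem
    rwa [S.inn_txn] at this
  have hlink : ∀ i, g i (O i).op.loc = g (i + 1) (I i).op.loc ∧ (O i).op.Clash (I i).op := by
    intro i
    have := ((hO i).conflicting_iff (hI i)).1 (S.conflicting i)
    rw [S.out_txn, S.inn_txn] at this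
    exact this.2
  have hpot : ∀ i, Pot (O i) (I i) := fun i => by
    refine ⟨?_, (hlink i).2⟩
    rw [← hμ (S.c i), ← hμ (S.c (i + 1))]
    exact congrArg _ (hlink i).1
  have hτn : τ (n - 1 + 1) = τ 0 := by
    simp only [τ, show n - 1 + 1 = S.n by omega, S.c_n]
  have hgn : g (n - 1 + 1) = g 0 := by
    simp only [g, show n - 1 + 1 = S.n by omega, S.c_n]
  have hn2' : n - 2 + 1 = n - 1 := by omega
  -- Whether `o₁` and `p₁` act on the same tuple in this cycle.
  let h : Bool := decide (g 0 (O 0).op.loc = g 0 (I (n - 1)).op.loc)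
  have hh : h = true ↔ g 0 (O 0).op.loc = g 0 (I (n - 1)).op.loc := decide_eq_true_iff
  let same : ℕ → Prop := fun j => (I j).op.loc = (O (j + 1)).op.loc
  have hsame : ∀ j, same j → g j (O j).op.loc = g (j + 1) (O (j + 1)).op.loc := by
    intro j hj
    rw [(hlink j).1]
    exact congrArg _ hj
  have hleft : ∀ i, (∀ j < i, same j) → g i (O i).op.loc = g 0 (O 0).op.loc := by
    intro i
    induction i with
    | zero => exact fun _ => rfl
    | succ i ih =>
      intro H
      rw [← hsame i (H i (by omega)), ih fun j hj => H j (by omega)]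
  have hlast : g (n - 1) (O (n - 1)).op.loc = g 0 (I (n - 1)).op.loc := by
    rw [(hlink _).1, hgn]
  -- Here `k` counts links backwards from the last one.
  have hright : ∀ k, k ≤ n - 1 → (∀ j < n - 1, n - 1 - k ≤ j → same j) →
      g (n - 1 - k) (O (n - 1 - k)).op.loc = g 0 (I (n - 1)).op.loc := by
    intro k
    induction k with
    | zero => exact fun _ _ => hlast
    | succ k ih =>
      intro hk H
      rw [hsame _ (H (n - 1 - (k + 1)) (by omega) le_rfl),
        show n - 1 - (k + 1) + 1 = n - 1 - k by omega]
      exact ih (by omega) fun j hj hj' => H j hj (by omega)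
  -- Variables kept throughout carry the tuple of `o₁` all the way to `p₁`.
  have hall : (∀ j < n - 1, same j) → h = true := fun H => by
    rw [hh, ← hleft (n - 1) H, hlast]
  -- conflicts between transactions of the cycle
  have hmeet : ∀ k, S.c 0 ≠ S.c k → ∀ x ∈ (τ 0).occs, ∀ y ∈ (τ k).occs,
      g 0 x.op.loc = g k y.op.loc → ∃ r r' : OpRef T, r.1 = S.c 0 ∧ r'.1 = S.c k ∧ Meet r r' ∧
        InstanceOf τs μ r x ∧ InstanceOf τs μ r' y := by
    intro k hk x hx y hy heq
    obtain ⟨r, hr, hrx⟩ := hT.exists_ref (i := S.c 0) hx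
    obtain ⟨r', hr', hry⟩ := hT.exists_ref (i := S.c k) hy
    refine ⟨r, r', hr, hr', ⟨by rwa [hr, hr'], ?_⟩, hrx, hry⟩
    rw [hrx.tuple, hry.tuple, hr, hr']
    exact heq
  have hnode : ∀ k, 2 ≤ k → k + 1 < n → ∀ o ∈ (τ k).occs, ∀ (c : Label) (d : Dir),
      (c = .O → g k o.op.loc = g 0 (O 0).op.loc) →
      (c = .P → g k o.op.loc = g 0 (I (n - 1)).op.loc) →
      (⟨o, c, d⟩ : Node) ∈ (nodes (O 0) (I (n - 1)) (τ 0) h Q).val := by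
    intro k h2 hk o ho c d h1 h1'
    -- A potential conflict on a common tuple would be a real conflict of `c 0` with a middle
    -- transaction.
    have key : ∀ x ∈ (τ 0).occs, ∀ y ∈ (τ k).occs, Pot x y → g 0 x.op.loc ≠ g k y.op.loc := by
      intro x hx y hy hp heq
      obtain ⟨r, r', hr, hr', hm, hrx, hry⟩ := hmeet k (S.ne_zero k h2 hk) x hx y hy heq
      refine S.not_conflicting k h2 hk r r' hr hr' ((hrx.conflicting_iff hry).2
        ⟨hm.1, ?_, hp.2⟩)
      rw [hr, hr']
      exact heq
    refine mem_nodes.2 ⟨τ k, hτs _, ho, ?_, ?_⟩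
    · rintro hc ⟨x, hx, hxl, y, hy, hyl, hp⟩
      refine key x hx y hy hp ?_
      rw [hxl, hyl]
      rcases hc with hc | ⟨hc', hc⟩
      · exact (h1 hc).symm
      · exact (hh.1 hc').trans (h1' hc).symm
    · rintro hc ⟨x, hx, hxl, y, hy, hyl, hp⟩
      refine key x hx y hy hp ?_
      rw [hxl, hyl]
      rcases hc with hc | ⟨hc', hc⟩
      · exact (h1' hc).symm
      · exact ((hh.1 hc').symm.trans (h1 hc).symm)
  let lab : ℕ → Label := linkLabel n same
  have hlabO : ∀ i, i ≤ n - 1 → lab i = .O → g i (O i).op.loc = g 0 (O 0).op.loc :=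
    fun i hi e => hleft i (linkLabel_eq_O e hi)
  have hlabP : ∀ i, i ≤ n - 1 → lab i = .P → g i (O i).op.loc = g 0 (I (n - 1)).op.loc := by
    intro i hi e
    have := hright (n - 1 - i) (by omega)
    rw [show n - 1 - (n - 1 - i) = i by omega] at this
    exact this (linkLabel_eq_P e)
  have hpath : ∀ k, k + 3 < n → Relation.TransGen (GraphEdge Q (τ 0) (O 0) (I (n - 1)) h)
      ⟨I 1, lab 1, .inc⟩ ⟨O (k + 2), lab (k + 2), .out⟩ := by
    have hout : ∀ k, k + 3 < n → (⟨O (k + 2), lab (k + 2), .out⟩ : Node) ∈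
        (nodes (O 0) (I (n - 1)) (τ 0) h Q).val := fun k hk =>
      hnode (k + 2) (by omega) (by omega) _ (hOm _) _ _ (hlabO _ (by omega)) (hlabP _ (by omega))
    have hinn : ∀ k, k + 3 < n → (⟨I (k + 1), lab (k + 1), .inc⟩ : Node) ∈
        (nodes (O 0) (I (n - 1)) (τ 0) h Q).val := fun k hk =>
      hnode (k + 2) (by omega) (by omega) _ (hIm _) _ _
        (fun e => (hlink (k + 1)).1.symm.trans (hlabO _ (by omega) e))
        (fun e => (hlink (k + 1)).1.symm.trans (hlabP _ (by omega) e))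
    have hedge : ∀ k, k + 3 < n → GraphEdge Q (τ 0) (O 0) (I (n - 1)) h
        ⟨I (k + 1), lab (k + 1), .inc⟩ ⟨O (k + 2), lab (k + 2), .out⟩ := by
      intro k hk
      refine ⟨hinn k hk, hout k hk, .inr ⟨rfl, rfl, ?_, ?_⟩⟩
      · exact (hQ.tid_eq (hτs _) (hIm (k + 1))).trans (hQ.tid_eq (hτs _) (hOm (k + 2))).symm
      · by_cases hs : same (k + 1)
        · refine .inl ⟨hs, ?_⟩
          rcases linkLabel_same (n := n) (same := same) (k := k + 2) (by omega) hs with e | ⟨e, e', H⟩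
          · exact .inl e
          · exact .inr ⟨e, e', hall H⟩
        · exact .inr ⟨hs, breakPair_linkLabel (k := k + 2) (by omega) (by omega) hs⟩
    intro k
    induction k with
    | zero => exact fun hk => .single (hedge 0 hk)
    | succ k ih =>
      intro hk
      -- Each further transaction adds a conflict edge and an edge inside its template.
      refine ((ih (by omega)).tail ?_).tail (hedge (k + 1) hk)
      exact ⟨hout k (by omega), hinn (k + 1) hk, .inl ⟨rfl, rfl, rfl, hpot _⟩⟩
  -- the labels of the second and the last transaction
  obtain ⟨c₂, cₙ, hc₂, hc₂', hcₙ, hcₙ', hO₂, hP₂, hOₙ, hPₙ, hreach⟩ : ∃ c₂ cₙ : Label,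
      (same 0 → c₂ = .O) ∧ (¬ same 0 → c₂ ≠ .O) ∧
      (same (n - 2) → cₙ = .P) ∧ (¬ same (n - 2) → cₙ ≠ .P) ∧
      (c₂ = .O → g 1 (O 1).op.loc = g 0 (O 0).op.loc) ∧
      (c₂ = .P → g 1 (O 1).op.loc = g 0 (I (n - 1)).op.loc) ∧
      (cₙ = .O → g (n - 2) (O (n - 2)).op.loc = g 0 (O 0).op.loc) ∧
      (cₙ = .P → g (n - 2) (O (n - 2)).op.loc = g 0 (I (n - 1)).op.loc) ∧
      Reachable Q (τ 0) (O 0) (I (n - 1)) h (O 1) (I 0) c₂ (O (n - 1)) (I (n - 2)) cₙ := by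
    -- Link `1` carries `c₂` and link `n - 2` carries `cₙ`. For `n = 2` these are the last and the
    -- first link, and for `n = 3` they are one link that may need both `O` and `P`; there the
    -- labels are chosen by hand.
    rcases (show n = 2 ∨ n = 3 ∨ 4 ≤ n by omega) with h2 | h3 | h4
    · have hlast' : g 1 (O 1).op.loc = g 0 (I (n - 1)).op.loc := by
        rw [← hlast, h2]
      have e1 : n - 1 = 1 := by omega
      have e2 : n - 2 = 0 := by omega
      by_cases hs : same 0
      · have hT' : h = true := hall fun j hj => by
          obtain rfl : j = 0 := by omega
          exact hs
        refine ⟨.O, .P, fun _ => rfl, fun h => absurd hs h, fun _ => rfl,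
          fun h => absurd (e2 ▸ hs) h, fun _ => (hsame 0 hs).symm, by simp,
          by simp, fun _ => ?_, .inl ⟨⟨?_, ?_⟩, .inr ⟨hT', rfl, rfl⟩⟩⟩
        · rw [e2]
          exact hh.1 hT'
        · rw [e1]
        · rw [e2]
      · refine ⟨.P, .O, fun h => absurd h hs, fun _ => by simp, fun h => absurd (e2 ▸ h) hs,
          fun _ => by simp, by simp, fun _ => hlast', fun _ => by rw [e2],
          by simp, .inl ⟨⟨?_, ?_⟩, .inl ⟨rfl, rfl⟩⟩⟩
        · rw [e1]
        · rw [e2]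
    · have e1 : n - 2 = 1 := by omega
      by_cases hs : ∀ j < n - 1, same j
      · have h0 : same 0 := hs 0 (by omega)
        have h1 : same (n - 2) := hs _ (by omega)
        refine ⟨.O, .P, fun _ => rfl, fun h => absurd h0 h, fun _ => rfl, fun h => absurd h1 h,
          fun _ => (hsame 0 h0).symm, by simp, by simp, fun _ => ?_,
          .inr (.inl ⟨?_, .inr ⟨hall hs, rfl, rfl⟩⟩)⟩
        · rw [hsame _ h1, hn2', hlast]
        · rw [e1]
          exact hpot 1
      · refine ⟨lab 1, lab (n - 2), fun h => linkLabel_one h,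
          fun h e => h (linkLabel_eq_O e (by omega) 0 (by omega)),
          fun h => linkLabel_last (.inr hs) hn2 h,
          fun h e => h (linkLabel_eq_P e _ (by omega) le_rfl), hlabO _ (by omega),
          hlabP _ (by omega), hlabO _ (by omega), hlabP _ (by omega),
          .inr (.inl ⟨?_, .inl ?_⟩)⟩
        · rw [e1]
          exact hpot 1
        · rw [e1]
    · refine ⟨lab 1, lab (n - 2), fun h => linkLabel_one h,
        fun h e => h (linkLabel_eq_O e (by omega) 0 (by omega)),
        fun h => linkLabel_last (.inl h4) hn2 h,
        fun h e => h (linkLabel_eq_P e _ (by omega) le_rfl), hlabO _ (by omega),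
        hlabP _ (by omega), hlabO _ (by omega), hlabP _ (by omega),
        .inr (.inr ⟨_, _, hpath (n - 4) (by omega), rfl, rfl, rfl, ?_, (hpot 1).symm, ?_⟩)⟩
      · rw [show n - 4 + 2 = n - 2 by omega]
      · rw [show n - 4 + 2 = n - 2 by omega]
        exact hpot _
  have hc01 : S.c 0 ≠ S.c 1 := by
    have := (S.conflicting 0).1.1
    rwa [S.out_txn, S.inn_txn] at this
  have hc0n : S.c 0 ≠ S.c (n - 1) := by
    have := (S.conflicting (n - 1)).1.1
    rw [S.out_txn, S.inn_txn, show n - 1 + 1 = S.n by omega, S.c_n] at this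
    exact this.symm
  have hconn₂ : ∀ {X Y}, Connected (O 0) (I (n - 1)) h (I 0) .O (O 1) c₂ X Y → g 0 X = g 1 Y :=
    fun H => H.eq hh.1 ⟨fun _ => (hlink 0).1.symm, by simp⟩ ⟨hO₂, hP₂⟩
  have hgin : g (n - 1) (I (n - 2)).op.loc = g (n - 2) (O (n - 2)).op.loc := by
    rw [(hlink (n - 2)).1, hn2']
  have hconnₙ : ∀ {X Y}, Connected (O 0) (I (n - 1)) h (O (n - 1)) .P (I (n - 2)) cₙ X Y →
      g 0 X = g (n - 1) Y :=
    fun H => H.eq hh.1 ⟨by simp, fun _ => hlast⟩ (hgin ▸ ⟨hOₙ, hPₙ⟩)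
  have hww : ∀ k, k = 1 ∨ k = n - 1 → ∀ x ∈ (τ 0).occs, ∀ y ∈ (τ k).occs, x.op.WW y.op →
      g 0 x.op.loc = g k y.op.loc → (τ 0).level = .RC ∧ (O 0).pos < x.pos := by
    intro k hk x hx y hy hc heq
    obtain ⟨r, r', hr, hr', hm, hrx, hry⟩ :=
      hmeet k (by rcases hk with rfl | rfl; exacts [hc01, hc0n]) x hx y hy heq
    have := S.not_ww k hk r r' hr hr' hm ((hrx.ww_iff hry).2 hc)
    rwa [← (hO 0).pos, ← hrx.pos] at this
  have hIlast : I (n - 1) ∈ (τ 0).occs := hτn ▸ hIm (n - 1)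
  refine ⟨{ τ₁ := τ 0, τ₁_mem := hτs _, o₁ := O 0, o₁_mem := hOm 0, p₁ := I (n - 1)
            p₁_mem := hIlast, h := h, h_eq := fun e => hh.2 (congrArg _ e)
            τ₂ := τ 1, τ₂_mem := hτs _, o₂ := O 1, o₂_mem := hOm 1, p₂ := I 0, p₂_mem := hIm 0
            τₙ := τ (n - 1), τₙ_mem := hτs _, oₙ := O (n - 1), oₙ_mem := hOm _, pₙ := I (n - 2)
            pₙ_mem := hn2' ▸ hIm (n - 2), pot₁ := hpot 0, potₙ := hpot _, c₂ := c₂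
            c₂_eq := fun e => hc₂ e.symm, c₂_ne := fun e => hc₂' (Ne.symm e), cₙ := cₙ
            cₙ_eq := fun e => hcₙ ?_, cₙ_ne := fun e => hcₙ' ?_, reachable := hreach
            valid := ?_ }⟩
  · simp only [same, hn2']
    exact e.symm
  · simp only [same, hn2']
    exact Ne.symm e
  constructor
  · exact fun x hx y hy _ hc hco => hww 1 (.inl rfl) x hx y hy hc (hconn₂ hco)
  · exact fun x hx y hy _ hc hco => hww (n - 1) (.inr rfl) x hx y hy hc (hconnₙ hco)
  · exact ⟨(hpot 0).1, ((hO 0).rw_iff (hI 0)).1 S.rw_zero⟩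
  · refine S.rw_last.imp (fun H => ⟨(hpot _).1, ((hO _).rw_iff (hI _)).1 H⟩) fun H => ?_
    rwa [← (hO 0).pos, ← (hI _).pos] at H
  · exact S.not_ssi
  · intro h0 h1 x hx y hy _ hc hco
    obtain ⟨r, r', hr, hr', hm, hrx, hry⟩ := hmeet 1 hc01 x hx y hy (hconn₂ hco)
    exact S.not_wr h0 h1 r r' hr hr' hm ((hrx.wr_iff hry).2 hc)
  · intro h0 h1 x hx y hy _ hc hco
    obtain ⟨r, r', hr, hr', hm, hrx, hry⟩ := hmeet (n - 1) hc0n x hx y hy (hconnₙ hco)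
    exact S.not_rw h0 h1 r r' hr hr' hm ((hrx.rw_iff hry).2 hc)

/-- A bad schedule over any database yields a split cycle, whose transactions all come from the
numbered templates, and hence a counterexample. -/
theorem robust_of_isEmpty {Q : List InTemplate} {P : List Template} {A : Template → Level}
    (hQ : IsInput Q P A) (hC : ¬ Nonempty (Counterexample Q)) : Robust {τ | τ ∈ P} A := by
  intro D m T B hT s hs
  by_contra hCS
  choose t ht hinst hB using hT
  choose μ hμ _ hμT using hinst
  choose τs hτs hlev hdesc using fun i => hQ.exists_inTemplate (t i) (ht i)
  obtain rfl : B = fun i => (τs i).level := funext fun i => by rw [hB, hlev]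
  obtain ⟨S⟩ := nonempty_splitCycle hs hCS
  exact hC (nonempty_counterexample hQ hτs hμ (fun i => ⟨t i, hdesc i, hμT i⟩) S)

theorem val_decideRobust_iff (P : List Template) (A : Template → Level) :
    (decideRobust (P.map fun τ => (τ, A τ))).val = true ↔ Robust {τ | τ ∈ P} A := by
  have hQ := isInput_numberTemplates P A
  rw [val_decideRobust]
  exact ⟨robust_of_isEmpty hQ, fun hR ⟨C⟩ => C.not_robust hQ hR⟩

end Algo

/-! ### Step counts -/

namespace Timed

variable {α β : Type}

@[simp] theorem steps_pure (a : α) : (pure a : Timed α).steps = 0 := rfl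
@[simp] theorem steps_bind (x : Timed α) (f : α → Timed β) :
    (x >>= f).steps = x.steps + (f x.val).steps := rfl
@[simp] theorem steps_tick (n : ℕ) : (tick n).steps = n := rfl

/-- An early exit is free, so a cascade of tests costs at most as much as running all of them. -/
theorem steps_ite_pure_le (c : Prop) [Decidable c] (a : α) (y : Timed α) :
    (if c then pure a else y).steps ≤ y.steps := by
  split_ifs <;> simp

theorem steps_ite_le {c : Prop} [Decidable c] {x y : Timed α} {B : ℕ} (hx : x.steps ≤ B)
    (hy : y.steps ≤ B) : (if c then x else y).steps ≤ B := by
  split_ifs <;> assumption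

theorem steps_and_le (x y : Timed Bool) : (Timed.and x y).steps ≤ 1 + x.steps + y.steps := by
  simp only [Timed.and, steps_bind, steps_tick]
  have : (if x.val = true then y else pure false).steps ≤ y.steps :=
    steps_ite_le le_rfl (Nat.zero_le _)
  omega

theorem steps_or_le (x y : Timed Bool) : (Timed.or x y).steps ≤ 1 + x.steps + y.steps := by
  simp only [Timed.or, steps_bind, steps_tick]
  have := steps_ite_pure_le (x.val = true) true y
  omega

theorem steps_not (x : Timed Bool) : (Timed.not x).steps = 1 + x.steps := rfl

theorem steps_eqNat_le {a b n : ℕ} (ha : a.size ≤ n) (hb : b.size ≤ n) :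
    (eqNat a b).steps ≤ 2 * n + 1 := by
  change 1 + a.size + b.size + 0 ≤ _
  omega

theorem steps_ltNat_le {a b n : ℕ} (ha : a.size ≤ n) (hb : b.size ≤ n) :
    (ltNat a b).steps ≤ 2 * n + 1 := by
  change 1 + a.size + b.size + 0 ≤ _
  omega

theorem steps_any_le {l : List α} {f : α → Timed Bool} {L B : ℕ} (hl : l.length ≤ L)
    (hf : ∀ a ∈ l, (f a).steps ≤ B) : (Timed.any l f).steps ≤ L * (B + 1) + 1 := by
  suffices h : (Timed.any l f).steps ≤ l.length * (B + 1) + 1 from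
    h.trans (Nat.add_le_add_right (Nat.mul_le_mul_right _ hl) 1)
  clear hl
  induction l with
  | nil => simp [Timed.any]
  | cons a l ih =>
    have h1 := hf a (by simp)
    have h2 := ih fun b hb => hf b (by simp [hb])
    have h3 := steps_ite_pure_le ((f a).val = true) true (Timed.any l f)
    simp only [Timed.any, steps_bind, steps_tick, List.length_cons]
    rw [Nat.add_mul, Nat.one_mul]
    omega

/-- Time and length are bounded together because copying each partial result is charged by its
length. -/
theorem collect_le {l : List α} {f : α → Timed (List β)} {L B K : ℕ} (hl : l.length ≤ L)
    (hf : ∀ a ∈ l, (f a).steps ≤ B ∧ (f a).val.length ≤ K) :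
    (collect l f).steps ≤ L * (1 + B + K) + 1 ∧ (collect l f).val.length ≤ L * K := by
  suffices h : (collect l f).steps ≤ l.length * (1 + B + K) + 1 ∧
      (collect l f).val.length ≤ l.length * K from
    ⟨h.1.trans (Nat.add_le_add_right (Nat.mul_le_mul_right _ hl) 1),
      h.2.trans (Nat.mul_le_mul_right _ hl)⟩
  clear hl
  induction l with
  | nil => simp [collect]
  | cons a l ih =>
    have h1 := hf a (by simp)
    have h2 := ih fun b hb => hf b (by simp [hb])
    simp only [collect, steps_bind, steps_tick, steps_pure, val_bind, val_pure, List.length_cons,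
      List.length_append]
    rw [Nat.add_mul, Nat.one_mul, Nat.add_mul, Nat.one_mul]
    omega

theorem collect_ite_le {l : List α} {f : α → Timed Bool} {g : α → β} {L B : ℕ}
    (hl : l.length ≤ L) (hf : ∀ a ∈ l, (f a).steps ≤ B) :
    (collect l fun a => do if ← f a then pure [g a] else pure []).steps ≤ L * (1 + B + 1) + 1 ∧
      (collect l fun a => do if ← f a then pure [g a] else pure []).val.length ≤ L := by
  have := collect_le (f := fun a => do if ← f a then pure [g a] else pure []) (K := 1) hl
    fun a ha => ⟨show _ ≤ B from ?_, ?_⟩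
  · rwa [Nat.mul_one] at this
  · have h : (if (f a).val = true then pure [g a] else pure [] : Timed (List β)).steps = 0 := by
      split_ifs <;> rfl
    rw [steps_bind, h]
    exact hf a ha
  · simp only [val_bind, val_ite, val_pure]
    split_ifs <;> simp

end Timed

namespace Algo

open Timed Polynomial

/-- The numbers in `o` have at most `n` bits, and its lists have at most `n` elements. -/
structure Occ.Fits (n : ℕ) (o : Occ) : Prop where
  tid : o.tid.size ≤ n
  pos : o.pos.size ≤ n
  rel : o.op.loc.rel.size ≤ n
  name : o.op.loc.name.size ≤ n
  readLength : o.op.readSet.length ≤ n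
  read : ∀ a ∈ o.op.readSet, a.size ≤ n
  writeLength : o.op.writeSet.length ≤ n
  write : ∀ a ∈ o.op.writeSet, a.size ≤ n

structure InTemplate.Fits (n : ℕ) (τ : InTemplate) : Prop where
  length : τ.occs.length ≤ n
  occs : ∀ o ∈ τ.occs, o.Fits n

/-! #### The size of the input -/

theorem size_le_self (n : ℕ) : n.size ≤ n := Nat.size_le.2 Nat.lt_two_pow_self

theorem length_le_sum_map {α : Type} (l : List α) (f : α → ℕ) (hf : ∀ a ∈ l, 1 ≤ f a) :
    l.length ≤ (l.map f).sum := by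
  induction l with
  | nil => simp
  | cons a l ih =>
    have := hf a (by simp)
    have := ih fun b hb => hf b (by simp [hb])
    simp only [List.length_cons, List.map_cons, List.sum_cons]
    omega

theorem le_sum_map {α : Type} {l : List α} (f : α → ℕ) {a : α} (ha : a ∈ l) :
    f a ≤ (l.map f).sum :=
  List.single_le_sum (fun _ _ => Nat.zero_le _) _ (List.mem_map_of_mem ha)

theorem attrs_fit {l : List ℕ} : l.length ≤ attrsSize l ∧ ∀ a ∈ l, a.size ≤ attrsSize l := by
  refine ⟨length_le_sum_map _ _ fun _ _ => Nat.le_add_right _ _, fun a ha => ?_⟩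
  have := le_sum_map (fun a : ℕ => 1 + a.size) ha
  unfold attrsSize
  omega

theorem length_numberOps (tid pos : ℕ) (t : Template) :
    (numberOps tid pos t).val.length = t.length := by
  induction t generalizing pos with
  | nil => rfl
  | cons o t ih => simp [numberOps, ih]

theorem length_numberTemplates (tid : ℕ) (l : List (Template × Level)) :
    (numberTemplates tid l).val.length = l.length := by
  induction l generalizing tid with
  | nil => rfl
  | cons o t ih => simp [numberTemplates, ih]

theorem steps_numberOps_le {n tid pos : ℕ} {t : Template} (ht : tid ≤ n)
    (hp : pos + t.length ≤ n) : (numberOps tid pos t).steps ≤ t.length * (1 + 2 * n) + 1 := by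
  induction t generalizing pos with
  | nil => simp [numberOps]
  | cons o t ih =>
    rw [List.length_cons] at hp
    have h1 := ih (pos := pos + 1) (by omega)
    have h2 := size_le_self tid
    have h3 := size_le_self pos
    simp only [numberOps, steps_bind, steps_tick, steps_pure, List.length_cons]
    rw [Nat.add_mul, Nat.one_mul]
    omega

theorem steps_numberTemplates_le {n tid : ℕ} {l : List (Template × Level)}
    (hl : ∀ x ∈ l, x.1.length ≤ n) (ht : tid + l.length ≤ n) :
    (numberTemplates tid l).steps ≤ l.length * (1 + n + (n * (1 + 2 * n) + 1)) + 1 := by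
  induction l generalizing tid with
  | nil => simp [numberTemplates]
  | cons x l ih =>
    rw [List.length_cons] at ht
    have h1 := ih (tid := tid + 1) (fun y hy => hl y (by simp [hy])) (by omega)
    have h2 := size_le_self tid
    have h4 := hl x (by simp)
    have h3 := steps_numberOps_le (n := n) (tid := tid) (pos := 0) (t := x.1) (by omega) (by omega)
    have h5 := Nat.mul_le_mul_right (1 + 2 * n) h4
    simp only [numberTemplates, steps_bind, steps_tick, steps_pure, List.length_cons]
    rw [Nat.add_mul, Nat.one_mul]
    omega

/-- Names and attributes are part of the description, and template numbers and positions are below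
list lengths that the description bounds. -/
theorem fits_numberTemplates (P : List Template) (A : Template → Level) :
    (numberTemplates 0 (P.map fun τ => (τ, A τ))).val.length ≤ templatesSize P ∧
      ∀ τ ∈ (numberTemplates 0 (P.map fun τ => (τ, A τ))).val, τ.Fits (templatesSize P) := by
  have hlen : P.length ≤ templatesSize P :=
    length_le_sum_map _ _ fun t _ => by unfold templateSize; omega
  refine ⟨by rwa [length_numberTemplates, List.length_map], fun τ hτ => ?_⟩
  obtain ⟨-, x, hx, -, hocc⟩ := mem_numberTemplates.1 hτ
  rw [Nat.sub_zero, List.getElem?_map, Option.map_eq_some_iff] at hx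
  obtain ⟨t, ht, rfl⟩ := hx
  have htid : τ.tid < P.length := (List.getElem?_eq_some_iff.1 ht).1
  have htP : templateSize t ≤ templatesSize P :=
    le_sum_map templateSize (List.mem_of_getElem? ht)
  have htl : t.length ≤ (t.map opSize).sum :=
    length_le_sum_map _ _ fun o _ => by unfold opSize; omega
  unfold templateSize at htP
  refine ⟨by rw [hocc, length_numberOps]; dsimp only; omega, fun o ho => ?_⟩
  rw [hocc, mem_numberOps] at ho
  obtain ⟨h1, -, h2⟩ := ho
  rw [Nat.sub_zero] at h2
  dsimp only at h2
  have hpos : o.pos < t.length := (List.getElem?_eq_some_iff.1 h2).1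
  have hop : 1 + o.op.loc.rel.size + o.op.loc.name.size + attrsSize o.op.readSet +
      attrsSize o.op.writeSet ≤ (t.map opSize).sum := le_sum_map opSize (List.mem_of_getElem? h2)
  have hr := attrs_fit (l := o.op.readSet)
  have hw := attrs_fit (l := o.op.writeSet)
  have h3 := size_le_self o.tid
  have h4 := size_le_self o.pos
  exact ⟨by omega, by omega, by omega, by omega, by omega,
    fun a ha => by have := hr.2 a ha; omega, by omega, fun a ha => by have := hw.2 a ha; omega⟩

/-! #### Polynomial bounds -/

/-- Each bound is a polynomial built in the same way as the program it belongs to, so bounds compose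
without being expanded. -/
noncomputable def eqBound : ℕ[X] := 2 * X + 1
noncomputable def varBound : ℕ[X] := 1 + eqBound + eqBound
noncomputable def loopBound (L B : ℕ[X]) : ℕ[X] := L * (B + 1) + 1
noncomputable def collectBound (L B K : ℕ[X]) : ℕ[X] := L * (1 + B + K) + 1
noncomputable def testBound : ℕ[X] := 1 + eqBound + loopBound X (loopBound X eqBound)
noncomputable def potBound : ℕ[X] := 1 + testBound + (1 + testBound + testBound)
noncomputable def blockedBound : ℕ[X] :=
  loopBound X (1 + varBound + loopBound X (1 + varBound + potBound))

theorem eval_loopBound (L B : ℕ[X]) (n : ℕ) :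
    (loopBound L B).eval n = L.eval n * (B.eval n + 1) + 1 := by
  simp [loopBound]

theorem eval_collectBound (L B K : ℕ[X]) (n : ℕ) :
    (collectBound L B K).eval n = L.eval n * (1 + B.eval n + K.eval n) + 1 := by
  simp [collectBound]

theorem eval_eqBound (n : ℕ) : eqBound.eval n = 2 * n + 1 := by
  simp [eqBound]

variable {n : ℕ}

theorem steps_any_le_loopBound {α : Type} {l : List α} {f : α → Timed Bool} {L B : ℕ[X]}
    (hl : l.length ≤ L.eval n) (hf : ∀ a ∈ l, (f a).steps ≤ B.eval n) :
    (Timed.any l f).steps ≤ (loopBound L B).eval n := by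
  rw [eval_loopBound]
  exact steps_any_le hl hf

theorem steps_and_le_eval {x y : Timed Bool} {B C : ℕ[X]} (hx : x.steps ≤ B.eval n)
    (hy : y.steps ≤ C.eval n) : (Timed.and x y).steps ≤ (1 + B + C).eval n := by
  have := steps_and_le x y
  rw [eval_add, eval_add, eval_one]
  omega

theorem steps_or_le_eval {x y : Timed Bool} {B C : ℕ[X]} (hx : x.steps ≤ B.eval n)
    (hy : y.steps ≤ C.eval n) : (Timed.or x y).steps ≤ (1 + B + C).eval n := by
  have := steps_or_le x y
  rw [eval_add, eval_add, eval_one]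
  omega

theorem steps_not_le_eval {x : Timed Bool} {B : ℕ[X]} (hx : x.steps ≤ B.eval n) :
    (Timed.not x).steps ≤ (1 + B).eval n := by
  rw [steps_not, eval_add, eval_one]
  omega

theorem steps_pure_le_eval {α : Type} (a : α) : (pure a : Timed α).steps ≤ (0 : ℕ[X]).eval n :=
  Nat.zero_le _

theorem steps_eqNat_le_eval {a b : ℕ} (ha : a.size ≤ n) (hb : b.size ≤ n) :
    (eqNat a b).steps ≤ eqBound.eval n := by
  rw [eval_eqBound]
  exact steps_eqNat_le ha hb

theorem steps_ltNat_le_eval {a b : ℕ} (ha : a.size ≤ n) (hb : b.size ≤ n) :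
    (ltNat a b).steps ≤ eqBound.eval n := by
  rw [eval_eqBound]
  exact steps_ltNat_le ha hb

theorem steps_meets_le {l l' : List ℕ} (h1 : l.length ≤ n) (h2 : ∀ a ∈ l, a.size ≤ n)
    (h1' : l'.length ≤ n) (h2' : ∀ a ∈ l', a.size ≤ n) :
    (meets l l').steps ≤ (loopBound X (loopBound X eqBound)).eval n :=
  steps_any_le_loopBound (by simpa using h1) fun a ha =>
    steps_any_le_loopBound (by simpa using h1') fun b hb =>
      steps_eqNat_le_eval (h2 a ha) (h2' b hb)

theorem steps_sameVar_le {o p : Occ} (ho : o.Fits n) (hp : p.Fits n) :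
    (sameVar o p).steps ≤ varBound.eval n :=
  steps_and_le_eval (steps_eqNat_le_eval ho.rel hp.rel) (steps_eqNat_le_eval ho.name hp.name)

theorem steps_sameOcc_le {o p : Occ} (ho : o.Fits n) (hp : p.Fits n) :
    (sameOcc o p).steps ≤ varBound.eval n :=
  steps_and_le_eval (steps_eqNat_le_eval ho.tid hp.tid) (steps_eqNat_le_eval ho.pos hp.pos)

theorem steps_potWW_le {o p : Occ} (ho : o.Fits n) (hp : p.Fits n) :
    (potWW o p).steps ≤ testBound.eval n :=
  steps_and_le_eval (steps_eqNat_le_eval ho.rel hp.rel)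
    (steps_meets_le ho.writeLength ho.write hp.writeLength hp.write)

theorem steps_potWR_le {o p : Occ} (ho : o.Fits n) (hp : p.Fits n) :
    (potWR o p).steps ≤ testBound.eval n :=
  steps_and_le_eval (steps_eqNat_le_eval ho.rel hp.rel)
    (steps_meets_le ho.writeLength ho.write hp.readLength hp.read)

theorem steps_potRW_le {o p : Occ} (ho : o.Fits n) (hp : p.Fits n) :
    (potRW o p).steps ≤ testBound.eval n :=
  steps_and_le_eval (steps_eqNat_le_eval ho.rel hp.rel)
    (steps_meets_le ho.readLength ho.read hp.writeLength hp.write)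

theorem steps_pot_le {o p : Occ} (ho : o.Fits n) (hp : p.Fits n) :
    (pot o p).steps ≤ potBound.eval n :=
  steps_or_le_eval (steps_potWW_le ho hp)
    (steps_or_le_eval (steps_potWR_le ho hp) (steps_potRW_le ho hp))

/-! ### Cost of the graph and of its closure -/

variable {n : ℕ}

theorem steps_blocked_le {τ₁ τ : InTemplate} {o₁ o : Occ} (hτ₁ : τ₁.Fits n) (hτ : τ.Fits n)
    (ho₁ : o₁.Fits n) (ho : o.Fits n) :
    (blocked τ₁ o₁ τ o).steps ≤ blockedBound.eval n :=
  steps_any_le_loopBound (by simpa using hτ₁.length) fun x hx =>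
    steps_and_le_eval (steps_sameVar_le (hτ₁.occs x hx) ho₁) <|
      steps_any_le_loopBound (by simpa using hτ.length) fun y hy =>
        steps_and_le_eval (steps_sameVar_le (hτ.occs y hy) ho)
          (steps_pot_le (hτ₁.occs x hx) (hτ.occs y hy))

noncomputable def nodeBound : ℕ[X] := 1 + (1 + 0 + blockedBound) + (1 + 0 + blockedBound)
noncomputable def nodesBound : ℕ[X] :=
  collectBound X (collectBound X (collectBound 3 nodeBound 2) (3 * 2)) (X * (3 * 2))
-- Templates, occurrences, three labels, two directions.
noncomputable def nodesLength : ℕ[X] := X * (X * (3 * 2))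

/-- Nodes over occurrences of bounded size. -/
def NodesFit (n : ℕ) (V : List Node) : Prop := ∀ x ∈ V, x.occ.Fits n

theorem nodes_le {o₁ p₁ : Occ} {τ₁ : InTemplate} (h : Bool) {Q : List InTemplate}
    (hQ : Q.length ≤ n) (hQ' : ∀ τ ∈ Q, τ.Fits n) (hτ₁ : τ₁.Fits n) (ho₁ : o₁.Fits n)
    (hp₁ : p₁.Fits n) :
    (nodes o₁ p₁ τ₁ h Q).steps ≤ nodesBound.eval n ∧
      (nodes o₁ p₁ τ₁ h Q).val.length ≤ nodesLength.eval n ∧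
      NodesFit n (nodes o₁ p₁ τ₁ h Q).val := by
  have h1 : ∀ τ ∈ Q, ∀ o ∈ τ.occs, ∀ c : Label,
      (Timed.or
        (Timed.and (pure (decide (c = .O) || (h && decide (c = .P)))) (blocked τ₁ o₁ τ o))
        (Timed.and (pure (decide (c = .P) || (h && decide (c = .O)))) (blocked τ₁ p₁ τ o))).steps
        ≤ nodeBound.eval n := fun τ hτ o ho c =>
    steps_or_le_eval
      (steps_and_le_eval (steps_pure_le_eval _)
        (steps_blocked_le hτ₁ (hQ' τ hτ) ho₁ ((hQ' τ hτ).occs o ho)))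
      (steps_and_le_eval (steps_pure_le_eval _)
        (steps_blocked_le hτ₁ (hQ' τ hτ) hp₁ ((hQ' τ hτ).occs o ho)))
  refine ⟨?_, ?_, fun x hx => ?_⟩
  rotate_left 2
  · obtain ⟨τ, hτ, ho, -⟩ := mem_nodes.1 hx
    exact (hQ' τ hτ).occs _ ho
  all_goals
    have key : _ ∧ _ := collect_le (l := Q) (L := n) (f := fun τ => collect τ.occs fun o =>
      collect [Label.O, Label.P, Label.N] fun c => do
        let excluded ← Timed.or
          (Timed.and (pure (decide (c = .O) || (h && decide (c = .P)))) (blocked τ₁ o₁ τ o))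
          (Timed.and (pure (decide (c = .P) || (h && decide (c = .O)))) (blocked τ₁ p₁ τ o))
        if excluded then pure [] else pure [(⟨o, c, .inc⟩ : Node), (⟨o, c, .out⟩ : Node)]) hQ fun τ hτ =>
      collect_le (L := n) (hQ' τ hτ).length fun o ho =>
        collect_le (L := 3) (K := 2) (B := nodeBound.eval n) (le_refl 3) fun c _ => ⟨by
          rw [steps_bind]
          refine (Nat.add_le_add (h1 τ hτ o ho c) (steps_ite_le (B := 0) ?_ ?_)) <;> exact le_rfl,
          by
            rw [val_bind, val_ite]
            split_ifs <;> simp⟩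
    simp only [nodesBound, nodesLength, eval_collectBound, eval_mul, eval_X, eval_ofNat]
  · exact key.1
  · exact key.2

noncomputable def edgeBound : ℕ[X] := 1 + eqBound + varBound + potBound

theorem steps_isEdge_le {h : Bool} {x y : Node} (hx : x.occ.Fits n) (hy : y.occ.Fits n) :
    (isEdge h x y).steps ≤ edgeBound.eval n := by
  have h1 := steps_pot_le hx hy
  have h2 := steps_sameVar_le hx hy
  have h3 := steps_eqNat_le_eval hx.tid hy.tid
  unfold isEdge edgeBound
  rw [eval_add, eval_add, eval_add, eval_one]
  split
  · refine (steps_and_le _ _).trans ?_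
    rw [steps_pure]
    omega
  · refine (steps_and_le _ _).trans ?_
    rw [steps_bind]
    have := steps_ite_le (c := (sameVar x.occ y.occ).val = true)
      (x := (pure (decide (x.label = y.label) ||
          (decide (x.label = .O) && decide (y.label = .P) && h)) : Timed Bool))
      (y := pure (breakPair x.label y.label)) (B := 0) le_rfl le_rfl
    omega
  · simp only [steps_bind, steps_tick, steps_pure]
    omega

noncomputable def edgesBound (V : ℕ[X]) : ℕ[X] := collectBound V (collectBound V edgeBound 1) V

/-- Lists of pairs of nodes over occurrences of bounded size. -/
def PairsFit (n : ℕ) (F : List (Node × Node)) : Prop :=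
  ∀ e ∈ F, e.1.occ.Fits n ∧ e.2.occ.Fits n

/-- A double loop that lists pairs of nodes. -/
theorem pairs_le {V : List Node} {f : Node → Node → Timed Bool} {L B : ℕ[X]}
    (hV : V.length ≤ L.eval n) (hV' : NodesFit n V)
    (hf : ∀ x ∈ V, ∀ y ∈ V, (f x y).steps ≤ B.eval n) :
    (collect V fun x => collect V fun y => do
      if ← f x y then pure [(x, y)] else pure []).steps ≤
        (collectBound L (collectBound L B 1) L).eval n ∧
    (collect V fun x => collect V fun y => do
      if ← f x y then pure [(x, y)] else pure []).val.length ≤ (L * L).eval n ∧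
    PairsFit n (collect V fun x => collect V fun y => do
      if ← f x y then pure [(x, y)] else pure []).val := by
  have key := collect_le (f := fun x => collect V fun y => do
      if ← f x y then pure [(x, y)] else pure []) hV fun x hx =>
    collect_ite_le (g := fun y => (x, y)) hV (hf x hx)
  simp only [eval_collectBound, eval_mul, eval_one]
  refine ⟨key.1, key.2, fun e he => ?_⟩
  simp only [mem_val_collect, val_bind, val_ite, val_pure] at he
  obtain ⟨x, hx, y, hy, he⟩ := he
  split_ifs at he
  · rw [List.mem_singleton.1 he]
    exact ⟨hV' x hx, hV' y hy⟩
  · simp at he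

theorem edges_le (h : Bool) {V : List Node} {L : ℕ[X]} (hV : V.length ≤ L.eval n)
    (hV' : NodesFit n V) :
    (edges h V).steps ≤ (edgesBound L).eval n ∧ (edges h V).val.length ≤ (L * L).eval n ∧
      PairsFit n (edges h V).val :=
  pairs_le hV hV' fun _ hx _ hy => steps_isEdge_le (hV' _ hx) (hV' _ hy)

noncomputable def sameNodeBound : ℕ[X] := 1 + varBound + 0

theorem steps_sameNode_le {x y : Node} (hx : x.occ.Fits n) (hy : y.occ.Fits n) :
    (sameNode x y).steps ≤ sameNodeBound.eval n :=
  steps_and_le_eval (steps_sameOcc_le hx hy) (steps_pure_le_eval _)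

noncomputable def isListedBound (L : ℕ[X]) : ℕ[X] :=
  loopBound (L * L) (1 + sameNodeBound + sameNodeBound)

theorem steps_isListed_le {E : List (Node × Node)} {x y : Node} {L : ℕ[X]}
    (hE : E.length ≤ (L * L).eval n) (hE' : PairsFit n E) (hx : x.occ.Fits n)
    (hy : y.occ.Fits n) : (isListed E x y).steps ≤ (isListedBound L).eval n :=
  steps_any_le_loopBound hE fun e he =>
    steps_and_le_eval (steps_sameNode_le (hE' e he).1 hx) (steps_sameNode_le (hE' e he).2 hy)

noncomputable def extendBound (L : ℕ[X]) : ℕ[X] :=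
  collectBound L (collectBound L (1 + isListedBound L +
    loopBound L (1 + isListedBound L + isListedBound L)) 1) L

/-- Each round rebuilds the list by a double loop over `V`, so its length stays below `L * L`
however many rounds are made. -/
theorem extend_le {V : List Node} {E F : List (Node × Node)} {L : ℕ[X]}
    (hV : V.length ≤ L.eval n) (hV' : NodesFit n V) (hE : E.length ≤ (L * L).eval n)
    (hE' : PairsFit n E) (hF : F.length ≤ (L * L).eval n) (hF' : PairsFit n F) :
    (extend V E F).steps ≤ (extendBound L).eval n ∧
      (extend V E F).val.length ≤ (L * L).eval n ∧ PairsFit n (extend V E F).val :=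
  pairs_le hV hV' fun _ hx _ hy =>
    steps_or_le_eval (steps_isListed_le hF hF' (hV' _ hx) (hV' _ hy))
      (steps_any_le_loopBound hV fun _ hz =>
        steps_and_le_eval (steps_isListed_le hF hF' (hV' _ hx) (hV' _ hz))
          (steps_isListed_le hE hE' (hV' _ hz) (hV' _ hy)))

noncomputable def transClosureBound (L : ℕ[X]) : ℕ[X] := L * (1 + extendBound L) + 1

theorem rounds_le {V : List Node} {E : List (Node × Node)} {L : ℕ[X]}
    (hV : V.length ≤ L.eval n) (hV' : NodesFit n V) (hE : E.length ≤ (L * L).eval n)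
    (hE' : PairsFit n E) (l : List Node) :
    ∀ F : List (Node × Node), F.length ≤ (L * L).eval n → PairsFit n F →
    (rounds V E l F).steps ≤ l.length * (1 + (extendBound L).eval n) + 1 ∧
      (rounds V E l F).val.length ≤ (L * L).eval n ∧ PairsFit n (rounds V E l F).val := by
  induction l with
  | nil => exact fun F hF hF' => ⟨by simp [rounds], hF, hF'⟩
  | cons x l ih =>
    intro F hF hF'
    have h1 := extend_le hV hV' hE hE' hF hF'
    have h2 := ih _ h1.2.1 h1.2.2
    refine ⟨?_, h2.2⟩
    simp only [rounds, steps_bind, steps_tick, List.length_cons]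
    rw [Nat.add_mul, Nat.one_mul]
    omega

theorem transClosure_le {V : List Node} {E : List (Node × Node)} {L : ℕ[X]}
    (hV : V.length ≤ L.eval n) (hV' : NodesFit n V) (hE : E.length ≤ (L * L).eval n)
    (hE' : PairsFit n E) :
    (transClosure V E).steps ≤ (transClosureBound L).eval n ∧
      (transClosure V E).val.length ≤ (L * L).eval n ∧ PairsFit n (transClosure V E).val := by
  have h := rounds_le hV hV' hE hE' V E hE hE'
  refine ⟨h.1.trans ?_, h.2⟩
  simp only [transClosureBound, eval_add, eval_mul, eval_one]
  exact Nat.add_le_add_right (Nat.mul_le_mul_right _ hV) 1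

/-! ### Cost of the final tests and of the whole search -/

noncomputable def reachableBound (L : ℕ[X]) : ℕ[X] :=
  1 + (1 + (1 + varBound + varBound) + 0) +
    (1 + (1 + potBound + 0) + loopBound (L * L) (1 + 0 + (1 + potBound + potBound)))

theorem steps_reachable_le {o₂ p₂ : Occ} {c₂ : Label} {oₙ pₙ : Occ} {cₙ : Label} {h : Bool}
    {TC : List (Node × Node)} {L : ℕ[X]} (hTC : TC.length ≤ (L * L).eval n)
    (hTC' : PairsFit n TC) (ho₂ : o₂.Fits n) (hp₂ : p₂.Fits n) (hoₙ : oₙ.Fits n)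
    (hpₙ : pₙ.Fits n) :
    (reachable o₂ p₂ c₂ oₙ pₙ cₙ h TC).steps ≤ (reachableBound L).eval n :=
  steps_or_le_eval
    (steps_and_le_eval (steps_and_le_eval (steps_sameOcc_le ho₂ hoₙ) (steps_sameOcc_le hp₂ hpₙ))
      (steps_pure_le_eval _)) <|
  steps_or_le_eval (steps_and_le_eval (steps_pot_le ho₂ hpₙ) (steps_pure_le_eval _)) <|
  steps_any_le_loopBound hTC fun e he =>
    steps_and_le_eval (steps_pure_le_eval _)
      (steps_and_le_eval (steps_pot_le (hTC' e he).1 ho₂) (steps_pot_le (hTC' e he).2 hpₙ))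

noncomputable def connBound : ℕ[X] := varBound + varBound + varBound + varBound

theorem steps_connected_le {o₁ p₁ : Occ} {h : Bool} {q : Occ} {d : Label} {q' : Occ} {d' : Label}
    {x y : Occ} (ho₁ : o₁.Fits n) (hp₁ : p₁.Fits n) (hq : q.Fits n) (hq' : q'.Fits n)
    (hx : x.Fits n) (hy : y.Fits n) :
    (connected o₁ p₁ h q d q' d' x.op.loc y.op.loc).steps ≤ connBound.eval n := by
  have h1 := steps_sameVar_le hx ho₁
  have h2 := steps_sameVar_le hx hp₁
  have h3 := steps_sameVar_le hy hq
  have h4 := steps_sameVar_le hy hq'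
  unfold sameVar at h1 h2 h3 h4
  simp only [connected, steps_bind, steps_pure, connBound, eval_add]
  omega

noncomputable def clashBound : ℕ[X] := loopBound X (loopBound X (1 + testBound + connBound))

theorem steps_clash_le {test : Occ → Occ → Timed Bool} {conn : Var → Var → Timed Bool}
    {l l' : List Occ} (hl : l.length ≤ n) (hl' : l'.length ≤ n)
    (htest : ∀ x ∈ l, ∀ y ∈ l', (test x y).steps ≤ testBound.eval n)
    (hconn : ∀ x ∈ l, ∀ y ∈ l', (conn x.op.loc y.op.loc).steps ≤ connBound.eval n) :
    (clash test conn l l').steps ≤ clashBound.eval n :=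
  steps_any_le_loopBound (by simpa using hl) fun x hx =>
    steps_any_le_loopBound (by simpa using hl') fun y hy =>
      steps_and_le_eval (htest x hx y hy) (hconn x hx y hy)

noncomputable def keepBound : ℕ[X] := collectBound X (1 + eqBound) 1

theorem keep_le {l : List Occ} {f : Occ → Timed Bool} (hl : l.length ≤ n)
    (hf : ∀ x ∈ l, (f x).steps ≤ (1 + eqBound).eval n) :
    (keep l f).steps ≤ keepBound.eval n ∧ (keep l f).val.length ≤ n := by
  have := collect_ite_le (g := fun a => a) hl hf
  rw [keepBound, eval_collectBound, eval_X, eval_one]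
  exact this

noncomputable def validBound : ℕ[X] :=
  keepBound + keepBound + (1 + clashBound + clashBound) + (1 + 0 + (1 + clashBound + clashBound)) +
    (1 + testBound) + (1 + (1 + testBound) + (1 + 0 + (1 + eqBound))) + (1 + 0 + clashBound) +
    (1 + 0 + clashBound)

theorem steps_validSchedule_le {τ₁ τ₂ τₙ : InTemplate} {o₁ p₁ o₂ p₂ oₙ pₙ : Occ} {c₂ cₙ : Label}
    {h : Bool} (hτ₁ : τ₁.Fits n) (hτ₂ : τ₂.Fits n) (hτₙ : τₙ.Fits n) (ho₁ : o₁.Fits n)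
    (hp₁ : p₁.Fits n) (ho₂ : o₂.Fits n) (hp₂ : p₂.Fits n) (hoₙ : oₙ.Fits n) (hpₙ : pₙ.Fits n) :
    (validSchedule τ₁ o₁ p₁ τ₂ o₂ p₂ c₂ τₙ oₙ pₙ cₙ h).steps ≤ validBound.eval n := by
  have hpre := keep_le (n := n) (f := fun o => Timed.not (ltNat o₁.pos o.pos)) hτ₁.length
    fun x hx => steps_not_le_eval (steps_ltNat_le_eval ho₁.pos (hτ₁.occs x hx).pos)
  have hpost := keep_le (n := n) (f := fun o => ltNat o₁.pos o.pos) hτ₁.length fun x hx =>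
    (steps_ltNat_le_eval ho₁.pos (hτ₁.occs x hx).pos).trans (by rw [eval_add]; omega)
  have hclash : ∀ (test : Occ → Occ → Timed Bool),
      (∀ x y, x.Fits n → y.Fits n → (test x y).steps ≤ testBound.eval n) →
      ∀ l : List Occ, l.length ≤ n → (∀ x ∈ l, x ∈ τ₁.occs) → ∀ τ : InTemplate, τ.Fits n →
      ∀ q : Occ, q.Fits n → ∀ q' : Occ, q'.Fits n → ∀ d d',
      (clash test (connected o₁ p₁ h q d q' d') l τ.occs).steps ≤ clashBound.eval n :=
    fun test htest l hl hl' τ hτ q hq q' hq' d d' => steps_clash_le hl hτ.length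
      (fun x hx y hy => htest x y (hτ₁.occs x (hl' x hx)) (hτ.occs y hy))
      fun x hx y hy => steps_connected_le ho₁ hp₁ hq hq' (hτ₁.occs x (hl' x hx)) (hτ.occs y hy)
  have hWW : ∀ x y : Occ, x.Fits n → y.Fits n → (potWW x y).steps ≤ testBound.eval n :=
    fun _ _ => steps_potWW_le
  have hWR : ∀ x y : Occ, x.Fits n → y.Fits n → (potWR x y).steps ≤ testBound.eval n :=
    fun _ _ => steps_potWR_le
  have hRW : ∀ x y : Occ, x.Fits n → y.Fits n → (potRW x y).steps ≤ testBound.eval n :=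
    fun _ _ => steps_potRW_le
  have hpre' := fun x => (mem_val_keep (l := τ₁.occs)
    (f := fun o => Timed.not (ltNat o₁.pos o.pos)) (a := x)).1
  have hpost' := fun x => (mem_val_keep (l := τ₁.occs)
    (f := fun o => ltNat o₁.pos o.pos) (a := x)).1
  have b1 := steps_or_le_eval
    (hclash _ hWW _ hpre.2 (fun x hx => (hpre' x hx).1) τ₂ hτ₂ p₂ hp₂ o₂ ho₂ .O c₂)
    (hclash _ hWW _ hpre.2 (fun x hx => (hpre' x hx).1) τₙ hτₙ oₙ hoₙ pₙ hpₙ .P cₙ)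
  have b2 := steps_and_le_eval (steps_pure_le_eval (decide (τ₁.level ≠ .RC))) (steps_or_le_eval
    (hclash _ hWW _ hpost.2 (fun x hx => (hpost' x hx).1) τ₂ hτ₂ p₂ hp₂ o₂ ho₂ .O c₂)
    (hclash _ hWW _ hpost.2 (fun x hx => (hpost' x hx).1) τₙ hτₙ oₙ hoₙ pₙ hpₙ .P cₙ))
  have b3 := steps_not_le_eval (steps_potRW_le ho₁ hp₂)
  have b4 := steps_and_le_eval (steps_not_le_eval (steps_potRW_le hoₙ hp₁))
    (steps_or_le_eval (steps_pure_le_eval (decide (τ₁.level ≠ .RC)))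
      (steps_not_le_eval (steps_ltNat_le_eval ho₁.pos hp₁.pos)))
  have b5 := steps_and_le_eval
    (steps_pure_le_eval (decide (τ₁.level = .SSI) && decide (τ₂.level = .SSI)))
    (hclash _ hWR _ hτ₁.length (fun _ hx => hx) τ₂ hτ₂ p₂ hp₂ o₂ ho₂ .O c₂)
  have b6 := steps_and_le_eval
    (steps_pure_le_eval (decide (τ₁.level = .SSI) && decide (τₙ.level = .SSI)))
    (hclash _ hRW _ hτ₁.length (fun _ hx => hx) τₙ hτₙ oₙ hoₙ pₙ hpₙ .P cₙ)
  -- Regrouped in the order of the tests, so that the bounds can be peeled off one at a time.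
  have hsum : validBound.eval n = keepBound.eval n + (keepBound.eval n +
      ((1 + clashBound + clashBound).eval n + ((1 + 0 + (1 + clashBound + clashBound)).eval n +
      ((1 + testBound).eval n + ((1 + (1 + testBound) + (1 + 0 + (1 + eqBound))).eval n +
      ((1 + 0 + clashBound).eval n + (1 + 0 + clashBound).eval n)))))) := by
    simp only [validBound, eval_add]
    ring
  rw [hsum]
  simp only [validSchedule, steps_bind]
  refine Nat.add_le_add hpre.1 (Nat.add_le_add hpost.1 (Nat.add_le_add b1 ?_))
  refine (steps_ite_pure_le _ _ _).trans (Nat.add_le_add b2 ?_)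
  refine (steps_ite_pure_le _ _ _).trans (Nat.add_le_add b3 ?_)
  refine (steps_ite_pure_le _ _ _).trans (Nat.add_le_add b4 ?_)
  -- The test for three SSI levels is free, so two branches are passed at once.
  refine (steps_ite_pure_le _ _ _).trans ((steps_ite_pure_le _ _ _).trans (Nat.add_le_add b5 ?_))
  exact (steps_ite_pure_le _ _ _).trans ((Nat.add_le_add b6 (steps_ite_pure_le _ _ _)))

noncomputable def witnessBound (L : ℕ[X]) : ℕ[X] :=
  (1 + (1 + potBound) + (1 + potBound)) + (varBound + (varBound +
    loopBound 2 (loopBound 2 (1 + reachableBound L + validBound))))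

theorem steps_witness_le {τ₁ τ₂ τₙ : InTemplate} {o₁ p₁ o₂ p₂ oₙ pₙ : Occ} {h : Bool}
    {TC : List (Node × Node)} {L : ℕ[X]} (hTC : TC.length ≤ (L * L).eval n)
    (hTC' : PairsFit n TC) (hτ₁ : τ₁.Fits n) (hτ₂ : τ₂.Fits n) (hτₙ : τₙ.Fits n)
    (ho₁ : o₁.Fits n) (hp₁ : p₁.Fits n) (ho₂ : o₂.Fits n) (hp₂ : p₂.Fits n) (hoₙ : oₙ.Fits n)
    (hpₙ : pₙ.Fits n) :
    (witness τ₁ o₁ p₁ h TC τ₂ o₂ p₂ τₙ oₙ pₙ).steps ≤ (witnessBound L).eval n := by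
  have b1 := steps_or_le_eval (steps_not_le_eval (steps_pot_le ho₁ hp₂))
    (steps_not_le_eval (steps_pot_le hoₙ hp₁))
  simp only [witness, steps_bind]
  rw [witnessBound, eval_add]
  refine Nat.add_le_add b1 ((steps_ite_pure_le _ _ _).trans ?_)
  rw [eval_add, eval_add]
  refine Nat.add_le_add (steps_sameVar_le ho₂ hp₂) (Nat.add_le_add (steps_sameVar_le hoₙ hpₙ) ?_)
  exact steps_any_le_loopBound (by rw [eval_ofNat]; split_ifs <;> simp) fun c₂ _ =>
    steps_any_le_loopBound (by rw [eval_ofNat]; split_ifs <;> simp) fun cₙ _ =>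
      steps_and_le_eval (steps_reachable_le hTC hTC' ho₂ hp₂ hoₙ hpₙ)
        (steps_validSchedule_le hτ₁ hτ₂ hτₙ ho₁ hp₁ ho₂ hp₂ hoₙ hpₙ)

noncomputable def searchBound : ℕ[X] :=
  nodesBound + (edgesBound nodesLength + (transClosureBound nodesLength +
    loopBound X (loopBound X (loopBound X (loopBound X (loopBound X (loopBound X
      (witnessBound nodesLength))))))))

noncomputable def decideRobustBound : ℕ[X] :=
  (X * (1 + X + (X * (1 + 2 * X) + 1)) + 1) +
    loopBound X (loopBound X (loopBound X (varBound + loopBound 2 searchBound)))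

/-- The nesting depth of the loops is fixed and each of them has length at most the input size or
`2`; the graph and its closure are built once for each choice of `τ₁`, `o₁`, `p₁` and `h`. -/
theorem steps_decideRobust_le (P : List Template) (A : Template → Level) :
    (decideRobust (P.map fun τ => (τ, A τ))).steps ≤ decideRobustBound.eval (templatesSize P) := by
  obtain ⟨hQ, hQ'⟩ := fits_numberTemplates P A
  have hnum : (numberTemplates 0 (P.map fun τ => (τ, A τ))).steps ≤
      (X * (1 + X + (X * (1 + 2 * X) + 1)) + 1 : ℕ[X]).eval (templatesSize P) := by
    simp only [eval_add, eval_mul, eval_X, eval_one, eval_ofNat]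
    have hlen : P.length ≤ templatesSize P :=
      length_le_sum_map _ _ fun t _ => by unfold templateSize; omega
    refine (steps_numberTemplates_le (n := templatesSize P) (fun x hx => ?_) ?_).trans
      (Nat.add_le_add_right (Nat.mul_le_mul_right _ ?_) 1)
    · obtain ⟨t, ht, rfl⟩ := List.mem_map.1 hx
      have h1 : templateSize t ≤ templatesSize P := le_sum_map templateSize ht
      have h2 : t.length ≤ (t.map opSize).sum :=
        length_le_sum_map _ _ fun o _ => by unfold opSize; omega
      unfold templateSize at h1
      dsimp only
      omega
    · rwa [List.length_map, Nat.zero_add]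
    · rwa [List.length_map]
  set n := templatesSize P
  set Q := numberTemplates 0 (P.map fun τ => (τ, A τ))
  have hl : Q.val.length ≤ (X : ℕ[X]).eval n := by rwa [eval_X]
  have hl' : ∀ τ ∈ Q.val, τ.occs.length ≤ (X : ℕ[X]).eval n := fun τ hτ => by
    rw [eval_X]
    exact (hQ' τ hτ).length
  have hfit : ∀ τ ∈ Q.val, ∀ o ∈ τ.occs, o.Fits n := fun τ hτ => (hQ' τ hτ).occs
  simp only [decideRobust, steps_bind, steps_pure, Nat.add_zero]
  rw [decideRobustBound, eval_add]
  refine Nat.add_le_add hnum ?_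
  refine steps_any_le_loopBound hl fun τ₁ hτ₁ => steps_any_le_loopBound (hl' _ hτ₁) fun o₁ ho₁ =>
    steps_any_le_loopBound (hl' _ hτ₁) fun p₁ hp₁ => ?_
  have ho₁ := hfit _ hτ₁ _ ho₁
  have hp₁ := hfit _ hτ₁ _ hp₁
  rw [steps_bind, eval_add]
  refine Nat.add_le_add (steps_sameVar_le ho₁ hp₁) (steps_any_le_loopBound
    (by rw [eval_ofNat]; split_ifs <;> simp) fun h _ => ?_)
  have hV := nodes_le h hQ hQ' (hQ' _ hτ₁) ho₁ hp₁
  have hE := edges_le h hV.2.1 hV.2.2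
  have hTC := transClosure_le hV.2.1 hV.2.2 hE.2.1 hE.2.2
  simp only [steps_bind]
  rw [searchBound, eval_add, eval_add, eval_add]
  refine Nat.add_le_add hV.1 (Nat.add_le_add hE.1 (Nat.add_le_add hTC.1 ?_))
  exact steps_any_le_loopBound hl fun τ₂ hτ₂ => steps_any_le_loopBound (hl' _ hτ₂) fun o₂ ho₂ =>
    steps_any_le_loopBound (hl' _ hτ₂) fun p₂ hp₂ => steps_any_le_loopBound hl fun τₙ hτₙ =>
    steps_any_le_loopBound (hl' _ hτₙ) fun oₙ hoₙ => steps_any_le_loopBound (hl' _ hτₙ)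
    fun pₙ hpₙ => steps_witness_le hTC.2.1 hTC.2.2 (hQ' _ hτ₁) (hQ' _ hτ₂) (hQ' _ hτₙ) ho₁ hp₁
      (hfit _ hτ₂ _ ho₂) (hfit _ hτ₂ _ hp₂) (hfit _ hτₙ _ hoₙ) (hfit _ hτₙ _ hpₙ)

end Algo

end TemplateRobustness

open TemplateRobustness in
theorem mainTheorem1 :
    (∀ (P : List Template) (A : Template → Level),
      (Algo.decideRobust (P.map fun τ => (τ, A τ))).val = true ↔ Robust {τ | τ ∈ P} A) ∧
    ∃ p : Polynomial ℕ, ∀ (P : List Template) (A : Template → Level),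
      (Algo.decideRobust (P.map fun τ => (τ, A τ))).steps ≤ p.eval (templatesSize P) :=
  ⟨Algo.val_decideRobust_iff, Algo.decideRobustBound, Algo.steps_decideRobust_le⟩
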